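/- Let $X=\operatorname{Proj}\mathbb{Q}[x,y,z,w]/(x^3y+y^3z+z^3w+w^3x+xyzw)$, let $\mathcal{X}\subseteq\mathbb{P}^3_{\mathbb{Z}}$ be the projective scheme over $\mathbb{Z}$ defined by the same equation, let $\mathcal{X}_2=\mathcal{X}\times_{\mathbb{Z}}\mathbb{Z}_2$, and let $Y=\mathcal{X}_2\times_{\mathbb{Z}_2}\mathbb{F}_2$ be its reduction modulo $2$. Then $Y$ is an ordinary K3 surface over $\mathbb{F}_2$; that is, $Y$ is a smooth, proper, geometrically integral surface over $\mathbb{F}_2$ with $\Omega^2_{Y/\mathbb{F}_2}\cong\mathcal{O}_Y$ and $H^1(Y,\mathcal{O}_Y)=0$, and the Frobenius endomorphism of $H^2(Y,\mathcal{O}_Y)$ is bijective. Moreover $|Y(\mathbb{F}_2)|=10$. The scheme $\mathcal{X}_2$ is smooth and proper over $\mathbb{Z}_2$ and its generic fibre is isomorphic to $X\times_{\mathbb{Q}}\mathbb{Q}_2$ over $\mathbb{Q}_2$; hence $X$ has good ordinary reduction at $2$. -/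

import Mathlib

open CategoryTheory CategoryTheory.Limits AlgebraicGeometry

universe u

namespace OrdinaryK3

noncomputable section

/-! ### Sections of the structure sheaf -/

/-- The structure homomorphism `k → Γ(Y, U)` of the sections of a `k`-scheme `Y`. -/
def scalars {k : Type u} [CommRing k] {Y : Scheme.{u}} (f : Y ⟶ Spec (.of k)) (U : Y.Opens) :
    k →+* Γ(Y, U) :=
  ((Scheme.ΓSpecIso (.of k)).inv ≫ f.appTop ≫ Y.presheaf.map (homOfLE le_top).op).hom

/-- The restriction homomorphism `Γ(Y, U) → Γ(Y, V)`. -/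
def restrict {Y : Scheme.{u}} {U V : Y.Opens} (h : V ≤ U) : Γ(Y, U) →+* Γ(Y, V) :=
  (Y.presheaf.map (homOfLE h).op).hom

lemma restrict_comp_scalars {k : Type u} [CommRing k] {Y : Scheme.{u}} (f : Y ⟶ Spec (.of k))
    {U V : Y.Opens} (h : V ≤ U) : (restrict h).comp (scalars f U) = scalars f V := by
  rw [scalars, scalars, restrict, ← CommRingCat.hom_comp, Category.assoc, Category.assoc,
    ← Functor.map_comp]
  rfl

lemma natCast_eq_zero {k : Type u} [CommRing k] (p : ℕ) [CharP k p] {Y : Scheme.{u}}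
    (f : Y ⟶ Spec (.of k)) (U : Y.Opens) : (p : Γ(Y, U)) = 0 := by
  rw [← map_natCast (scalars f U), CharP.cast_eq_zero, map_zero]

/-! ### Cohomology of the structure sheaf, and Frobenius -/

/-- The structure sheaf `𝒪_Y`, as a sheaf of abelian groups on the topological space `Y`. -/
abbrev structureSheafAb (Y : Scheme.{u}) :
    Sheaf (Opens.grothendieckTopology Y) AddCommGrpCat.{u} :=
  (sheafCompose _ (forget₂ CommRingCat.{u} RingCat.{u} ⋙ forget₂ RingCat.{u} AddCommGrpCat.{u})).obj
    Y.sheaf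

/-- The `n`-th (Zariski) sheaf cohomology group `Hⁿ(Y, 𝒪_Y)`. -/
abbrev H (Y : Scheme.{u}) (n : ℕ) : Type u := Sheaf.H.{u} (structureSheafAb Y) n

/-- The additive map `s ↦ s ^ p` of a commutative ring in which the prime `p` is zero. -/
def powHom (p : ℕ) [Fact p.Prime] {A : Type u} [CommRing A] (hp : (p : A) = 0) : A →+ A where
  toFun s := s ^ p
  map_zero' := zero_pow (Fact.out : p.Prime).ne_zero
  map_add' s t := by
    rw [add_pow_prime_eq (Fact.out : p.Prime), hp]
    ring

/-- The endomorphism of the abelian sheaf `𝒪_Y` given by the absolute Frobenius of a scheme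
`Y` of characteristic `p`: the identity on the topological space, `s ↦ s ^ p` on sections. -/
def frobenius {k : Type u} [CommRing k] (p : ℕ) [Fact p.Prime] [CharP k p] {Y : Scheme.{u}}
    (f : Y ⟶ Spec (.of k)) : structureSheafAb Y ⟶ structureSheafAb Y where
  hom :=
    { app := fun U => AddCommGrpCat.ofHom (powHom (A := Γ(Y, U.unop)) p (natCast_eq_zero p f U.unop))
      naturality := by
        intro U V i
        ext s
        exact (map_pow (Y.presheaf.map i).hom (show Γ(Y, U.unop) from s) p).symm }

/-! ### Differential 2-forms -/

/-- For a homomorphism `A → B` of `k`-algebras, the induced map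
`⋀²_A Ω_{A/k} → ⋀²_B Ω_{B/k}`, `da ∧ da' ↦ d(a|_B) ∧ d(a'|_B)`. -/
def exteriorSquareMap (k A B : Type u) [CommRing k] [CommRing A] [CommRing B] [Algebra k A]
    [Algebra k B] [Algebra A B] [IsScalarTower k A B] :
    ⋀[A]^2 (Ω[A⁄k]) →ₗ[A] ⋀[B]^2 (Ω[B⁄k]) :=
  exteriorPower.alternatingMapLinearEquiv
    { ((exteriorPower.ιMulti B 2 (M := Ω[B⁄k])).toMultilinearMap.restrictScalars A).compLinearMap
        fun _ => KaehlerDifferential.map k k A B with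
      map_eq_zero_of_eq' := fun _ _ _ hv hij =>
        (exteriorPower.ιMulti B 2 (M := Ω[B⁄k])).map_eq_zero_of_eq _
          (congrArg (KaehlerDifferential.map k k A B) hv) hij }

/-- The `A`-module `Ω²_{A/k} = ⋀²_A Ω_{A/k}` of Kähler 2-forms of a ring homomorphism `k → A`. -/
abbrev TwoForms {k A : Type u} [CommRing k] [CommRing A] (φ : k →+* A) : Type u :=
  letI := φ.toAlgebra
  ⋀[A]^2 (Ω[A⁄k])

/-- The pullback of 2-forms along a homomorphism `g : A → B` of `k`-algebras. -/
def TwoForms.map {k A B : Type u} [CommRing k] [CommRing A] [CommRing B] {φ : k →+* A}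
    {ψ : k →+* B} (g : A →+* B) (hg : g.comp φ = ψ) : TwoForms φ → TwoForms ψ :=
  letI := φ.toAlgebra
  letI := ψ.toAlgebra
  letI := g.toAlgebra
  haveI : IsScalarTower k A B := .of_algebraMap_eq' hg.symm
  exteriorSquareMap k A B

/-- A global section of the sheaf `Ω²_{Y/k} = ⋀² Ω_{Y/k}`. As this sheaf is quasi-coherent with
sections `⋀² Ω_{Γ(Y, U)/k}` on an affine open `U`, and the affine opens are a basis of the
topology, this is a family of 2-forms on all affine opens, compatible with restrictions. -/
structure GlobalTwoForm {k : Type u} [CommRing k] {Y : Scheme.{u}} (f : Y ⟶ Spec (.of k)) where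
  /-- The restriction of the form to an affine open. -/
  form (U : Y.affineOpens) : TwoForms (scalars f U.1)
  map_form (U V : Y.affineOpens) (h : V.1 ≤ U.1) :
    TwoForms.map (restrict h) (restrict_comp_scalars f h) (form U) = form V

/-- The homomorphism `𝒪_Y → Ω²_{Y/k}`, `a ↦ a • ω`, is an isomorphism. -/
def GlobalTwoForm.Trivializes {k : Type u} [CommRing k] {Y : Scheme.{u}} {f : Y ⟶ Spec (.of k)}
    (ω : GlobalTwoForm f) : Prop :=
  ∀ U : Y.affineOpens, Function.Bijective fun a : Γ(Y, U.1) => a • ω.form U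

/-! ### K3 surfaces -/

/-- A K3 surface over a field `k`: a smooth proper geometrically integral surface `Y` over `k`
with `Ω²_{Y/k} ≅ 𝒪_Y` and `H¹(Y, 𝒪_Y) = 0`. -/
structure IsK3Surface {k : Type u} [Field k] {Y : Scheme.{u}} (f : Y ⟶ Spec (.of k)) : Prop where
  isProper : IsProper f
  smooth : SmoothOfRelativeDimension 2 f
  geometricallyIntegral : GeometricallyIntegral f
  canonical_trivial : ∃ ω : GlobalTwoForm f, ω.Trivializes
  h1_eq_zero : Subsingleton (H Y 1)

/-- An ordinary K3 surface over a (perfect) field `k` of characteristic `p`: a K3 surface for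
which the Frobenius endomorphism of `H²(Y, 𝒪_Y)` is bijective. -/
structure IsOrdinaryK3Surface {k : Type u} [Field k] (p : ℕ) [Fact p.Prime] [CharP k p]
    {Y : Scheme.{u}} (f : Y ⟶ Spec (.of k)) : Prop where
  isK3Surface : IsK3Surface f
  frobenius_bijective : Function.Bijective (Sheaf.H.map (frobenius p f) 2)

/-! ### Rational points and base change -/

/-- The set `Y(R)` of `R`-points of an `R`-scheme `Y`. -/
def Points {R : Type u} [CommRing R] {Y : Scheme.{u}} (f : Y ⟶ Spec (.of R)) : Type u :=
  { s : Spec (.of R) ⟶ Y // s ≫ f = 𝟙 _ }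

/-- The structure morphism `Y ×_R S ⟶ Spec S` of the base change of an `R`-scheme `Y` along
`φ : R → S`. -/
def baseChange {R S : Type u} [CommRing R] [CommRing S] {Y : Scheme.{u}} (f : Y ⟶ Spec (.of R))
    (φ : R →+* S) : pullback f (Spec.map (CommRingCat.ofHom φ)) ⟶ Spec (.of S) :=
  pullback.snd f (Spec.map (CommRingCat.ofHom φ))

/-- The `ℤ_p`-scheme `g` is a model with good reduction of the `ℚ`-scheme `f`: it is smooth and
proper over `ℤ_p`, and its generic fibre is isomorphic to `X ×_ℚ ℚ_p` over `ℚ_p`. -/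
structure IsGoodModelAt (p : ℕ) [Fact p.Prime] {X M : Scheme.{0}} (f : X ⟶ Spec (.of ℚ))
    (g : M ⟶ Spec (.of ℤ_[p])) : Prop where
  smooth : Smooth g
  isProper : IsProper g
  generic_fibre : Nonempty
    (Over.mk (baseChange g (algebraMap ℤ_[p] ℚ_[p])) ≅ Over.mk (baseChange f (algebraMap ℚ ℚ_[p])))

/-! ### Projective hypersurfaces -/

section Grading

variable {R A : Type u} [CommRing R] [CommRing A] [Algebra R A] (𝒜 : ℕ → Submodule R A)
  [GradedAlgebra 𝒜]

/-- The grading on `A ⧸ I` by the images of the homogeneous parts of `A`. -/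
def quotientGrading (I : Ideal A) (i : ℕ) : Submodule R (A ⧸ I) :=
  (𝒜 i).map (Ideal.Quotient.mkₐ R I).toLinearMap

/-- The map of `𝒜 i` onto the `i`-th part of the quotient. -/
def quotientGradingMk (I : Ideal A) (i : ℕ) : 𝒜 i →+ quotientGrading 𝒜 I i where
  toFun a := ⟨Ideal.Quotient.mk I a, Submodule.mem_map_of_mem a.2⟩
  map_zero' := by ext; simp
  map_add' a b := by ext; simp

/-- `A → ⨁ (A ⧸ I)_i`. -/
def quotientGradingDecompose (I : Ideal A) : A →+ DirectSum ℕ fun i => quotientGrading 𝒜 I i :=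
  (DirectSum.map (quotientGradingMk 𝒜 I)).comp (DirectSum.decomposeAddEquiv 𝒜).toAddMonoidHom

lemma quotientGradingDecompose_of_mem (I : Ideal A) {i : ℕ} {a : A} (ha : a ∈ 𝒜 i) :
    quotientGradingDecompose 𝒜 I a =
      DirectSum.of (fun i => quotientGrading 𝒜 I i) i (quotientGradingMk 𝒜 I i ⟨a, ha⟩) := by
  simp [quotientGradingDecompose, DirectSum.decompose_of_mem 𝒜 ha, DirectSum.map_of]

lemma quotientGradingDecompose_eq_zero {I : Ideal A} (hI : I.IsHomogeneous 𝒜) {a : A}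
    (ha : a ∈ I) : quotientGradingDecompose 𝒜 I a = 0 := by
  refine DFinsupp.ext fun i => Subtype.ext ?_
  have h := Ideal.Quotient.eq_zero_iff_mem.mpr (hI i ha)
  simpa [quotientGradingDecompose, quotientGradingMk] using h

/-- `A ⧸ I → ⨁ (A ⧸ I)_i`. -/
def quotientDecompose {I : Ideal A} (hI : I.IsHomogeneous 𝒜) :
    A ⧸ I →+ DirectSum ℕ fun i => quotientGrading 𝒜 I i :=
  QuotientAddGroup.lift I.toAddSubgroup (quotientGradingDecompose 𝒜 I)
    fun _ ha => AddMonoidHom.mem_ker.mpr (quotientGradingDecompose_eq_zero 𝒜 hI ha)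

lemma quotientDecompose_mk {I : Ideal A} (hI : I.IsHomogeneous 𝒜) (a : A) :
    quotientDecompose 𝒜 hI (Ideal.Quotient.mk I a) = quotientGradingDecompose 𝒜 I a :=
  rfl

lemma coe_quotientGradingDecompose (I : Ideal A) (a : A) :
    DirectSum.coeAddMonoidHom (quotientGrading 𝒜 I) (quotientGradingDecompose 𝒜 I a) =
      Ideal.Quotient.mk I a := by
  induction a using DirectSum.Decomposition.inductionOn 𝒜 with
  | zero => simp
  | homogeneous a =>
    rw [quotientGradingDecompose_of_mem 𝒜 I a.2, DirectSum.coeAddMonoidHom_of]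
    rfl
  | add a b ha hb => rw [map_add, map_add, ha, hb, map_add]

lemma quotientDecompose_of_mem {I : Ideal A} (hI : I.IsHomogeneous 𝒜) {i : ℕ}
    (x : quotientGrading 𝒜 I i) :
    quotientDecompose 𝒜 hI x = DirectSum.of (fun i => quotientGrading 𝒜 I i) i x := by
  obtain ⟨_, a, ha, rfl⟩ := x
  exact (quotientDecompose_mk 𝒜 hI a).trans (quotientGradingDecompose_of_mem 𝒜 I ha)

/-- The quotient of a graded algebra by a homogeneous ideal is graded. -/
@[reducible]
def quotientGradedAlgebra {I : Ideal A} (hI : I.IsHomogeneous 𝒜) :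
    GradedAlgebra (quotientGrading 𝒜 I) where
  one_mem := ⟨1, SetLike.GradedOne.one_mem, rfl⟩
  mul_mem := by
    rintro i j _ _ ⟨a, ha, rfl⟩ ⟨b, hb, rfl⟩
    exact ⟨a * b, SetLike.GradedMul.mul_mem ha hb, rfl⟩
  decompose' := quotientDecompose 𝒜 hI
  left_inv x := by
    obtain ⟨a, rfl⟩ := Ideal.Quotient.mk_surjective x
    exact coe_quotientGradingDecompose 𝒜 I a
  right_inv x := by
    induction x using DirectSum.induction_on with
    | zero => rw [map_zero, map_zero]
    | of i x => rw [DirectSum.coeAddMonoidHom_of, quotientDecompose_of_mem]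
    | add x y hx hy => rw [map_add, map_add, hx, hy]

end Grading

section Hypersurface

attribute [local instance] MvPolynomial.gradedAlgebra

variable (R : Type u) [CommRing R]

/-- The polynomial `x³y + y³z + z³w + w³x + xyzw`. -/
def quartic : MvPolynomial (Fin 4) R :=
  .X 0 ^ 3 * .X 1 + .X 1 ^ 3 * .X 2 + .X 2 ^ 3 * .X 3 + .X 3 ^ 3 * .X 0 +
    .X 0 * .X 1 * .X 2 * .X 3

lemma quartic_isHomogeneous : (quartic R).IsHomogeneous 4 := by
  have hX (i : Fin 4) : (MvPolynomial.X i : MvPolynomial (Fin 4) R).IsHomogeneous 1 :=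
    MvPolynomial.isHomogeneous_X R i
  have h3 (i j : Fin 4) := ((hX i).pow 3).mul (hX j)
  exact ((((h3 0 1).add (h3 1 2)).add (h3 2 3)).add (h3 3 0)).add
    ((((hX 0).mul (hX 1)).mul (hX 2)).mul (hX 3))

/-- The homogeneous ideal generated by the quartic. -/
def quarticIdeal : Ideal (MvPolynomial (Fin 4) R) := Ideal.span {quartic R}

lemma quarticIdeal_isHomogeneous :
    (quarticIdeal R).IsHomogeneous (MvPolynomial.homogeneousSubmodule (Fin 4) R) := by
  refine Ideal.homogeneous_span _ _ ?_
  rintro _ rfl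
  exact ⟨4, quartic_isHomogeneous R⟩

/-- The grading of the homogeneous coordinate ring `R[x, y, z, w] / (quartic)`. -/
abbrev coordGrading : ℕ → Submodule R (MvPolynomial (Fin 4) R ⧸ quarticIdeal R) :=
  quotientGrading (MvPolynomial.homogeneousSubmodule (Fin 4) R) (quarticIdeal R)

instance : GradedAlgebra (coordGrading R) :=
  quotientGradedAlgebra _ (quarticIdeal_isHomogeneous R)

/-- The projective quartic `Proj R[x, y, z, w] / (x³y + y³z + z³w + w³x + xyzw)`. -/
def quarticScheme : Scheme.{u} := Proj (coordGrading R)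

/-- The structure morphism of the projective quartic over `R`. -/
def quarticStr : quarticScheme R ⟶ Spec (.of R) :=
  Proj.toSpecZero (coordGrading R) ≫
    Spec.map (CommRingCat.ofHom (algebraMap R (coordGrading R 0)))

end Hypersurface

/-- The base change of the quartic over `ℤ` to `ℤ₂`. -/
abbrev model₂ := baseChange (quarticStr ℤ) (algebraMap ℤ ℤ_[2])

/-- The reduction of `model₂` at `2`, over `𝔽₂ = ZMod 2`. -/
abbrev reduction₂ := baseChange model₂ (PadicInt.toZMod (p := 2))

end

end OrdinaryK3

/-! All schemes in the statement come from one construction, the quartic over an arbitrary ring `R`.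
Its four charts represent the zeros of the quartic form with one coordinate equal to `1`, so its
formation commutes with base change (`quarticMap_isPullback`). Hence the reduction is the quartic
over `ZMod 2`, and both generic fibres are the quartic over `ℚ_[2]`.

Smoothness: modulo the equation, three partial derivatives together with `2` generate the unit ideal
of a chart (`quartic_certificate`), so points of residue characteristic two are smooth. Over
`ℤ_[2]`, properness would move any other singular point to one over the closed point. Integrality
over every field: a chart embeds in the domain defined by a monic cubic without roots, and the
charts meet.

Canonical bundle: in characteristic two let `F_j` be the partial derivatives and put `η = (t_a dt_b
∧ dt_c + t_b dt_a ∧ dt_c + t_c dt_a ∧ dt_b) / F_j`, where `a, b, c` are the indices other than `j`.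
The relation `dF = 0` and Euler's relation show that `η` does not depend on `j`; being of weight
zero, it does not depend on the chart either. It generates the two-forms wherever `F_j` is
invertible. Working inside the two-forms of the function field makes gluing automatic
(`exists_trivializes`).

Cohomology: Mayer-Vietoris and vanishing on affine opens reduce `H¹` and `H²` to Čech computations
with three affine opens. Modulo two the point `(1 : 1 : 1 : 1)` is not on the quartic, so `a = x +
w`, `b = y + w`, `c = z + w` have no common zero on it, and the coordinate ring is free over `K[a,
b, c]` with basis `1, w, w², w³`. Thus `a, b, c` is a regular sequence, and exactness of the Koszul
complex gives `H¹ = 0`. The group `H²` is spanned by the class of `w³ / (abc)`. Since `w⁶ ≡ abc w³`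
modulo `(a², b², c²)` (`coord_pow_six`), Frobenius fixes this class, and over `𝔽₂` it is the
identity on `H²`.

Points: a point over `𝔽₂` has a unique vector of homogeneous coordinates, so counting is an
enumeration of vectors. -/

namespace OrdinaryK3

noncomputable section

/-! ### Cohomology of opens as Ext from free sheaves, and Mayer-Vietoris -/

section Cohomology

open TopologicalSpace Opposite Abelian

variable {T : Type u} [TopologicalSpace T]

/-- The free abelian sheaf on (the sheaf represented by) an open subset. -/
abbrev freeSheaf (U : Opens T) : Sheaf (Opens.grothendieckTopology T) AddCommGrpCat.{u} :=
  (presheafToSheaf (Opens.grothendieckTopology T) AddCommGrpCat.{u}).obj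
    (yoneda.obj U ⋙ AddCommGrpCat.free)

/-- The map of free abelian sheaves attached to an inclusion of open subsets. -/
def freeSheafMap {U V : Opens T} (h : V ≤ U) : freeSheaf V ⟶ freeSheaf U :=
  (presheafToSheaf (Opens.grothendieckTopology T) AddCommGrpCat.{u}).map
    (Functor.whiskerRight (yoneda.map (homOfLE h)) _)

lemma freeSheafMap_comp {U V W : Opens T} (h : V ≤ U) (h' : W ≤ V) :
    freeSheafMap h' ≫ freeSheafMap h = freeSheafMap (h'.trans h) := by
  rw [freeSheafMap, freeSheafMap, ← Functor.map_comp, ← Functor.whiskerRight_comp,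
    ← Functor.map_comp]
  rfl

variable {F G : Sheaf (Opens.grothendieckTopology T) AddCommGrpCat.{u}}

/-- Restriction of cohomology classes to a smaller open subset. -/
def resExt {U V : Opens T} (h : V ≤ U) {n : ℕ} (x : Ext.{u} (freeSheaf U) F n) :
    Ext.{u} (freeSheaf V) F n :=
  (Ext.mk₀ (freeSheafMap h)).comp x (zero_add n)

lemma resExt_resExt {U V W : Opens T} (h : V ≤ U) (h' : W ≤ V) {n : ℕ}
    (x : Ext.{u} (freeSheaf U) F n) : resExt h' (resExt h x) = resExt (h'.trans h) x := by
  rw [resExt, resExt, resExt, Ext.mk₀_comp_mk₀_assoc, freeSheafMap_comp]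

@[simp]
lemma resExt_zero {U V : Opens T} (h : V ≤ U) {n : ℕ} :
    resExt h (0 : Ext.{u} (freeSheaf U) F n) = 0 := by
  simp [resExt]

lemma resExt_comp {U V : Opens T} (h : V ≤ U) {n m p : ℕ} (x : Ext.{u} (freeSheaf U) F n)
    (y : Ext.{u} F G m) (hp : n + m = p) :
    resExt h (x.comp y hp) = (resExt h x).comp y hp := by
  rw [resExt, resExt, Ext.comp_assoc]
  omega

/-- The canonical section of the free abelian sheaf on `U` over `U`. -/
def freeSheafGen (U : Opens T) : (freeSheaf U).obj.obj (op U) :=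
  (toSheafify (Opens.grothendieckTopology T) (yoneda.obj U ⋙ AddCommGrpCat.free)).app (op U)
    (FreeAbelianGroup.of (𝟙 U))

lemma freeSheafMap_gen {U V : Opens T} (h : V ≤ U) :
    (freeSheafMap h).hom.app (op V) (freeSheafGen V) =
      (freeSheaf U).obj.map (homOfLE h).op (freeSheafGen U) := by
  have h₁ := ConcreteCategory.congr_hom (NatTrans.congr_app
    (toSheafify_naturality (Opens.grothendieckTopology T)
      (Functor.whiskerRight (yoneda.map (homOfLE h)) AddCommGrpCat.free)) (op V))
      (FreeAbelianGroup.of (𝟙 V))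
  have h₂ := ConcreteCategory.congr_hom ((toSheafify (Opens.grothendieckTopology T)
    (yoneda.obj U ⋙ AddCommGrpCat.free)).naturality (homOfLE h).op)
      (FreeAbelianGroup.of (𝟙 U))
  refine Eq.trans h₁.symm (Eq.trans ?_ h₂)
  refine congrArg (ConcreteCategory.hom ((toSheafify (Opens.grothendieckTopology T)
    (yoneda.obj U ⋙ AddCommGrpCat.free)).app (op V))) ?_
  exact congrArg FreeAbelianGroup.of (Subsingleton.elim (α := V ⟶ U) _ _)

/-- Evaluation of a morphism from a free abelian sheaf at the canonical section. -/
def evalGen (F : Sheaf (Opens.grothendieckTopology T) AddCommGrpCat.{u}) (U : Opens T) :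
    (freeSheaf U ⟶ F) →+ F.obj.obj (op U) where
  toFun φ := φ.hom.app (op U) (freeSheafGen U)
  map_zero' := rfl
  map_add' _ _ := rfl

/-- The composite of the sheafification adjunction, the free-forgetful adjunction and the Yoneda
lemma. -/
lemma evalGen_bijective (F : Sheaf (Opens.grothendieckTopology T) AddCommGrpCat.{u})
    (U : Opens T) : Function.Bijective (evalGen F U) := by
  let e := (((sheafificationAdjunction (Opens.grothendieckTopology T) AddCommGrpCat.{u}).homEquiv
    (yoneda.obj U ⋙ AddCommGrpCat.free) F).trans (((AddCommGrpCat.adj.whiskerRight _).homEquiv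
      (yoneda.obj U) F.obj).trans (yonedaEquiv (X := U))))
  have : ⇑(evalGen F U) = e := by
    ext φ
    simp [e, evalGen, yonedaEquiv]
    rfl
  rw [this]
  exact e.bijective

lemma evalGen_freeSheafMap {U V : Opens T} (h : V ≤ U) (φ : freeSheaf U ⟶ F) :
    evalGen F V (freeSheafMap h ≫ φ) = F.obj.map (homOfLE h).op (evalGen F U φ) := by
  have h₁ := ConcreteCategory.congr_hom (φ.hom.naturality (homOfLE h).op) (freeSheafGen U)
  refine Eq.trans ?_ h₁
  change φ.hom.app (op V) ((freeSheafMap h).hom.app (op V) (freeSheafGen V)) = _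
  rw [freeSheafMap_gen]
  rfl

lemma evalGen_comp {U : Opens T} (φ : freeSheaf U ⟶ F) (ψ : F ⟶ G) :
    evalGen G U (φ ≫ ψ) = ψ.hom.app (op U) (evalGen F U φ) :=
  rfl

/-- The class of degree zero attached to a section. -/
def sectionExt (F : Sheaf (Opens.grothendieckTopology T) AddCommGrpCat.{u}) (U : Opens T) :
    F.obj.obj (op U) ≃+ Ext.{u} (freeSheaf U) F 0 :=
  (AddEquiv.ofBijective _ (evalGen_bijective F U)).symm.trans Ext.addEquiv₀.symm

lemma sectionExt_evalGen {U : Opens T} (φ : freeSheaf U ⟶ F) :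
    sectionExt F U (evalGen F U φ) = Ext.mk₀ φ := by
  simp only [sectionExt, AddEquiv.trans_apply, Ext.addEquiv₀_symm_apply]
  congr 1
  exact (AddEquiv.ofBijective _ (evalGen_bijective F U)).symm_apply_apply φ

lemma resExt_sectionExt {U V : Opens T} (h : V ≤ U) (s : F.obj.obj (op U)) :
    resExt h (sectionExt F U s) = sectionExt F V (F.obj.map (homOfLE h).op s) := by
  obtain ⟨φ, rfl⟩ := (evalGen_bijective F U).2 s
  rw [sectionExt_evalGen, ← evalGen_freeSheafMap, sectionExt_evalGen, resExt, Ext.mk₀_comp_mk₀]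

lemma sectionExt_comp {U : Opens T} (s : F.obj.obj (op U)) (ψ : F ⟶ G) :
    (sectionExt F U s).comp (Ext.mk₀ ψ) (add_zero 0) = sectionExt G U (ψ.hom.app (op U) s) := by
  obtain ⟨φ, rfl⟩ := (evalGen_bijective F U).2 s
  rw [sectionExt_evalGen, ← evalGen_comp, sectionExt_evalGen, Ext.mk₀_comp_mk₀]

/-- The commutative square formed by two opens, their union and their intersection. -/
abbrev opensSquare {U V W D : Opens T} (hW : W = U ⊔ V) (hD : D = U ⊓ V) : Square (Opens T) where
  X₁ := D
  X₂ := U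
  X₃ := V
  X₄ := W
  f₁₂ := homOfLE (hD.trans_le inf_le_left)
  f₁₃ := homOfLE (hD.trans_le inf_le_right)
  f₂₄ := homOfLE (le_sup_left.trans_eq hW.symm)
  f₃₄ := homOfLE (le_sup_right.trans_eq hW.symm)
  fac := Subsingleton.elim _ _

/-- The Mayer-Vietoris square formed by two opens, their union and their intersection. -/
abbrev mvSquare {U V W D : Opens T} (hW : W = U ⊔ V) (hD : D = U ⊓ V) :
    (Opens.grothendieckTopology T).MayerVietorisSquare :=
  Opens.mayerVietorisSquare' (opensSquare hW hD) hW hD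

/-- The Mayer-Vietoris short complex `ℤ[U ∩ V] ⟶ ℤ[U] ⊞ ℤ[V] ⟶ ℤ[U ∪ V]`. -/
def mvComplex {U V W D : Opens T} (hW : W = U ⊔ V) (hD : D = U ⊓ V) :
    ShortComplex (Sheaf (Opens.grothendieckTopology T) AddCommGrpCat.{u}) :=
  .mk (X₁ := freeSheaf D) (X₂ := freeSheaf U ⊞ freeSheaf V) (X₃ := freeSheaf W)
    (biprod.lift (freeSheafMap (hD.trans_le inf_le_left))
      (-freeSheafMap (hD.trans_le inf_le_right)))
    (biprod.desc (freeSheafMap (le_sup_left.trans_eq hW.symm))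
      (freeSheafMap (le_sup_right.trans_eq hW.symm)))
    (by simp [freeSheafMap_comp])

lemma mvComplex_shortExact {U V W D : Opens T} (hW : W = U ⊔ V) (hD : D = U ⊓ V) :
    (mvComplex hW hD).ShortExact :=
  (mvSquare hW hD).shortComplex_shortExact

/-- The extension class of the Mayer-Vietoris short complex. -/
def mvClass {U V W D : Opens T} (hW : W = U ⊔ V) (hD : D = U ⊓ V) :
    Ext.{u} (freeSheaf W) (freeSheaf D) 1 :=
  (mvComplex_shortExact hW hD).extClass

/-- The connecting homomorphism of the Mayer-Vietoris sequence. -/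
def mvδ {U V W D : Opens T} (hW : W = U ⊔ V) (hD : D = U ⊓ V) {n : ℕ}
    (x : Ext.{u} (freeSheaf D) F n) : Ext.{u} (freeSheaf W) F (n + 1) :=
  (mvClass hW hD).comp x (add_comm 1 n)

section MV

variable {U V W D : Opens T} (hW : W = U ⊔ V) (hD : D = U ⊓ V)

lemma mvδ_comp {n m p : ℕ} (x : Ext.{u} (freeSheaf D) F n) (y : Ext.{u} F G m)
    (hp : n + m = p) (hq : (n + 1) + m = p + 1) :
    (mvδ hW hD x).comp y hq = mvδ hW hD (x.comp y hp) := by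
  rw [mvδ, mvδ, Ext.comp_assoc]
  omega

lemma mvδ_add {n : ℕ} (x y : Ext.{u} (freeSheaf D) F n) :
    mvδ hW hD (x + y) = mvδ hW hD x + mvδ hW hD y := by
  simp [mvδ]

@[simp]
lemma mvδ_zero {n : ℕ} : mvδ hW hD (0 : Ext.{u} (freeSheaf D) F n) = 0 := by
  simp [mvδ]

/-- Exactness of the long Ext sequence of `mvComplex`; a class on the biproduct is zero when both of
its components, here the two restrictions, are. -/
lemma exists_mvδ_eq {n : ℕ} (x : Ext.{u} (freeSheaf W) F (n + 1))
    (hU : resExt (le_sup_left.trans_eq hW.symm) x = 0)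
    (hV : resExt (le_sup_right.trans_eq hW.symm) x = 0) :
    ∃ y : Ext.{u} (freeSheaf D) F n, mvδ hW hD y = x := by
  refine Ext.contravariant_sequence_exact₃ (mvComplex_shortExact hW hD) F x ?_ _
  refine Ext.biprodAddEquiv.injective (Prod.ext ?_ ?_)
  · change (Ext.mk₀ biprod.inl).comp ((Ext.mk₀ (biprod.desc _ _)).comp x (zero_add _))
      (zero_add _) =
      (Ext.mk₀ biprod.inl).comp 0 (zero_add _)
    rw [Ext.mk₀_comp_mk₀_assoc, biprod.inl_desc, Ext.comp_zero]
    exact hU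
  · change (Ext.mk₀ biprod.inr).comp ((Ext.mk₀ (biprod.desc _ _)).comp x (zero_add _))
      (zero_add _) =
      (Ext.mk₀ biprod.inr).comp 0 (zero_add _)
    rw [Ext.mk₀_comp_mk₀_assoc, biprod.inr_desc, Ext.comp_zero]
    exact hV

lemma mvδ_resExt_left {n : ℕ} (x : Ext.{u} (freeSheaf U) F n) :
    mvδ hW hD (resExt (hD.trans_le inf_le_left) x) = 0 := by
  have := (mvComplex_shortExact hW hD).extClass_comp_assoc (h := add_comm 1 n)
    ((Ext.mk₀ (biprod.fst : freeSheaf U ⊞ freeSheaf V ⟶ _)).comp x (zero_add n))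
  change (mvClass hW hD).comp ((Ext.mk₀ (biprod.lift _ _)).comp _ _) _ = 0 at this
  rwa [Ext.mk₀_comp_mk₀_assoc, biprod.lift_fst] at this

lemma mvδ_resExt_right {n : ℕ} (x : Ext.{u} (freeSheaf V) F n) :
    mvδ hW hD (resExt (hD.trans_le inf_le_right) x) = 0 := by
  have := (mvComplex_shortExact hW hD).extClass_comp_assoc (h := add_comm 1 n)
    ((Ext.mk₀ (biprod.snd : freeSheaf U ⊞ freeSheaf V ⟶ _)).comp x (zero_add n))
  change (mvClass hW hD).comp ((Ext.mk₀ (biprod.lift _ _)).comp _ _) _ = 0 at this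
  rw [Ext.mk₀_comp_mk₀_assoc, biprod.lift_snd, Ext.mk₀_neg, Ext.neg_comp, Ext.comp_neg,
    neg_eq_zero] at this
  exact this

/-- Naturality of the extension class along the morphism of Mayer-Vietoris complexes given by the
inclusions. -/
lemma resExt_mvδ {U' V' W' D' : Opens T} (hW' : W' = U' ⊔ V') (hD' : D' = U' ⊓ V')
    (hU : U' ≤ U) (hV : V' ≤ V) (hWW : W' ≤ W) (hDD : D' ≤ D) {n : ℕ}
    (x : Ext.{u} (freeSheaf D) F n) :
    resExt hWW (mvδ hW hD x) = mvδ hW' hD' (resExt hDD x) := by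
  let φ : mvComplex hW' hD' ⟶ mvComplex hW hD :=
    { τ₁ := freeSheafMap hDD
      τ₂ := biprod.map (freeSheafMap hU) (freeSheafMap hV)
      τ₃ := freeSheafMap hWW
      comm₁₂ := by
        apply biprod.hom_ext <;> simp [mvComplex, freeSheafMap_comp]
      comm₂₃ := by
        apply biprod.hom_ext' <;> simp [mvComplex, freeSheafMap_comp] }
  have h : (mvClass hW' hD').comp (Ext.mk₀ (freeSheafMap hDD)) (add_zero 1) =
      (Ext.mk₀ (freeSheafMap hWW)).comp (mvClass hW hD) (zero_add 1) :=
    ShortComplex.ShortExact.extClass_naturality (mvComplex_shortExact hW' hD')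
      (mvComplex_shortExact hW hD) φ
  rw [resExt, mvδ, mvδ, resExt, ← Ext.comp_assoc (a₁₂ := 1) _ _ _ (by omega) (by omega) (by omega),
    ← h, Ext.comp_assoc_of_second_deg_zero]

end MV

end Cohomology

/-! ### Classes of positive degree vanish locally -/

section LocalVanishing

open TopologicalSpace Opposite Abelian

variable {T : Type u} [TopologicalSpace T]

/-- Embed `F` in an injective sheaf: a class of degree `n + 1` is the boundary of a class of degree
`n` in the quotient sheaf. In degree zero that class is a section, which lifts locally; higher
degrees follow by dimension shifting, which is why `F` varies in the induction. -/
lemma exists_resExt_eq_zero (n : ℕ) : ∀ (F : Sheaf (Opens.grothendieckTopology T) AddCommGrpCat.{u})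
    (U : Opens T) (x : Ext.{u} (freeSheaf U) F (n + 1)) (p : T), p ∈ U →
    ∃ (V : Opens T) (h : V ≤ U), p ∈ V ∧ resExt h x = 0 := by
  induction n with
  | zero =>
    intro F U x p hp
    let S : ShortComplex (Sheaf (Opens.grothendieckTopology T) AddCommGrpCat.{u}) :=
      .mk (Injective.ι F) (cokernel.π _) (cokernel.condition _)
    have hS : S.ShortExact := { exact := ShortComplex.exact_cokernel _ }
    obtain ⟨y, rfl⟩ := Ext.covariant_sequence_exact₁ _ hS x
      (Ext.eq_zero_of_injective (I := Injective.under F) _) rfl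
    obtain ⟨q, rfl⟩ := (sectionExt _ U).surjective y
    have : Sheaf.IsLocallySurjective S.g :=
      (Sheaf.isLocallySurjective_iff_epi' _ _).2 hS.epi_g
    obtain ⟨V, i, ⟨t, ht⟩, hV⟩ := Presheaf.imageSieve_mem (Opens.grothendieckTopology T) S.g.hom q p
      hp
    refine ⟨V, leOfHom i, hV, ?_⟩
    rw [resExt_comp, resExt_sectionExt]
    have : (sectionExt S.X₃ V) (S.X₃.obj.map (homOfLE (leOfHom i)).op q) =
        (sectionExt S.X₂ V t).comp (Ext.mk₀ S.g) (add_zero 0) := by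
      rw [sectionExt_comp]
      exact congrArg _ ht.symm
    rw [this, Ext.comp_assoc_of_second_deg_zero, hS.comp_extClass, Ext.comp_zero]
  | succ n ih =>
    intro F U x p hp
    let S : ShortComplex (Sheaf (Opens.grothendieckTopology T) AddCommGrpCat.{u}) :=
      .mk (Injective.ι F) (cokernel.π _) (cokernel.condition _)
    have hS : S.ShortExact := { exact := ShortComplex.exact_cokernel _ }
    obtain ⟨y, rfl⟩ := Ext.covariant_sequence_exact₁ _ hS x
      (Ext.eq_zero_of_injective (I := Injective.under F) _) rfl
    obtain ⟨V, h, hpV, hy⟩ := ih _ U y p hp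
    exact ⟨V, h, hpV, by rw [resExt_comp, hy, Ext.zero_comp]⟩

lemma resExt_eq_zero_of_eq_bot {F : Sheaf (Opens.grothendieckTopology T) AddCommGrpCat.{u}}
    {U V : Opens T} (hV : V = ⊥) (h : V ≤ U) {n : ℕ} (x : Ext.{u} (freeSheaf U) F n) :
    resExt h x = 0 := by
  subst hV
  have : freeSheafMap h = 0 := by
    apply (evalGen_bijective _ _).1
    have : Subsingleton ((freeSheaf U).obj.obj (op ⊥)) :=
      AddCommGrpCat.subsingleton_of_isZero
        ((isZero_zero _).of_iso ((TopCat.Sheaf.isTerminalOfEmpty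
          (X := TopCat.of T) (freeSheaf U)).uniqueUpToIso (isZero_zero _).isTerminal))
    exact Subsingleton.elim _ _
  rw [resExt, this, Ext.mk₀_zero, Ext.zero_comp]

end LocalVanishing

/-! ### Vanishing of higher cohomology on affine opens -/

section AffineVanishing

open TopologicalSpace Opposite Abelian

variable {Y : Scheme.{u}}

/-- The class of degree zero attached to a section of the structure sheaf. -/
def secExt {U : Y.Opens} (s : Γ(Y, U)) : Ext.{u} (freeSheaf U) (structureSheafAb Y) 0 :=
  sectionExt (structureSheafAb Y) U s

lemma secExt_add {U : Y.Opens} (s t : Γ(Y, U)) : secExt (s + t) = secExt s + secExt t :=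
  map_add (sectionExt (structureSheafAb Y) U) s t

lemma secExt_surjective {U : Y.Opens} : Function.Surjective (secExt (U := U)) :=
  (sectionExt (structureSheafAb Y) U).surjective

lemma secExt_injective {U : Y.Opens} : Function.Injective (secExt (U := U)) :=
  (sectionExt (structureSheafAb Y) U).injective

lemma resExt_secExt {U V : Y.Opens} (h : V ≤ U) (s : Γ(Y, U)) :
    resExt h (secExt s) = secExt (restrict h s) :=
  resExt_sectionExt h _

lemma restrict_restrict {U V W : Y.Opens} (h : V ≤ U) (h' : W ≤ V) (s : Γ(Y, U)) :
    restrict h' (restrict h s) = restrict (h'.trans h) s := by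
  simp only [restrict, ← CommRingCat.comp_apply, ← Functor.map_comp]
  rfl

/-- If `s = a / (fg)ⁿ` and `α fⁿ + β gⁿ = 1`, then `s = aβ / fⁿ + aα / gⁿ`. -/
lemma exists_restrict_add_restrict {W : Y.Opens} (hW : IsAffineOpen W) (f g : Γ(Y, W))
    (hfg : IsUnit (f + g)) {U V D : Y.Opens} (hU : U = Y.basicOpen f) (hV : V = Y.basicOpen g)
    (hDU : D ≤ U) (hDV : D ≤ V) (hD : D = U ⊓ V) (s : Γ(Y, D)) :
    ∃ (a : Γ(Y, U)) (b : Γ(Y, V)), s = restrict hDU a + restrict hDV b := by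
  subst hU hV
  have hD' : D = Y.basicOpen (f * g) := by rw [hD, Scheme.basicOpen_mul]
  subst hD'
  have := hW.isLocalization_basicOpen (f * g)
  have := hW.isLocalization_basicOpen f
  have := hW.isLocalization_basicOpen g
  obtain ⟨n, a, ha⟩ := IsLocalization.Away.surj (f * g) s
  have hcop : IsCoprime f g := by
    obtain ⟨u, hu⟩ := hfg
    exact ⟨↑u⁻¹, ↑u⁻¹, by rw [← mul_add, ← hu, Units.inv_mul]⟩
  obtain ⟨α, β, hαβ⟩ := hcop.pow (m := n) (n := n)
  obtain ⟨p, hp⟩ : ∃ p : Γ(Y, Y.basicOpen f), p * algebraMap _ _ f ^ n =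
      algebraMap _ _ (a * β) := by
    obtain ⟨u, hu⟩ := (IsLocalization.Away.algebraMap_isUnit (S := Γ(Y, Y.basicOpen f)) f).pow n
    exact ⟨algebraMap _ _ (a * β) * ↑u⁻¹, by rw [← hu, Units.inv_mul_cancel_right]⟩
  obtain ⟨q, hq⟩ : ∃ q : Γ(Y, Y.basicOpen g), q * algebraMap _ _ g ^ n =
      algebraMap _ _ (a * α) := by
    obtain ⟨u, hu⟩ := (IsLocalization.Away.algebraMap_isUnit (S := Γ(Y, Y.basicOpen g)) g).pow n
    exact ⟨algebraMap _ _ (a * α) * ↑u⁻¹, by rw [← hu, Units.inv_mul_cancel_right]⟩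
  refine ⟨p, q, ?_⟩
  have hfD (t : Γ(Y, W)) : restrict hDU (algebraMap Γ(Y, W) Γ(Y, Y.basicOpen f) t) =
      algebraMap Γ(Y, W) Γ(Y, Y.basicOpen (f * g)) t := restrict_restrict (Y.basicOpen_le f) hDU t
  have hgD (t : Γ(Y, W)) : restrict hDV (algebraMap Γ(Y, W) Γ(Y, Y.basicOpen g) t) =
      algebraMap Γ(Y, W) Γ(Y, Y.basicOpen (f * g)) t := restrict_restrict (Y.basicOpen_le g) hDV t
  have hp' := congrArg (restrict hDU) hp
  have hq' := congrArg (restrict hDV) hq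
  have hαβ' := congrArg (algebraMap Γ(Y, W) Γ(Y, Y.basicOpen (f * g))) hαβ
  rw [map_mul, map_pow, hfD, hfD] at hp'
  rw [map_mul, map_pow, hgD, hgD] at hq'
  have hu := (IsLocalization.Away.algebraMap_isUnit (S := Γ(Y, Y.basicOpen (f * g))) (f * g)).pow n
  refine hu.mul_right_cancel ?_
  simp only [map_mul, map_add, map_pow, map_one] at *
  linear_combination ha - algebraMap Γ(Y, W) Γ(Y, Y.basicOpen (f * g)) a * hαβ' -
    algebraMap Γ(Y, W) Γ(Y, Y.basicOpen (f * g)) g ^ n * hp' -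
    algebraMap Γ(Y, W) Γ(Y, Y.basicOpen (f * g)) f ^ n * hq'

/-- Vanishing of the higher cohomology of the structure sheaf on affine opens. -/
theorem ext_eq_zero_of_isAffineOpen (n : ℕ) : ∀ {U : Y.Opens} (_ : IsAffineOpen U)
    (x : Ext.{u} (freeSheaf U) (structureSheafAb Y) (n + 1)), x = 0 := by
  induction n using Nat.strong_induction_on with
  | _ n ih =>
  intro U hU x
  -- The `f` for which `x` vanishes on `D(f)` form an ideal. Closure under addition is
  -- Mayer-Vietoris on `D(f + g)`, which is covered by its intersections with `D(f)` and `D(g)`.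
  have key : ∀ (f g : Γ(Y, U)), resExt (Y.basicOpen_le f) x = 0 → resExt (Y.basicOpen_le g) x = 0 →
      resExt (Y.basicOpen_le (f + g)) x = 0 := by
    intro f g hf hg
    set W := Y.basicOpen (f + g)
    have hW : IsAffineOpen W := hU.basicOpen _
    have hWU : W ≤ U := Y.basicOpen_le _
    have hfW : Y.basicOpen (restrict hWU f) = W ⊓ Y.basicOpen f := Scheme.basicOpen_res _ _ _
    have hgW : Y.basicOpen (restrict hWU g) = W ⊓ Y.basicOpen g := Scheme.basicOpen_res _ _ _
    have hu : IsUnit (restrict hWU f + restrict hWU g) := by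
      rw [← map_add]
      exact RingedSpace.isUnit_res_basicOpen _ _
    have hc : W = Y.basicOpen (restrict hWU f) ⊔ Y.basicOpen (restrict hWU g) := by
      rw [hfW, hgW, ← inf_sup_left]
      exact (inf_eq_left.2 (Y.basicOpen_add_le f g)).symm
    obtain ⟨y, hy⟩ := exists_mvδ_eq hc rfl (resExt hWU x)
      (by rw [resExt_resExt, ← resExt_resExt (Y.basicOpen_le f) (hfW.trans_le inf_le_right), hf,
        resExt_zero])
      (by rw [resExt_resExt, ← resExt_resExt (Y.basicOpen_le g) (hgW.trans_le inf_le_right), hg,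
        resExt_zero])
    rw [← hy]
    -- In degree zero `y` is a section, hence a sum of two restrictions, which the boundary kills;
    -- in higher degree it vanishes by induction, the intersection being affine.
    obtain _ | n := n
    · obtain ⟨s, rfl⟩ := secExt_surjective y
      obtain ⟨a, b, rfl⟩ := exists_restrict_add_restrict hW _ _ hu rfl rfl inf_le_left inf_le_right
        rfl s
      rw [secExt_add, mvδ_add, ← resExt_secExt, ← resExt_secExt]
      erw [mvδ_resExt_left, mvδ_resExt_right]
      simp
    · rw [ih n (by omega) _ y, mvδ_zero]
      rw [← Scheme.basicOpen_mul]
      exact hW.basicOpen _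
  let I : Ideal Γ(Y, U) :=
    { carrier := {f | resExt (Y.basicOpen_le f) x = 0}
      add_mem' := fun {f g} hf hg => key f g hf hg
      zero_mem' := by
        have h : Y.basicOpen (0 : Γ(Y, U)) = ⊥ := Scheme.basicOpen_zero _ _
        change resExt _ x = 0
        exact resExt_eq_zero_of_eq_bot h _ _
      smul_mem' := fun c f hf => by
        have h : Y.basicOpen (c • f) ≤ Y.basicOpen f := by
          rw [smul_eq_mul, Scheme.basicOpen_mul]
          exact inf_le_right
        change resExt _ x = 0
        rw [← resExt_resExt (Y.basicOpen_le f) h, hf, resExt_zero] }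
  -- By local vanishing, the basic opens of elements of `I` cover `U`.
  have hI : I = ⊤ := by
    rw [← Ideal.span_eq I, ← hU.iSup_basicOpen_eq_self_iff]
    refine le_antisymm (iSup_le fun f => Y.basicOpen_le _) fun p hp => ?_
    obtain ⟨V, h, hpV, hV⟩ := exists_resExt_eq_zero n _ U x p hp
    obtain ⟨f, hfV, hpf⟩ := hU.exists_basicOpen_le ⟨p, hpV⟩ hp
    refine Opens.mem_iSup.2 ⟨⟨f, ?_⟩, hpf⟩
    change resExt _ x = 0
    rw [← resExt_resExt h hfV, hV, resExt_zero]
  have h1 : (1 : Γ(Y, U)) ∈ I := hI ▸ Submodule.mem_top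
  have h : U ≤ Y.basicOpen (1 : Γ(Y, U)) := by rw [Scheme.basicOpen_of_isUnit _ isUnit_one]
  have h2 : resExt h (resExt (Y.basicOpen_le _) x) = 0 := by
    rw [show resExt (Y.basicOpen_le _) x = 0 from h1, resExt_zero]
  rw [resExt_resExt] at h2
  simpa [resExt, freeSheafMap] using h2

end AffineVanishing

/-! ### Čech computations with three affine opens -/

section ThreeCover

open TopologicalSpace Opposite Abelian

section MV

variable {T : Type u} [TopologicalSpace T]
  {F : Sheaf (Opens.grothendieckTopology T) AddCommGrpCat.{u}}
  {U V W D : Opens T} (hW : W = U ⊔ V) (hD : D = U ⊓ V)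

lemma mk₀_f_comp {n : ℕ} (a : Ext.{u} (freeSheaf U) F n) (b : Ext.{u} (freeSheaf V) F n) :
    (Ext.mk₀ (biprod.lift (freeSheafMap (hD.trans_le inf_le_left))
      (-freeSheafMap (hD.trans_le inf_le_right)))).comp (Ext.biprodAddEquiv.symm (a, b))
      (zero_add n) = resExt (hD.trans_le inf_le_left) a - resExt (hD.trans_le inf_le_right) b := by
  rw [Ext.biprodAddEquiv_symm_apply, Ext.comp_add, Ext.mk₀_comp_mk₀_assoc, Ext.mk₀_comp_mk₀_assoc,
    biprod.lift_fst, biprod.lift_snd, Ext.mk₀_neg, Ext.neg_comp, sub_eq_add_neg]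
  rfl

lemma biprodAddEquiv_mk₀_g_comp {n : ℕ} (x : Ext.{u} (freeSheaf W) F n) :
    Ext.biprodAddEquiv ((Ext.mk₀ (biprod.desc (freeSheafMap (le_sup_left.trans_eq hW.symm))
      (freeSheafMap (le_sup_right.trans_eq hW.symm)))).comp x (zero_add n)) =
      (resExt (le_sup_left.trans_eq hW.symm) x, resExt (le_sup_right.trans_eq hW.symm) x) := by
  refine Prod.ext ?_ ?_
  · change (Ext.mk₀ biprod.inl).comp _ (zero_add _) = _
    rw [Ext.mk₀_comp_mk₀_assoc, biprod.inl_desc]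
    rfl
  · change (Ext.mk₀ biprod.inr).comp _ (zero_add _) = _
    rw [Ext.mk₀_comp_mk₀_assoc, biprod.inr_desc]
    rfl

lemma exists_resExt_sub_resExt_eq {n : ℕ} (y : Ext.{u} (freeSheaf D) F n) (hy : mvδ hW hD y = 0) :
    ∃ (a : Ext.{u} (freeSheaf U) F n) (b : Ext.{u} (freeSheaf V) F n),
      y = resExt (hD.trans_le inf_le_left) a - resExt (hD.trans_le inf_le_right) b := by
  obtain ⟨z, rfl⟩ := Ext.contravariant_sequence_exact₁ (mvComplex_shortExact hW hD) F y
    (add_comm 1 n) hy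
  obtain ⟨⟨a, b⟩, rfl⟩ := Ext.biprodAddEquiv.symm.surjective z
  exact ⟨a, b, mk₀_f_comp hD a b⟩

lemma exists_resExt_eq {n : ℕ} (a : Ext.{u} (freeSheaf U) F n) (b : Ext.{u} (freeSheaf V) F n)
    (hab : resExt (hD.trans_le inf_le_left) a = resExt (hD.trans_le inf_le_right) b) :
    ∃ x : Ext.{u} (freeSheaf W) F n, resExt (le_sup_left.trans_eq hW.symm) x = a ∧
      resExt (le_sup_right.trans_eq hW.symm) x = b := by
  obtain ⟨x, hx⟩ := Ext.contravariant_sequence_exact₂ (mvComplex_shortExact hW hD) F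
    (Ext.biprodAddEquiv.symm (a, b)) ((mk₀_f_comp hD a b).trans (sub_eq_zero.2 hab))
  have h := (biprodAddEquiv_mk₀_g_comp hW x).symm.trans ((congrArg Ext.biprodAddEquiv hx).trans
    (Ext.biprodAddEquiv.apply_symm_apply _))
  exact ⟨x, congrArg Prod.fst h, congrArg Prod.snd h⟩

include hW in
lemma ext_zero_ext {x y : Ext.{u} (freeSheaf W) F 0}
    (hU : resExt (le_sup_left.trans_eq hW.symm) x = resExt (le_sup_left.trans_eq hW.symm) y)
    (hV : resExt (le_sup_right.trans_eq hW.symm) x = resExt (le_sup_right.trans_eq hW.symm) y) :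
    x = y := by
  have := (mvComplex_shortExact hW rfl).epi_g
  refine Ext.precomp_mk₀_injective_of_epi F (mvComplex hW rfl).g (Ext.biprodAddEquiv.injective ?_)
  exact (biprodAddEquiv_mk₀_g_comp hW x).trans ((Prod.ext hU hV).trans
    (biprodAddEquiv_mk₀_g_comp hW y).symm)

lemma mvδ_sub {n : ℕ} (x y : Ext.{u} (freeSheaf D) F n) :
    mvδ hW hD (x - y) = mvδ hW hD x - mvδ hW hD y := by
  simp [mvδ, sub_eq_add_neg]

lemma resExt_add {h : V ≤ U} {n : ℕ} (x y : Ext.{u} (freeSheaf U) F n) :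
    resExt h (x + y) = resExt h x + resExt h y := by
  simp [resExt]

end MV

/-! ### The constant sheaf `ℤ` as the free sheaf on the whole space -/

section ConstantSheaf

variable {T : Type u} [TopologicalSpace T]

/-- The constant presheaf `ℤ` is the free abelian presheaf on the whole space. -/
def constantPresheafIso : (Functor.const (Opens T)ᵒᵖ).obj (AddCommGrpCat.of (ULift.{u} ℤ)) ≅
    yoneda.obj (⊤ : Opens T) ⋙ AddCommGrpCat.free.{u} :=
  NatIso.ofComponents (fun U =>
    letI : Unique (unop U ⟶ (⊤ : Opens T)) := ⟨⟨homOfLE le_top⟩, fun _ => Subsingleton.elim _ _⟩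
    (AddEquiv.ulift.trans
      (FreeAbelianGroup.uniqueEquiv (unop U ⟶ (⊤ : Opens T))).symm).toAddCommGrpIso) (by
    intro U V i
    ext n
    refine Eq.trans ?_ (map_zsmul ((yoneda.obj (⊤ : Opens T) ⋙ AddCommGrpCat.free).map i).hom
      n.down (FreeAbelianGroup.of (homOfLE le_top : unop U ⟶ ⊤))).symm
    exact congrArg (fun j : unop V ⟶ ⊤ => n.down • FreeAbelianGroup.of j) (Subsingleton.elim _ _))

/-- The constant sheaf `ℤ` is the free abelian sheaf on the whole space. -/
def constantSheafIso :
    (constantSheaf (Opens.grothendieckTopology T) AddCommGrpCat.{u}).obj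
      (AddCommGrpCat.of (ULift.{u} ℤ)) ≅ freeSheaf (⊤ : Opens T) :=
  (presheafToSheaf _ _).mapIso constantPresheafIso

end ConstantSheaf

variable {Y : Scheme.{u}}

lemma secExt_sub {U : Y.Opens} (s t : Γ(Y, U)) : secExt (s - t) = secExt s - secExt t :=
  map_sub (sectionExt (structureSheafAb Y) U) s t

/-- Cohomology classes on the whole space. -/
def toExtTop {n : ℕ} (x : H Y n) : Ext.{u} (freeSheaf (⊤ : Y.Opens)) (structureSheafAb Y) n :=
  (Ext.mk₀ constantSheafIso.{u}.inv).comp x (zero_add n)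

lemma toExtTop_injective {n : ℕ} : Function.Injective (toExtTop (Y := Y) (n := n)) := by
  intro x y h
  have := congrArg (fun z => (Ext.mk₀ constantSheafIso.{u}.hom).comp z (zero_add n)) h
  simpa [toExtTop] using this

lemma toExtTop_map {n : ℕ} (φ : structureSheafAb Y ⟶ structureSheafAb Y) (x : H Y n) :
    toExtTop (Sheaf.H.map φ n x) = (toExtTop x).comp (Ext.mk₀ φ) (add_zero n) := by
  rw [toExtTop, toExtTop, Sheaf.H.map_apply, Ext.comp_assoc_of_third_deg_zero]

variable {U V W : Y.Opens}

/-- The hypothesis `hC` is exactness of the Čech complex in degree one. It is used twice: for the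
Mayer-Vietoris sequence of `U ⊔ V`, and then for that of `(U ⊔ V) ⊔ W`. -/
theorem subsingleton_h_one (hU : IsAffineOpen U) (hV : IsAffineOpen V) (hW : IsAffineOpen W)
    (hcov : U ⊔ V ⊔ W = ⊤)
    (hC : ∀ (s : Γ(Y, U ⊓ V)) (t : Γ(Y, V ⊓ W)) (r : Γ(Y, U ⊓ W)),
      restrict (inf_le_left : U ⊓ V ⊓ W ≤ U ⊓ V) s +
        restrict (inf_le_inf_right W inf_le_right : U ⊓ V ⊓ W ≤ V ⊓ W) t =
        restrict (inf_le_inf_right W inf_le_left : U ⊓ V ⊓ W ≤ U ⊓ W) r →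
      ∃ (α : Γ(Y, U)) (β : Γ(Y, V)) (γ : Γ(Y, W)),
        s = restrict inf_le_right β - restrict inf_le_left α ∧
        t = restrict inf_le_right γ - restrict inf_le_left β ∧
        r = restrict inf_le_right γ - restrict inf_le_left α) :
    Subsingleton (H Y 1) := by
  refine subsingleton_of_forall_eq 0 fun x => toExtTop_injective ?_
  have h0 : toExtTop (0 : H Y 1) = 0 := by simp [toExtTop]
  rw [h0]
  generalize toExtTop x = x
  have hA : (U ⊔ V) ⊓ W = (U ⊓ W) ⊔ (V ⊓ W) := inf_sup_right _ _ _
  have hD : U ⊓ V ⊓ W = (U ⊓ W) ⊓ (V ⊓ W) := inf_inf_distrib_right _ _ _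
  have hxA : resExt le_top x = (0 : Ext.{u} (freeSheaf (U ⊔ V)) _ _) := by
    obtain ⟨y, hy⟩ := exists_mvδ_eq (rfl : U ⊔ V = U ⊔ V) rfl (resExt le_top x)
      (ext_eq_zero_of_isAffineOpen _ hU _) (ext_eq_zero_of_isAffineOpen _ hV _)
    obtain ⟨s, rfl⟩ := secExt_surjective y
    -- The restriction of `x` to `(U ⊔ V) ⊓ W` factors through the affine `W`, so it is zero. Hence
    -- `s` becomes a difference on the triple intersection, which is the cocycle relation of `hC`.
    obtain ⟨a, b, hab⟩ := exists_resExt_sub_resExt_eq hA hD (resExt inf_le_left (secExt s)) (by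
      rw [← resExt_mvδ rfl rfl hA hD inf_le_left inf_le_left inf_le_left, hy, resExt_resExt,
        ← resExt_resExt (V := W) le_top inf_le_right, ext_eq_zero_of_isAffineOpen _ hW (resExt _ x),
        resExt_zero])
    obtain ⟨r, rfl⟩ := secExt_surjective a
    obtain ⟨t, rfl⟩ := secExt_surjective b
    rw [eq_sub_iff_add_eq, resExt_secExt, resExt_secExt, resExt_secExt, ← secExt_add] at hab
    obtain ⟨α, β, γ, hs, -, -⟩ := hC s t r (secExt_injective hab)
    rw [← hy, hs, secExt_sub, ← resExt_secExt, ← resExt_secExt, mvδ_sub, mvδ_resExt_left,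
      mvδ_resExt_right, sub_zero]
  obtain ⟨y, rfl⟩ := exists_mvδ_eq hcov.symm rfl x hxA (ext_eq_zero_of_isAffineOpen _ hW _)
  obtain ⟨s, rfl⟩ := secExt_surjective y
  -- The zero component makes `α` and `β` agree on `U ⊓ V`; they glue to a class `g` on `U ⊔ V`, and
  -- `s` is the difference of the restrictions of `γ` and `g`.
  obtain ⟨α, β, γ, h₁, h₂, h₃⟩ := hC 0 (restrict (inf_le_inf_right W le_sup_right) s)
    (restrict (inf_le_inf_right W le_sup_left) s) (by
      rw [restrict_restrict, restrict_restrict, map_zero, zero_add])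
  obtain ⟨g, hgα, hgβ⟩ := exists_resExt_eq (rfl : U ⊔ V = U ⊔ V) rfl (secExt α) (secExt β) (by
    rw [resExt_secExt, resExt_secExt, sub_eq_zero.1 h₁.symm])
  have hs : secExt s = resExt inf_le_right (secExt γ) - resExt inf_le_left g := by
    rw [eq_sub_iff_add_eq]
    apply ext_zero_ext hA
    · rw [resExt_add, resExt_secExt, resExt_resExt, ← resExt_resExt (V := U) le_sup_left
        inf_le_left,
        hgα, resExt_resExt, resExt_secExt, resExt_secExt, ← secExt_add, h₃, sub_add_cancel]
    · rw [resExt_add, resExt_secExt, resExt_resExt, ← resExt_resExt (V := V) le_sup_right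
        inf_le_left,
        hgβ, resExt_resExt, resExt_secExt, resExt_secExt, ← secExt_add, h₂, sub_add_cancel]
  rw [hs, mvδ_sub, mvδ_resExt_left, mvδ_resExt_right, sub_zero]

/-- Affine vanishing makes every class in `H²` an iterated boundary of a section on the triple
intersection. Boundaries commute with `φ`, so it suffices that `φ` is the identity modulo sections
from the double intersections. -/
theorem h_two_map_eq (hU : IsAffineOpen U) (hV : IsAffineOpen V) (hW : IsAffineOpen W)
    (hUV : IsAffineOpen (U ⊓ V)) (hVW : IsAffineOpen (V ⊓ W)) (hUW : IsAffineOpen (U ⊓ W))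
    (hcov : U ⊔ V ⊔ W = ⊤) (φ : structureSheafAb Y ⟶ structureSheafAb Y)
    (hφ : ∀ s : Γ(Y, U ⊓ V ⊓ W), ∃ (a : Γ(Y, U ⊓ V)) (b : Γ(Y, V ⊓ W)) (c : Γ(Y, U ⊓ W)),
      φ.hom.app (op (U ⊓ V ⊓ W)) s = s + restrict inf_le_left a +
        restrict (inf_le_inf_right W inf_le_right) b +
        restrict (inf_le_inf_right W inf_le_left) c)
    (x : H Y 2) : Sheaf.H.map φ 2 x = x := by
  apply toExtTop_injective
  rw [toExtTop_map]
  generalize toExtTop x = x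
  have hA : (U ⊔ V) ⊓ W = (U ⊓ W) ⊔ (V ⊓ W) := inf_sup_right _ _ _
  have hD : U ⊓ V ⊓ W = (U ⊓ W) ⊓ (V ⊓ W) := inf_inf_distrib_right _ _ _
  have hxA : resExt le_top x = (0 : Ext.{u} (freeSheaf (U ⊔ V)) _ _) := by
    obtain ⟨y, hy⟩ := exists_mvδ_eq (rfl : U ⊔ V = U ⊔ V) rfl (resExt le_top x)
      (ext_eq_zero_of_isAffineOpen _ hU _) (ext_eq_zero_of_isAffineOpen _ hV _)
    rw [← hy, ext_eq_zero_of_isAffineOpen _ hUV y, mvδ_zero]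
  obtain ⟨y, rfl⟩ := exists_mvδ_eq hcov.symm rfl x hxA (ext_eq_zero_of_isAffineOpen _ hW _)
  obtain ⟨z, rfl⟩ := exists_mvδ_eq hA hD y (ext_eq_zero_of_isAffineOpen _ hUW _)
    (ext_eq_zero_of_isAffineOpen _ hVW _)
  obtain ⟨s, rfl⟩ := secExt_surjective z
  obtain ⟨a, b, c, h⟩ := hφ s
  have hs : (secExt s).comp (Ext.mk₀ φ) (add_zero 0) = secExt s + resExt inf_le_left (secExt a) +
      resExt (inf_le_inf_right W inf_le_right) (secExt b) +
      resExt (inf_le_inf_right W inf_le_left) (secExt c) := by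
    simp only [resExt_secExt, ← secExt_add]
    exact (sectionExt_comp (F := structureSheafAb Y) s φ).trans (congrArg secExt h)
  -- The inner boundary kills the terms from `V ⊓ W` and `U ⊓ W`. For the term from `U ⊓ V` it gives
  -- a class restricted from `U ⊔ V`, which the outer boundary kills.
  rw [mvδ_comp _ _ _ _ (add_zero 1), mvδ_comp _ _ _ _ (add_zero 0), hs, mvδ_add, mvδ_add, mvδ_add,
    mvδ_resExt_left, mvδ_resExt_right, mvδ_zero, add_zero, add_zero, mvδ_add,
    ← resExt_mvδ rfl rfl hA hD inf_le_left inf_le_left inf_le_left, mvδ_add, mvδ_resExt_left,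
      add_zero]

end ThreeCover

/-! ### The affine charts and their universal property -/

section Charts

open HomogeneousLocalization

lemma eval₂_mul_of_isHomogeneous {σ A B : Type*} [CommSemiring A] [CommSemiring B]
    {p : MvPolynomial σ A} {n : ℕ} (hp : p.IsHomogeneous n) (f : A →+* B) (c : B) (t : σ → B) :
    p.eval₂ f (fun j => c * t j) = c ^ n * p.eval₂ f t := by
  rw [MvPolynomial.eval₂_eq, MvPolynomial.eval₂_eq, Finset.mul_sum]
  refine Finset.sum_congr rfl fun d hd => ?_
  have h : ∏ i ∈ d.support, c ^ d i = c ^ n := by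
    rw [Finset.prod_pow_eq_pow_sum, ← hp (MvPolynomial.mem_support_iff.1 hd)]
    simp [Finsupp.weight_apply, Finsupp.sum]
  simp_rw [mul_pow]
  rw [Finset.prod_mul_distrib, h]
  ring

/-- The value of the quartic form at a vector. -/
def quarticVal {B : Type*} [CommRing B] (t : Fin 4 → B) : B :=
  t 0 ^ 3 * t 1 + t 1 ^ 3 * t 2 + t 2 ^ 3 * t 3 + t 3 ^ 3 * t 0 + t 0 * t 1 * t 2 * t 3

lemma map_quarticVal {B B' : Type*} [CommRing B] [CommRing B'] (φ : B →+* B') (t : Fin 4 → B) :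
    φ (quarticVal t) = quarticVal fun j => φ (t j) := by
  simp [quarticVal]

variable (R : Type u) [CommRing R]

lemma eval₂_quartic {B : Type*} [CommRing B] (φ : R →+* B) (t : Fin 4 → B) :
    (quartic R).eval₂ φ t = quarticVal t := by
  simp [quartic, quarticVal]

/-- The homogeneous coordinate ring of the quartic. -/
abbrev CoordRing : Type u := MvPolynomial (Fin 4) R ⧸ quarticIdeal R

/-- The homogeneous coordinates. -/
def coord (i : Fin 4) : CoordRing R := Ideal.Quotient.mk _ (.X i)

lemma mk_mem_coordGrading {p : MvPolynomial (Fin 4) R} {n : ℕ} (hp : p.IsHomogeneous n) :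
    (Ideal.Quotient.mk (quarticIdeal R) p : CoordRing R) ∈ coordGrading R n :=
  Submodule.mem_map_of_mem hp

lemma coord_mem (i : Fin 4) : coord R i ∈ coordGrading R 1 :=
  mk_mem_coordGrading R (MvPolynomial.isHomogeneous_X R i)

lemma quarticVal_coord : quarticVal (coord R) = 0 := by
  have : Ideal.Quotient.mk (quarticIdeal R) (quartic R) = 0 :=
    Ideal.Quotient.eq_zero_iff_mem.2 (Ideal.subset_span rfl)
  simpa [quartic, quarticVal, coord] using this

/-- The homomorphism out of the coordinate ring defined by a zero of the quartic form. -/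
def coordLift {B : Type*} [CommRing B] (φ : R →+* B) (t : Fin 4 → B) (ht : quarticVal t = 0) :
    CoordRing R →+* B :=
  Ideal.Quotient.lift _ (MvPolynomial.eval₂Hom φ t) fun a ha => by
    rw [quarticIdeal, Ideal.mem_span_singleton] at ha
    obtain ⟨b, rfl⟩ := ha
    rw [map_mul, MvPolynomial.coe_eval₂Hom, eval₂_quartic, ht, zero_mul]

@[simp]
lemma coordLift_mk {B : Type*} [CommRing B] (φ : R →+* B) (t : Fin 4 → B) (ht : quarticVal t = 0)
    (p : MvPolynomial (Fin 4) R) :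
    coordLift R φ t ht (Ideal.Quotient.mk _ p) = p.eval₂ φ t :=
  rfl

@[simp]
lemma coordLift_coord {B : Type*} [CommRing B] (φ : R →+* B) (t : Fin 4 → B)
    (ht : quarticVal t = 0) (j : Fin 4) : coordLift R φ t ht (coord R j) = t j :=
  MvPolynomial.eval₂_X ..

/-- The coordinate ring of the affine chart where the `i`-th coordinate does not vanish. -/
abbrev Chart (i : Fin 4) : Type u := Away (coordGrading R) (coord R i)

/-- The structure homomorphism of a chart. -/
def chartC (i : Fin 4) : R →+* Chart R i :=
  (fromZeroRingHom _ _).comp (algebraMap R (coordGrading R 0))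

lemma val_chartC (i : Fin 4) (r : R) : (chartC R i r).val =
    algebraMap (CoordRing R) (Localization.Away (coord R i)) (algebraMap R _ r) :=
  Localization.mk_one_eq_algebraMap _

/-- The affine coordinates of a chart. -/
def chartCoord (i j : Fin 4) : Chart R i :=
  Away.mk _ (coord_mem R i) 1 (coord R j) (coord_mem R j)

@[simp]
lemma chartCoord_self (i : Fin 4) : chartCoord R i i = 1 := by
  apply val_injective
  rw [chartCoord, Away.val_mk, val_one, Localization.mk_eq_mk', IsLocalization.mk'_eq_iff_eq_mul]
  simp

lemma exists_isHomogeneous_of_mem {n : ℕ} {a : CoordRing R} (ha : a ∈ coordGrading R n) :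
    ∃ p : MvPolynomial (Fin 4) R, p.IsHomogeneous n ∧ a = Ideal.Quotient.mk _ p := by
  obtain ⟨p, hp, rfl⟩ := ha
  exact ⟨p, hp, rfl⟩

lemma eval₂_coord {B : Type*} [CommRing B] (φ : CoordRing R →+* B) (p : MvPolynomial (Fin 4) R) :
    p.eval₂ (φ.comp (algebraMap R _)) (fun j => φ (coord R j)) = φ (Ideal.Quotient.mk _ p) := by
  have : MvPolynomial.eval₂Hom (φ.comp (algebraMap R _)) (fun j => φ (coord R j)) =
      φ.comp (Ideal.Quotient.mk _) := by
    ext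
    · simp
      rfl
    · simp [coord]
  exact RingHom.congr_fun this p

/-- By homogeneity `p / x_iⁿ` is `p` evaluated at the fractions `x_j / x_i`. So a chart is generated
by these fractions, and together with `chartLift` it represents the zeros of the quartic with `i`-th
coordinate `1`. -/
lemma chart_mk_eq (i : Fin 4) {n : ℕ} {p : MvPolynomial (Fin 4) R} (hp : p.IsHomogeneous n)
    {a : CoordRing R} (ha : a = Ideal.Quotient.mk _ p) (h : a ∈ coordGrading R (n • 1)) :
    Away.mk _ (coord_mem R i) n a h = p.eval₂ (chartC R i) (chartCoord R i) := by
  subst ha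
  apply val_injective
  set u : Localization.Away (coord R i) := IsLocalization.Away.invSelf (coord R i) with hu
  have hxu : algebraMap _ _ (coord R i) * u = 1 := IsLocalization.Away.mul_invSelf _
  have hmk (m : ℕ) (b : CoordRing R) (hm) : Localization.mk b ⟨coord R i ^ m, hm⟩ =
      u ^ m * algebraMap (CoordRing R) (Localization.Away (coord R i)) b := by
    rw [Localization.mk_eq_mk', IsLocalization.mk'_eq_iff_eq_mul, map_pow, mul_right_comm,
      ← mul_pow, mul_comm u, hxu, one_pow, one_mul]
  have hv : ∀ x : Chart R i, x.val = algebraMap (Chart R i) (Localization.Away (coord R i)) x :=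
    fun _ => rfl
  have h₁ : ⇑(algebraMap (Chart R i) (Localization.Away (coord R i))) ∘ (chartCoord R i) =
      fun j => u * algebraMap (CoordRing R) (Localization.Away (coord R i)) (coord R j) := by
    ext j
    rw [Function.comp_apply, ← hv, chartCoord, Away.val_mk, hmk, pow_one]
  have h₂ : (algebraMap (Chart R i) (Localization.Away (coord R i))).comp (chartC R i) =
      (algebraMap (CoordRing R) (Localization.Away (coord R i))).comp (algebraMap R _) := by
    ext r
    rw [RingHom.comp_apply, RingHom.comp_apply, ← hv, val_chartC]
  rw [hv (MvPolynomial.eval₂ _ _ _), MvPolynomial.eval₂_comp_left, h₁, h₂,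
    eval₂_mul_of_isHomogeneous hp, eval₂_coord, Away.val_mk, hmk]

lemma quarticVal_chartCoord (i : Fin 4) : quarticVal (chartCoord R i) = 0 := by
  rw [← eval₂_quartic R (chartC R i), ← chart_mk_eq R i (quartic_isHomogeneous R) rfl
    (mk_mem_coordGrading R (quartic_isHomogeneous R))]
  apply val_injective
  rw [Away.val_mk, show Ideal.Quotient.mk (quarticIdeal R) (quartic R) = 0 from
    Ideal.Quotient.eq_zero_iff_mem.2 (Ideal.subset_span rfl), Localization.mk_zero,
    val_zero]

variable {R}

lemma chart_hom_ext {i : Fin 4} {B : Type*} [CommRing B] {f g : Chart R i →+* B}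
    (hC : ∀ r, f (chartC R i r) = g (chartC R i r))
    (hX : ∀ j, f (chartCoord R i j) = g (chartCoord R i j)) : f = g := by
  ext x
  obtain ⟨n, a, ha, rfl⟩ := Away.mk_surjective _ (coord_mem R i) x
  obtain ⟨p, hp, hap⟩ := exists_isHomogeneous_of_mem R ha
  rw [smul_eq_mul, mul_one] at hp
  rw [chart_mk_eq R i hp hap, MvPolynomial.eval₂_comp_left, MvPolynomial.eval₂_comp_left,
    show f.comp (chartC R i) = g.comp (chartC R i) from RingHom.ext hC,
    show f ∘ chartCoord R i = g ∘ chartCoord R i from funext hX]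

lemma isUnit_coordLift {i : Fin 4} {B : Type*} [CommRing B] (φ : R →+* B) (t : Fin 4 → B)
    (hi : t i = 1) (ht : quarticVal t = 0) : IsUnit (coordLift R φ t ht (coord R i)) := by
  rw [coordLift_coord, hi]
  exact isUnit_one

/-- The homomorphism out of a chart defined by a zero of the quartic form. -/
def chartLift {i : Fin 4} {B : Type*} [CommRing B] (φ : R →+* B) (t : Fin 4 → B) (hi : t i = 1)
    (ht : quarticVal t = 0) : Chart R i →+* B :=
  (Localization.awayLift (coordLift R φ t ht) (coord R i)
    (isUnit_coordLift φ t hi ht)).comp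
      (algebraMap (Chart R i) (Localization.Away (coord R i)))

lemma chartLift_mk {i : Fin 4} {B : Type*} [CommRing B] (φ : R →+* B) (t : Fin 4 → B)
    (hi : t i = 1) (ht : quarticVal t = 0) (n : ℕ) (s : CoordRing R) (hs) :
    chartLift φ t hi ht (Away.mk _ (coord_mem R i) n s hs) = coordLift R φ t ht s := by
  change Localization.awayLift _ _ (isUnit_coordLift φ t hi ht) (HomogeneousLocalization.val
    (Away.mk (coordGrading R)
    (coord_mem R i) n s hs)) = _
  rw [Away.val_mk, Localization.awayLift_mk _ _ _ 1 (by rw [coordLift_coord, hi, one_mul])]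
  simp

@[simp]
lemma chartLift_C {i : Fin 4} {B : Type*} [CommRing B] (φ : R →+* B) (t : Fin 4 → B)
    (hi : t i = 1) (ht : quarticVal t = 0) (r : R) :
    chartLift φ t hi ht (chartC R i r) = φ r := by
  change Localization.awayLift _ _ (isUnit_coordLift φ t hi ht)
    (HomogeneousLocalization.val (chartC R i r)) = _
  rw [val_chartC]
  refine (IsLocalization.lift_eq _ _).trans (MvPolynomial.eval₂_C _ _ _)

@[simp]
lemma chartLift_coord {i : Fin 4} {B : Type*} [CommRing B] (φ : R →+* B) (t : Fin 4 → B)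
    (hi : t i = 1) (ht : quarticVal t = 0) (j : Fin 4) :
    chartLift φ t hi ht (chartCoord R i j) = t j := by
  rw [chartCoord, chartLift_mk, coordLift_coord]

end Charts

/-! ### Compatibility of the quartic with base change -/

section BaseChange

open HomogeneousLocalization HomogeneousIdeal

attribute [local instance] MvPolynomial.gradedAlgebra

variable (R : Type u) [CommRing R]

lemma irrelevant_le_span_coord :
    (HomogeneousIdeal.irrelevant (coordGrading R)).toIdeal ≤ Ideal.span (Set.range (coord R)) := by
  rw [toIdeal_irrelevant_le]
  intro n hn a ha
  obtain ⟨p, hp, rfl⟩ := exists_isHomogeneous_of_mem R ha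
  have h : p ∈ Ideal.span (MvPolynomial.X '' (Set.univ : Set (Fin 4))) := by
    rw [MvPolynomial.mem_ideal_span_X_image]
    intro m hm
    by_contra! h
    have h0 : m = 0 := Finsupp.ext fun i => h i trivial
    have := hp (MvPolynomial.mem_support_iff.1 hm)
    rw [h0, map_zero] at this
    omega
  have h' := Ideal.mem_map_of_mem (Ideal.Quotient.mk (quarticIdeal R)) h
  rw [Ideal.map_span, ← Set.image_comp, Set.image_univ] at h'
  exact h'

/-- The open immersion of a chart. -/
def chartι (i : Fin 4) : Spec (.of (Chart R i)) ⟶ quarticScheme R :=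
  Proj.awayι (coordGrading R) (coord R i) (coord_mem R i) one_pos

instance (i : Fin 4) : IsOpenImmersion (chartι R i) :=
  inferInstanceAs (IsOpenImmersion (Proj.awayι _ _ _ _))

lemma chartι_str (i : Fin 4) :
    chartι R i ≫ quarticStr R = Spec.map (CommRingCat.ofHom (chartC R i)) := by
  rw [chartι, quarticStr]
  erw [Proj.awayι_toSpecZero_assoc]
  rw [← Spec.map_comp]
  rfl

/-- The open subset where a homogeneous element does not vanish. -/
def dPlus (s : CoordRing R) : (quarticScheme R).Opens := Proj.basicOpen (coordGrading R) s

lemma opensRange_chartι (i : Fin 4) : (chartι R i).opensRange = dPlus R (coord R i) :=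
  Proj.opensRange_awayι _ _ _ _

/-- The cover of the quartic by its four charts. -/
def chartCover : (quarticScheme R).AffineOpenCover :=
  Proj.affineOpenCoverOfIrrelevantLESpan (coordGrading R) (coord R) (coord_mem R)
    (fun _ => one_pos) (irrelevant_le_span_coord R)

variable {R} {R' : Type u} [CommRing R'] (φ : R →+* R')

lemma coordLift_algebraMap_comp (p : MvPolynomial (Fin 4) R) :
    coordLift R ((algebraMap R' _).comp φ) (coord R') (quarticVal_coord R')
      (Ideal.Quotient.mk _ p) = Ideal.Quotient.mk _ (p.map φ) := by
  rw [coordLift_mk, ← MvPolynomial.eval₂_map]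
  exact eval₂_coord R' (RingHom.id _) _

/-- The map of homogeneous coordinate rings induced by a ring homomorphism. -/
def coordMap : coordGrading R →+*ᵍ coordGrading R' where
  toRingHom := coordLift R ((algebraMap R' _).comp φ) (coord R') (quarticVal_coord R')
  map_mem {n x} hx := by
    obtain ⟨p, hp, rfl⟩ := exists_isHomogeneous_of_mem R hx
    have := coordLift_algebraMap_comp φ p
    change coordLift R _ _ _ _ ∈ _
    rw [this]
    exact mk_mem_coordGrading R' (hp.map φ)

lemma coordMap_mk (p : MvPolynomial (Fin 4) R) :
    coordMap φ (Ideal.Quotient.mk _ p) = Ideal.Quotient.mk _ (p.map φ) :=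
  coordLift_algebraMap_comp φ p

@[simp]
lemma coordMap_coord (i : Fin 4) : coordMap φ (coord R i) = coord R' i :=
  coordLift_coord R _ _ (quarticVal_coord R') i

lemma irrelevant_le_map_coordMap :
    (irrelevant (coordGrading R')) ≤ (irrelevant (coordGrading R)).map (coordMap φ) := by
  rw [← toIdeal_le_toIdeal_iff]
  refine (irrelevant_le_span_coord R').trans (Ideal.span_le.2 ?_)
  rintro _ ⟨i, rfl⟩
  rw [← coordMap_coord φ]
  refine Ideal.mem_map_of_mem _ ?_
  exact HomogeneousIdeal.mem_irrelevant_of_mem _ one_pos (coord_mem R i)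

/-- The map of quartics induced by a ring homomorphism. -/
def quarticMap : quarticScheme R' ⟶ quarticScheme R :=
  Proj.map (coordMap φ) (irrelevant_le_map_coordMap φ)

/-- The map of charts induced by a ring homomorphism. -/
def chartMap (i : Fin 4) : Chart R i →+* Chart R' i :=
  chartLift ((chartC R' i).comp φ) (chartCoord R' i) (chartCoord_self R' i)
    (quarticVal_chartCoord R' i)

/-- `Proj.map` on a chart, for a ring map known only through its values on fractions and with `f s`
only propositionally equal to `s'`; this is the form in which `chartMap` is available. -/
lemma awayι_comp_map_of_mk {A A' : Type u} [CommRing A] [CommRing A'] [Algebra R A] [Algebra R' A']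
    {𝒜 : ℕ → Submodule R A} {𝒜' : ℕ → Submodule R' A'} [GradedAlgebra 𝒜] [GradedAlgebra 𝒜']
    (f : 𝒜 →+*ᵍ 𝒜')
    (hf : irrelevant 𝒜' ≤ (irrelevant 𝒜).map f) {s : A} {s' : A'} {d : ℕ} (hd : 0 < d)
    (hs : s ∈ 𝒜 d) (hs' : s' ∈ 𝒜' d) (h : f s = s') (g : Away 𝒜 s →+* Away 𝒜' s')
    (hg : ∀ n x hx, g (Away.mk 𝒜 hs n x hx) = Away.mk 𝒜' hs' n (f x) (f.2 hx)) :
    Proj.awayι 𝒜' s' hs' hd ≫ Proj.map f hf =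
      Spec.map (CommRingCat.ofHom (R := Away 𝒜 s) (S := Away 𝒜' s') g) ≫ Proj.awayι 𝒜 s hs hd := by
  subst h
  have : g = Away.map f s := by
    ext1 x
    obtain ⟨n, a, ha, rfl⟩ := Away.mk_surjective _ hs x
    rw [hg]
    exact (Away.map_mk f s hs n a ha).symm
  rw [this]
  exact Proj.awayι_comp_map f hf hd s hs

lemma chartMap_mk (i : Fin 4) (n : ℕ) (a : CoordRing R) (ha : a ∈ coordGrading R (n • 1)) :
    chartMap φ i (Away.mk _ (coord_mem R i) n a ha) =
      Away.mk _ (coord_mem R' i) n (coordMap φ a) ((coordMap φ).2 ha) := by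
  obtain ⟨p, hp, hap⟩ := exists_isHomogeneous_of_mem R ha
  rw [smul_eq_mul, mul_one] at hp
  rw [chart_mk_eq R' i (hp.map φ) (by rw [hap, coordMap_mk]), chartMap, chartLift_mk, hap,
    coordLift_mk, MvPolynomial.eval₂_map]

lemma chartι_quarticMap (i : Fin 4) :
    chartι R' i ≫ quarticMap φ = Spec.map (CommRingCat.ofHom (chartMap φ i)) ≫ chartι R i :=
  awayι_comp_map_of_mk _ _ one_pos (coord_mem R i) (coord_mem R' i) (coordMap_coord φ i) _
    (chartMap_mk φ i)

@[simp]
lemma chartMap_C (i : Fin 4) (r : R) : chartMap φ i (chartC R i r) = chartC R' i (φ r) :=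
  chartLift_C ..

@[simp]
lemma chartMap_coord (i j : Fin 4) : chartMap φ i (chartCoord R i j) = chartCoord R' i j :=
  chartLift_coord ..

/-- A zero of the quartic in an `R'`-algebra is the same thing over `R` and over `R'`, so the
universal properties agree. -/
lemma chartMap_isPushout (i : Fin 4) : IsPushout (CommRingCat.ofHom (chartC R i))
    (CommRingCat.ofHom φ) (CommRingCat.ofHom (chartMap φ i)) (CommRingCat.ofHom (chartC R' i)) := by
  refine ⟨⟨?_⟩, ⟨PushoutCocone.IsColimit.mk _ (fun s => CommRingCat.ofHom (chartLift s.inr.hom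
    (fun j => s.inl.hom (chartCoord R i j)) ?_ ?_)) ?_ ?_ ?_⟩⟩
  · ext r
    simp
  · simp
  · rw [← map_quarticVal, quarticVal_chartCoord, map_zero]
  · intro s
    refine CommRingCat.hom_ext (chart_hom_ext (fun r => ?_) fun j => ?_)
    · have := congrArg (fun f => f.hom r) s.condition
      simpa using this.symm
    · simp
  · intro s
    ext r
    simp
  · intro s m h₁ h₂
    refine CommRingCat.hom_ext (chart_hom_ext (fun r => ?_) fun j => ?_)
    · rw [CommRingCat.hom_ofHom, chartLift_C, ← h₂]
      rfl
    · rw [CommRingCat.hom_ofHom, chartLift_coord, ← h₁]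
      simp

lemma quarticMap_preimage (i : Fin 4) :
    quarticMap φ ⁻¹ᵁ (chartι R i).opensRange = (chartι R' i).opensRange := by
  rw [opensRange_chartι, opensRange_chartι, ← coordMap_coord φ]
  exact Proj.map_preimage_basicOpen _ _ _

/-- Being cartesian is local on the target. Over a chart the square is the spectrum of the pushout
of rings, because the preimage of a chart is the corresponding chart. -/
theorem quarticMap_isPullback :
    IsPullback (quarticMap φ) (quarticStr R') (quarticStr R) (Spec.map (CommRingCat.ofHom φ)) := by
  have key (i : Fin 4) : IsPullback (pullback.snd (quarticMap φ) (chartι R i))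
      (pullback.fst (quarticMap φ) (chartι R i) ≫ quarticStr R') (chartι R i ≫ quarticStr R)
      (Spec.map (CommRingCat.ofHom φ)) := by
    have h₁ : IsPullback (Spec.map (CommRingCat.ofHom (chartMap φ i))) (chartι R' i) (chartι R i)
        (quarticMap φ) :=
      IsOpenImmersion.isPullback _ _ _ _ (chartι_quarticMap φ i) (quarticMap_preimage φ i)
    have h₂ := isPullback_SpecMap_of_isPushout _ _ _ _ (chartMap_isPushout φ i)
    rw [chartι_str]
    refine h₂.of_iso h₁.flip.isoPullback (Iso.refl _) (Iso.refl _) (Iso.refl _) ?_ ?_ ?_ ?_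
    · simp
    · simp [chartι_str]
    · simp
    · simp
  exact Scheme.isPullback_of_openCover _ _ _ _ (chartCover R).openCover key

end BaseChange

/-! ### The fibres of the model as quartics -/

section Isos

variable {R : Type u} [CommRing R] {R' : Type u} [CommRing R'] (φ : R →+* R')

lemma exists_iso_baseChange {Y : Scheme.{u}} {f : Y ⟶ Spec (.of R)} (e : quarticScheme R ≅ Y)
    (he : e.hom ≫ f = quarticStr R) :
    ∃ e' : quarticScheme R' ≅ pullback f (Spec.map (CommRingCat.ofHom φ)),
      e'.hom ≫ baseChange f φ = quarticStr R' := by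
  have h : IsPullback (quarticMap φ ≫ e.hom) (quarticStr R') f (Spec.map (CommRingCat.ofHom φ)) :=
    (quarticMap_isPullback φ).of_iso (Iso.refl _) e (Iso.refl _) (Iso.refl _) (by simp) (by simp)
      (by simp [he]) (by simp)
  exact ⟨h.isoPullback, h.isoPullback_hom_snd⟩

lemma exists_iso_baseChange_quarticStr :
    ∃ e : quarticScheme R' ≅ pullback (quarticStr R) (Spec.map (CommRingCat.ofHom φ)),
      e.hom ≫ baseChange (quarticStr R) φ = quarticStr R' :=
  exists_iso_baseChange φ (Iso.refl _) (Category.id_comp _)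

lemma exists_iso_reduction₂ :
    ∃ e : quarticScheme (ZMod 2) ≅ pullback model₂ (Spec.map (CommRingCat.ofHom
      (PadicInt.toZMod (p := 2)))), e.hom ≫ reduction₂ = quarticStr (ZMod 2) := by
  obtain ⟨e, he⟩ := exists_iso_baseChange_quarticStr (algebraMap ℤ ℤ_[2])
  exact exists_iso_baseChange _ e he

lemma nonempty_genericFibre_iso :
    Nonempty (Over.mk (baseChange model₂ (algebraMap ℤ_[2] ℚ_[2])) ≅
      Over.mk (baseChange (quarticStr ℚ) (algebraMap ℚ ℚ_[2]))) := by
  obtain ⟨e, he⟩ := exists_iso_baseChange_quarticStr (algebraMap ℤ ℤ_[2])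
  obtain ⟨e₁, h₁⟩ := exists_iso_baseChange (algebraMap ℤ_[2] ℚ_[2]) e he
  obtain ⟨e₂, h₂⟩ := exists_iso_baseChange_quarticStr (algebraMap ℚ ℚ_[2])
  exact ⟨Over.isoMk (e₁.symm ≪≫ e₂) (by
    change (e₁.inv ≫ e₂.hom) ≫ baseChange (quarticStr ℚ) _ = baseChange model₂ _
    rw [Category.assoc, h₂, ← h₁, Iso.inv_hom_id_assoc])⟩

end Isos

/-! ### Properness -/

section Proper

variable (R : Type u) [CommRing R]

instance : Algebra.FiniteType (coordGrading R 0) (CoordRing R) := by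
  have : IsScalarTower R (coordGrading R 0) (CoordRing R) :=
    .of_algebraMap_eq (R := R) (S := coordGrading R 0) (A := CoordRing R) fun _ => rfl
  exact .of_restrictScalars_finiteType R _ _

lemma algebraMap_coordGrading_zero_surjective :
    Function.Surjective (algebraMap R (coordGrading R 0)) := by
  rintro ⟨a, ha⟩
  obtain ⟨p, hp, rfl⟩ := exists_isHomogeneous_of_mem R ha
  rw [← MvPolynomial.totalDegree_zero_iff_isHomogeneous, MvPolynomial.totalDegree_eq_zero_iff_eq_C]
    at hp
  exact ⟨p.coeff 0, Subtype.ext (congrArg (Ideal.Quotient.mk _) hp.symm)⟩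

/-- `Proj` is proper over its degree-zero part, and that part is a quotient of `R`. -/
instance : IsProper (quarticStr R) := by
  have : IsClosedImmersion (Spec.map (CommRingCat.ofHom (algebraMap R (coordGrading R 0)))) :=
    IsClosedImmersion.spec_of_surjective _ (algebraMap_coordGrading_zero_surjective R)
  have : IsProper (Proj.toSpecZero (coordGrading R)) := inferInstance
  exact inferInstanceAs (IsProper (Proj.toSpecZero (coordGrading R) ≫ _))

end Proper

/-! ### Partial derivatives and the Jacobian criterion modulo two -/

section Jacobian

/-- The value of the `j`-th partial derivative of the quartic form at a vector. -/
def quarticPDeriv {B : Type*} [CommRing B] (t : Fin 4 → B) (j : Fin 4) : B :=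
  3 * t j ^ 2 * t (j + 1) + t (j + 3) ^ 3 + t (j + 1) * t (j + 2) * t (j + 3)

lemma map_quarticPDeriv {B B' : Type*} [CommRing B] [CommRing B'] (φ : B →+* B') (t : Fin 4 → B)
    (j : Fin 4) : φ (quarticPDeriv t j) = quarticPDeriv (fun i => φ (t i)) j := by
  simp [quarticPDeriv, map_ofNat φ 3]

/-- The cyclic symmetry of the form; it reduces questions on any chart to the chart `x_0 = 1`. -/
lemma quarticVal_rotate {B : Type*} [CommRing B] (t : Fin 4 → B) (i : Fin 4) :
    quarticVal (fun j => t (j + i)) = quarticVal t := by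
  fin_cases i <;> simp [quarticVal] <;> ring

lemma quarticPDeriv_rotate {B : Type*} [CommRing B] (t : Fin 4 → B) (i j : Fin 4) :
    quarticPDeriv (fun j => t (j + i)) j = quarticPDeriv t (j + i) := by
  simp only [quarticPDeriv]
  rw [add_right_comm j 1 i, add_right_comm j 2 i, add_right_comm j 3 i]

/-- An explicit Nullstellensatz identity: modulo two, the equation and its derivatives in `y, z, w`
generate the unit ideal. The element `h` is the correction when that identity is lifted to integral
coefficients. -/
lemma quartic_certificate {B : Type*} [CommRing B] {t : Fin 4 → B} (h₀ : t 0 = 1)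
    (ht : quarticVal t = 0) :
    ∃ (g : Fin 3 → B) (h : B), ∑ j, g j * quarticPDeriv t j.succ + 2 * h = 1 := by
  obtain ⟨y, z, w, hy, hz, hw⟩ : ∃ y z w, t 1 = y ∧ t 2 = z ∧ t 3 = w := ⟨_, _, _, rfl, rfl, rfl⟩
  have hf : y + y ^ 3 * z + z ^ 3 * w + w ^ 3 + y * z * w = 0 := by
    rw [← ht, quarticVal, h₀, hy, hz, hw]
    ring
  refine ⟨![1 + z * w + z ^ 2 * w ^ 2 + y * z * w ^ 3 + y ^ 5, z * w ^ 2 + y * w ^ 3 + y * z ^ 2,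
    z * w ^ 4 + y * z ^ 2 * w ^ 2 + y ^ 2 * w ^ 2],
    -2 * y * z * w^3 - 2 * y^3 * z^2 * w^3 - z^4 * w^4 - 2 * z * w^6 - 5 * y * z^2 * w^4
      - 2 * y^2 * z - y^4 * z^2 - 2 * y * z^4 * w - 3 * y^2 * z^2 * w - y^4 * z^3 * w
      - y * z^5 * w^2 - 3 * y^2 * z^3 * w^2 - y^5 - 2 * y^7 * z - y^4 * w^3 - y^5 * z * w
      - z * w - z^2 * w^2 - 2 * z^3 * w^3 - y^3 * z * w^2 - 2 * y^2 * w^4, ?_⟩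
  have e₁ : quarticPDeriv t 1 = 3 * y ^ 2 * z + 1 + z * w := by
    simp [quarticPDeriv, h₀, hy, hz, hw]
  have e₂ : quarticPDeriv t 2 = 3 * z ^ 2 * w + y ^ 3 + w * y := by
    simp [quarticPDeriv, h₀, hy, hz, hw]
  have e₃ : quarticPDeriv t 3 = 3 * w ^ 2 + z ^ 3 + y * z := by
    simp [quarticPDeriv, h₀, hy, hz, hw]
  simp only [Fin.sum_univ_three]
  change _ * quarticPDeriv t 1 + _ * quarticPDeriv t 2 + _ * quarticPDeriv t 3 + _ = _
  rw [e₁, e₂, e₃]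
  simp only [Matrix.cons_val]
  linear_combination -(z * w ^ 3 + y * z + y * z ^ 2 * w + y ^ 4) * hf

/-- The quartic is smooth at points of residue characteristic two. -/
lemma exists_quarticPDeriv_notMem {B : Type*} [CommRing B] {t : Fin 4 → B} {i : Fin 4}
    (hi : t i = 1) (ht : quarticVal t = 0) (P : Ideal B) [P.IsPrime] (h2 : (2 : B) ∈ P) :
    ∃ j, j ≠ i ∧ quarticPDeriv t j ∉ P := by
  obtain ⟨g, h, hg⟩ := quartic_certificate (t := fun j => t (j + i)) (by simpa using hi)
    (by rwa [quarticVal_rotate])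
  by_contra! H
  refine Ideal.IsPrime.ne_top ‹_› ((Ideal.eq_top_iff_one P).2 ?_)
  rw [← hg]
  refine add_mem (sum_mem fun j _ => P.mul_mem_left _ ?_) (P.mul_mem_right _ h2)
  rw [quarticPDeriv_rotate]
  exact H _ (by simp)

end Jacobian

/-! ### Patches: the loci in a chart where a partial derivative is invertible -/

section Patch

variable (R : Type u) [CommRing R] (i j : Fin 4)

/-- The equations of the part of the chart `x_i = 1` where the `j`-th partial derivative of the
quartic is invertible. -/
def patchRel : Fin 3 → MvPolynomial (Option (Fin 4)) R :=
  ![quarticVal fun k => .X (some k), .X (some i) - 1,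
    .X none * quarticPDeriv (fun k => .X (some k)) j - 1]

lemma patchRel_zero : patchRel R i j 0 = quarticVal fun k => .X (some k) := rfl

lemma patchRel_one : patchRel R i j 1 = .X (some i) - 1 := rfl

lemma patchRel_two :
    patchRel R i j 2 = .X none * quarticPDeriv (fun k => .X (some k)) j - 1 := rfl

/-- The coordinate ring of the part of the chart `x_i = 1` where the `j`-th partial derivative of
the quartic is invertible. -/
abbrev Patch : Type u :=
  MvPolynomial (Option (Fin 4)) R ⧸ Ideal.span (Set.range (patchRel R i j))

/-- The coordinates of a patch. -/
def patchCoord (k : Fin 4) : Patch R i j := Ideal.Quotient.mk _ (.X (some k))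

/-- The inverse of the partial derivative on a patch. -/
def patchInv : Patch R i j := Ideal.Quotient.mk _ (.X none)

lemma mk_patchRel (m : Fin 3) :
    Ideal.Quotient.mk (Ideal.span (Set.range (patchRel R i j))) (patchRel R i j m) = 0 :=
  Ideal.Quotient.eq_zero_iff_mem.2 (Ideal.subset_span ⟨m, rfl⟩)

lemma quarticVal_patchCoord : quarticVal (patchCoord R i j) = 0 := by
  rw [← mk_patchRel R i j 0]
  exact (map_quarticVal (Ideal.Quotient.mk _) _).symm

lemma patchCoord_self : patchCoord R i j i = 1 := by
  have h : Ideal.Quotient.mk (Ideal.span (Set.range (patchRel R i j))) (.X (some i) - 1) = 0 :=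
    mk_patchRel R i j 1
  rwa [map_sub, map_one, sub_eq_zero] at h

lemma patchInv_mul : patchInv R i j * quarticPDeriv (patchCoord R i j) j = 1 := by
  have h : Ideal.Quotient.mk (Ideal.span (Set.range (patchRel R i j)))
      (.X none * quarticPDeriv (fun k => .X (some k)) j - 1) = 0 := mk_patchRel R i j 2
  rwa [map_sub, map_one, sub_eq_zero, map_mul, map_quarticPDeriv] at h

lemma pderiv_quarticVal_X :
    MvPolynomial.pderiv (some j)
      (quarticVal fun k => (.X (some k) : MvPolynomial (Option (Fin 4)) R)) =
      quarticPDeriv (fun k => .X (some k)) j := by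
  fin_cases j <;> simp [quarticVal, quarticPDeriv, MvPolynomial.pderiv_X] <;> ring

lemma patchVar_injective {i j : Fin 4} (hij : j ≠ i) :
    Function.Injective ![some j, some i, none] := by
  revert i j
  decide

/-- The presentation of a patch, without the condition on the Jacobian. -/
def prePatchPresentation {i j : Fin 4} (hij : j ≠ i) :
    Algebra.PreSubmersivePresentation R (Patch R i j) (Option (Fin 4)) (Fin 3) :=
  .naive (v := patchRel R i j) ![some j, some i, none] (patchVar_injective hij)

lemma jacobiMatrix_prePatchPresentation {i j : Fin 4} (hij : j ≠ i) (a b : Fin 3) :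
    (prePatchPresentation R hij).jacobiMatrix a b =
      MvPolynomial.pderiv (![some j, some i, none] a) (patchRel R i j b) :=
  Algebra.PreSubmersivePresentation.jacobiMatrix_naive ..

/-- Rows belong to the variables `x_j`, `x_i` and the inverse `v`, columns to the three equations.
Three zeros and a one reduce the determinant to the derivative of the quartic in `x_j` times that of
`v ∂_jF - 1` in `v`; both are `∂_jF`. -/
lemma det_jacobiMatrix_prePatchPresentation {i j : Fin 4} (hij : j ≠ i) :
    (prePatchPresentation R hij).jacobiMatrix.det =
      (quarticPDeriv (fun k => .X (some k)) j ^ 2 : MvPolynomial (Option (Fin 4)) R) := by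
  have e₁ : MvPolynomial.pderiv (some j) (patchRel R i j 0) =
      quarticPDeriv (fun k => .X (some k)) j := pderiv_quarticVal_X R j
  have e₂ : MvPolynomial.pderiv (some j) (patchRel R i j 1) = 0 := by
    simp [patchRel, MvPolynomial.pderiv_X, hij.symm]
  have e₃ : MvPolynomial.pderiv (some i) (patchRel R i j 1) = 1 := by
    simp [patchRel]
  have e₄ : MvPolynomial.pderiv none (patchRel R i j 0) = 0 := by
    simp [patchRel, quarticVal, MvPolynomial.pderiv_X]
  have e₅ : MvPolynomial.pderiv none (patchRel R i j 1) = 0 := by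
    simp [patchRel, MvPolynomial.pderiv_X]
  have e₆ : MvPolynomial.pderiv none (patchRel R i j 2) =
      quarticPDeriv (fun k => .X (some k)) j := by
    have h3 : MvPolynomial.pderiv none (3 : MvPolynomial (Option (Fin 4)) R) = 0 :=
      Derivation.map_natCast _ 3
    simp [patchRel, quarticPDeriv, MvPolynomial.pderiv_X, h3]
  have det (M : Matrix (Fin 3) (Fin 3) (MvPolynomial (Option (Fin 4)) R)) (h₁ : M 0 1 = 0)
      (h₂ : M 2 0 = 0) (h₃ : M 2 1 = 0) (h₄ : M 1 1 = 1) : M.det = M 0 0 * M 2 2 := by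
    rw [Matrix.det_fin_three, h₁, h₂, h₃, h₄]
    ring
  refine (det _ ?_ ?_ ?_ ?_).trans ?_
  · exact (jacobiMatrix_prePatchPresentation R hij 0 1).trans e₂
  · exact (jacobiMatrix_prePatchPresentation R hij 2 0).trans e₄
  · exact (jacobiMatrix_prePatchPresentation R hij 2 1).trans e₅
  · exact (jacobiMatrix_prePatchPresentation R hij 1 1).trans e₃
  · rw [sq]
    exact congrArg₂ _ ((jacobiMatrix_prePatchPresentation R hij 0 0).trans e₁)
      ((jacobiMatrix_prePatchPresentation R hij 2 2).trans e₆)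

/-- The presentation of a patch. -/
def patchPresentation {i j : Fin 4} (hij : j ≠ i) :
    Algebra.SubmersivePresentation R (Patch R i j) (Option (Fin 4)) (Fin 3) where
  __ := prePatchPresentation R hij
  jacobian_isUnit := by
    rw [Algebra.PreSubmersivePresentation.jacobian_eq_jacobiMatrix_det]
    erw [det_jacobiMatrix_prePatchPresentation]
    change IsUnit (Ideal.Quotient.mk _ _)
    rw [map_pow, map_quarticPDeriv]
    exact (IsUnit.of_mul_eq_one_right _ (patchInv_mul R i j)).pow 2

lemma patchPresentation_dimension {i j : Fin 4} (hij : j ≠ i) :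
    (patchPresentation R hij).dimension = 2 := by
  simp [Algebra.Presentation.dimension]

lemma isStandardSmooth_patch {i j : Fin 4} (hij : j ≠ i) :
    Algebra.IsStandardSmoothOfRelativeDimension 2 R (Patch R i j) :=
  (patchPresentation R hij).isStandardSmoothOfRelativeDimension (patchPresentation_dimension R hij)

/-- The map from a chart to a patch of it. -/
def chartToPatch : Chart R i →+* Patch R i j :=
  chartLift (algebraMap R _) (patchCoord R i j) (patchCoord_self R i j)
    (quarticVal_patchCoord R i j)

variable {R i j}

lemma patch_hom_ext {B : Type*} [CommRing B] {f g : Patch R i j →+* B}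
    (hC : ∀ r, f (algebraMap R _ r) = g (algebraMap R _ r))
    (hX : ∀ k, f (patchCoord R i j k) = g (patchCoord R i j k)) : f = g := by
  refine Ideal.Quotient.ringHom_ext (MvPolynomial.ringHom_ext hC ?_)
  rintro (_ | k)
  · have h (f : Patch R i j →+* B) :
        f (patchInv R i j) * quarticPDeriv (fun k => f (patchCoord R i j k)) j = 1 := by
      rw [← map_quarticPDeriv, ← map_mul, patchInv_mul, map_one]
    have hf := h f
    rw [funext hX] at hf
    exact (IsUnit.of_mul_eq_one_right _ hf).mul_right_cancel (hf.trans (h g).symm)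
  · exact hX k

lemma span_patchRel_le_ker {B : Type*} [CommRing B] (φ : R →+* B) {t : Fin 4 → B} {v : B}
    (hi : t i = 1) (ht : quarticVal t = 0) (hv : v * quarticPDeriv t j = 1) :
    Ideal.span (Set.range (patchRel R i j)) ≤
      RingHom.ker (MvPolynomial.eval₂Hom φ fun k => k.elim v t) := by
  rw [Ideal.span_le, Set.range_subset_iff]
  have hX (k : Fin 4) : MvPolynomial.eval₂Hom φ (fun k : Option (Fin 4) => k.elim v t)
      (.X (some k)) = t k := MvPolynomial.eval₂Hom_X' ..
  have hX' : MvPolynomial.eval₂Hom φ (fun k : Option (Fin 4) => k.elim v t) (.X none) = v :=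
    MvPolynomial.eval₂Hom_X' ..
  intro m
  rw [SetLike.mem_coe, RingHom.mem_ker]
  obtain rfl | rfl | rfl : m = 0 ∨ m = 1 ∨ m = 2 := by revert m; decide
  · rw [patchRel_zero, map_quarticVal]
    simp_rw [hX]
    exact ht
  · rw [patchRel_one, map_sub, hX, hi, map_one, sub_self]
  · rw [patchRel_two, map_sub, map_mul, map_quarticPDeriv, hX', map_one]
    simp_rw [hX]
    rw [hv, sub_self]

/-- The homomorphism out of a patch. -/
def patchLift {B : Type*} [CommRing B] (φ : R →+* B) (t : Fin 4 → B) (v : B) (hi : t i = 1)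
    (ht : quarticVal t = 0) (hv : v * quarticPDeriv t j = 1) : Patch R i j →+* B :=
  Ideal.Quotient.lift _ (MvPolynomial.eval₂Hom φ (fun k => k.elim v t))
    fun _ ha => span_patchRel_le_ker φ hi ht hv ha

@[simp]
lemma patchLift_algebraMap {B : Type*} [CommRing B] (φ : R →+* B) (t : Fin 4 → B) (v : B)
    (hi : t i = 1) (ht : quarticVal t = 0) (hv : v * quarticPDeriv t j = 1) (r : R) :
    patchLift φ t v hi ht hv (algebraMap R _ r) = φ r :=
  MvPolynomial.eval₂_C ..

@[simp]
lemma patchLift_coord {B : Type*} [CommRing B] (φ : R →+* B) (t : Fin 4 → B) (v : B)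
    (hi : t i = 1) (ht : quarticVal t = 0) (hv : v * quarticPDeriv t j = 1) (k : Fin 4) :
    patchLift φ t v hi ht hv (patchCoord R i j k) = t k :=
  MvPolynomial.eval₂_X ..

variable (R i j)

@[simp]
lemma chartToPatch_C (r : R) : chartToPatch R i j (chartC R i r) = algebraMap R _ r :=
  chartLift_C _ _ (patchCoord_self R i j) (quarticVal_patchCoord R i j) r

@[simp]
lemma chartToPatch_coord (k : Fin 4) :
    chartToPatch R i j (chartCoord R i k) = patchCoord R i j k :=
  chartLift_coord _ _ (patchCoord_self R i j) (quarticVal_patchCoord R i j) k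

lemma isUnit_chartToPatch : IsUnit (chartToPatch R i j (quarticPDeriv (chartCoord R i) j)) := by
  rw [map_quarticPDeriv]
  simp_rw [chartToPatch_coord]
  exact .of_mul_eq_one_right _ (patchInv_mul R i j)

/-- Both rings represent the zeros of the quartic with `i`-th coordinate `1` and invertible `j`-th
derivative. -/
lemma isLocalization_patch :
    letI := (chartToPatch R i j).toAlgebra
    IsLocalization.Away (quarticPDeriv (chartCoord R i) j) (Patch R i j) := by
  let _ := (chartToPatch R i j).toAlgebra
  set a := quarticPDeriv (chartCoord R i) j
  let f : Localization.Away a →+* Patch R i j := IsLocalization.Away.lift a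
    (isUnit_chartToPatch R i j)
  have hf (x : Chart R i) : f (algebraMap _ _ x) = chartToPatch R i j x :=
    IsLocalization.Away.lift_eq ..
  let g : Patch R i j →+* Localization.Away a :=
    patchLift ((algebraMap (Chart R i) (Localization.Away a)).comp (chartC R i))
    (fun k => algebraMap _ _ (chartCoord R i k)) (IsLocalization.Away.invSelf a)
    (by simp)
    (by rw [← map_quarticVal, quarticVal_chartCoord, map_zero]) (by
      rw [← map_quarticPDeriv, mul_comm]
      exact IsLocalization.Away.mul_invSelf a)
  have hg : (g.comp (chartToPatch R i j)) = algebraMap (Chart R i) (Localization.Away a) :=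
    chart_hom_ext (fun r => by simp [g]) fun k => by simp [g]
  have hgf : g.comp f = RingHom.id _ := by
    refine IsLocalization.ringHom_ext (Submonoid.powers a) ?_
    rw [RingHom.comp_assoc, show f.comp (algebraMap _ _) = chartToPatch R i j from RingHom.ext hf,
      hg, RingHom.id_comp]
  have hfg : f.comp g = RingHom.id _ :=
    patch_hom_ext (fun r => by simp [g, hf]) fun k => by simp [g, hf]
  exact IsLocalization.isLocalization_of_algEquiv (Submonoid.powers a)
    (AlgEquiv.ofRingEquiv (f := RingEquiv.ofRingHom f g hfg hgf) hf)

/-- The open immersion of a patch. -/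
def patchι : Spec (.of (Patch R i j)) ⟶ quarticScheme R :=
  Spec.map (CommRingCat.ofHom (chartToPatch R i j)) ≫ chartι R i

lemma patchι_str : patchι R i j ≫ quarticStr R =
    Spec.map (CommRingCat.ofHom (algebraMap R (Patch R i j))) := by
  rw [patchι, Category.assoc, chartι_str, ← Spec.map_comp]
  congr 1
  ext r
  exact chartToPatch_C R i j r

instance : IsOpenImmersion (patchι R i j) := by
  have := isLocalization_patch R i j
  let := (chartToPatch R i j).toAlgebra
  have : IsOpenImmersion (Spec.map (CommRingCat.ofHom (chartToPatch R i j))) :=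
    IsOpenImmersion.of_isLocalization (quarticPDeriv (chartCoord R i) j)
  exact inferInstanceAs (IsOpenImmersion (_ ≫ _))

end Patch

/-! ### Smoothness in characteristic two and over `ℤ_[2]` -/

section Smooth

variable {R : Type u} [CommRing R]

lemma range_patchι (i j : Fin 4) : Set.range (patchι R i j) =
    chartι R i '' (PrimeSpectrum.basicOpen (quarticPDeriv (chartCoord R i) j) :
      Set (PrimeSpectrum (Chart R i))) := by
  let := (chartToPatch R i j).toAlgebra
  have := isLocalization_patch R i j
  have h := PrimeSpectrum.localization_away_comap_range (Patch R i j)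
    (quarticPDeriv (chartCoord R i) j)
  refine Eq.trans ?_ (congrArg (chartι R i '' ·) h)
  exact Set.range_comp (chartι R i) (PrimeSpectrum.comap (chartToPatch R i j))

lemma exists_mem_range_chartι (x : quarticScheme R) : ∃ i y, chartι R i y = x := by
  obtain ⟨y, hy⟩ := (chartCover R).openCover.covers x
  exact ⟨(chartCover R).openCover.idx x, y, hy⟩

lemma exists_mem_range_patchι (x : quarticScheme R) (hx : (2 : R) ∈ (quarticStr R x).asIdeal) :
    ∃ i j, j ≠ i ∧ x ∈ Set.range (patchι R i j) := by
  obtain ⟨i, y, rfl⟩ := exists_mem_range_chartι x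
  rw [← Scheme.Hom.comp_apply, chartι_str] at hx
  have hy : y.asIdeal.IsPrime := PrimeSpectrum.isPrime _
  replace hx : chartC R i 2 ∈ y.asIdeal := hx
  rw [map_ofNat] at hx
  obtain ⟨j, hj, h⟩ := exists_quarticPDeriv_notMem (chartCoord_self R i)
    (quarticVal_chartCoord R i) y.asIdeal hx
  refine ⟨i, j, hj, ?_⟩
  rw [range_patchι]
  exact Set.mem_image_of_mem _ h

lemma smoothOfRelativeDimension_patchι {i j : Fin 4} (hij : j ≠ i) :
    SmoothOfRelativeDimension 2 (patchι R i j ≫ quarticStr R) := by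
  rw [patchι_str, HasRingHomProperty.Spec_iff (P := @SmoothOfRelativeDimension 2)]
  exact RingHom.locally_of RingHom.isStandardSmoothOfRelativeDimension_respectsIso _
    ((RingHom.isStandardSmoothOfRelativeDimension_algebraMap _).2 (isStandardSmooth_patch R hij))

theorem smoothOfRelativeDimension_quarticStr [CharP R 2] :
    SmoothOfRelativeDimension 2 (quarticStr R) := by
  have : IsZariskiLocalAtSource (@SmoothOfRelativeDimension 2) :=
    HasRingHomProperty.instIsZariskiLocalAtSource
      (Q := RingHom.Locally (RingHom.IsStandardSmoothOfRelativeDimension 2))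
  refine IsZariskiLocalAtSource.of_iSup_eq_top (P := @SmoothOfRelativeDimension 2)
    (fun p : { p : Fin 4 × Fin 4 // p.2 ≠ p.1 } => (patchι R p.1.1 p.1.2).opensRange) ?_ ?_
  · refine top_le_iff.1 fun x _ => ?_
    obtain ⟨i, j, hij, hx⟩ := exists_mem_range_patchι x (by
      rw [show (2 : R) = 0 from CharP.cast_eq_zero R 2]
      exact zero_mem _)
    exact TopologicalSpace.Opens.mem_iSup.2 ⟨⟨(i, j), hij⟩, hx⟩
  · rintro ⟨⟨i, j⟩, hij⟩
    have h := smoothOfRelativeDimension_patchι (R := R) hij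
    rw [← (patchι R i j).isoOpensRange_inv_comp, Category.assoc]
    exact IsZariskiLocalAtSource.comp h _

lemma opensRange_patchι_le {i j : Fin 4} (hij : j ≠ i)
    [LocallyOfFinitePresentation (quarticStr R)] :
    (patchι R i j).opensRange ≤ (quarticStr R).smoothLocus := by
  have h₂ := smoothOfRelativeDimension_patchι (R := R) hij
  have h₃ : Smooth (patchι R i j ≫ quarticStr R) := SmoothOfRelativeDimension.smooth 2 _
  have h := Scheme.Hom.preimage_smoothLocus_eq (patchι R i j) (quarticStr R)
  rw [Scheme.Hom.smoothLocus_eq_top (patchι R i j ≫ quarticStr R)] at h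
  rintro _ ⟨x, rfl⟩
  have : x ∈ (⊤ : (Spec (.of (Patch R i j))).Opens) := trivial
  rwa [← h] at this

lemma locallyOfFinitePresentation_quarticStr [IsNoetherianRing R] :
    LocallyOfFinitePresentation (quarticStr R) := by
  have : IsLocallyNoetherian (Spec (.of R)) := inferInstance
  exact LocallyOfFinitePresentation.iff_locallyOfFiniteType.2 inferInstance

/-- Points over the closed point lie in smooth patches. By properness the image of the non-smooth
locus is closed; if non-empty, it contains the closed point, to which every point of the base
specializes. -/
theorem smooth_quarticStr_of_isLocalRing [IsNoetherianRing R] [IsLocalRing R]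
    (h2 : (2 : R) ∈ IsLocalRing.maximalIdeal R) : Smooth (quarticStr R) := by
  have := locallyOfFinitePresentation_quarticStr (R := R)
  rw [← Scheme.Hom.smoothLocus_eq_top_iff, ← top_le_iff]
  intro x _
  by_contra hx
  have hcl : IsClosed (quarticStr R '' ((quarticStr R).smoothLocus : Set (quarticScheme R))ᶜ) :=
    (quarticStr R).isClosedMap _ (quarticStr R).smoothLocus.isOpen.isClosed_compl
  have hs : (quarticStr R x) ⤳ IsLocalRing.closedPoint R :=
    IsLocalRing.specializes_closedPoint _
  obtain ⟨y, hy, hyx⟩ := hs.mem_closed hcl ⟨x, hx, rfl⟩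
  obtain ⟨i, j, hij, h⟩ := exists_mem_range_patchι y (by
    rw [hyx]
    exact h2)
  exact hy (opensRange_patchι_le hij h)

lemma smooth_model₂ : Smooth model₂ := by
  obtain ⟨e, he⟩ := exists_iso_baseChange_quarticStr (algebraMap ℤ ℤ_[2])
  have hs : Smooth (quarticStr ℤ_[2]) := smooth_quarticStr_of_isLocalRing (by
    rw [PadicInt.maximalIdeal_eq_span_p]
    exact Ideal.subset_span rfl)
  have : IsZariskiLocalAtSource @Smooth :=
    HasRingHomProperty.instIsZariskiLocalAtSource (Q := RingHom.Smooth)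
  rw [show model₂ = e.inv ≫ quarticStr ℤ_[2] from (Iso.eq_inv_comp e).2 he]
  exact IsZariskiLocalAtSource.comp hs _

theorem isGoodModelAt_model₂ : IsGoodModelAt 2 (quarticStr ℚ) model₂ where
  smooth := smooth_model₂
  isProper := inferInstanceAs (IsProper (pullback.snd _ _))
  generic_fibre := nonempty_genericFibre_iso

end Smooth

/-! ### Geometric integrality -/

section Integral

open HomogeneousLocalization Polynomial

lemma chartι_preimage_dPlus (R : Type u) [CommRing R] (i j : Fin 4) :
    chartι R i ⁻¹ᵁ dPlus R (coord R j) = PrimeSpectrum.basicOpen (chartCoord R i j) := by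
  have h : chartι R i ⁻¹ᵁ dPlus R (coord R j) = _ :=
    Proj.awayι_preimage_basicOpen (coordGrading R) (coord_mem R i) one_pos (coord_mem R j) one_pos
  rw [h]
  congr 1
  simp only [Away.isLocalizationElem, chartCoord, pow_one]

variable (K : Type u) [Field K]

/-- The polynomial in `w` defining an affine chart of the quartic. -/
def affinePoly : (MvPolynomial (Fin 2) K)[X] :=
  X ^ 3 + (C (.X 1 ^ 3 + .X 0 * .X 1) * X + C (.X 0 + .X 0 ^ 3 * .X 1))

lemma degree_affinePoly_aux :
    (C (.X 1 ^ 3 + .X 0 * .X 1) * X + C (.X 0 + .X 0 ^ 3 * .X 1) :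
      (MvPolynomial (Fin 2) K)[X]).degree < (3 : ℕ) :=
  degree_linear_le.trans_lt (by norm_num)

lemma affinePoly_monic : (affinePoly K).Monic :=
  monic_X_pow_add (degree_affinePoly_aux K)

lemma degree_affinePoly : (affinePoly K).degree = 3 :=
  (degree_add_eq_left_of_degree_lt (by
    rw [degree_X_pow]
    exact degree_affinePoly_aux K)).trans (degree_X_pow 3)

lemma natDegree_affinePoly : (affinePoly K).natDegree = 3 :=
  natDegree_eq_of_degree_eq_some (degree_affinePoly K)

lemma eval₂_affinePoly {B : Type*} [CommRing B] (φ : MvPolynomial (Fin 2) K →+* B) (w : B) :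
    (affinePoly K).eval₂ φ w =
      w ^ 3 + (φ (.X 1 ^ 3 + .X 0 * .X 1) * w + φ (.X 0 + .X 0 ^ 3 * .X 1)) := by
  simp only [affinePoly, eval₂_add, eval₂_mul, eval₂_pow, eval₂_X, eval₂_C]

/-- A monic cubic over a domain is irreducible if it has no root. At `z = 0` the polynomial becomes
`w³ + y`, so a root would specialize to a polynomial whose cube is `-y`, contradicting degrees. -/
lemma affinePoly_irreducible : Irreducible (affinePoly K) := by
  rw [(affinePoly_monic K).irreducible_iff_roots_eq_zero_of_degree_le_three
    (by simp [natDegree_affinePoly]) (natDegree_affinePoly K).le]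
  rw [Multiset.eq_zero_iff_forall_notMem]
  intro a ha
  have ha' := (mem_roots (affinePoly_monic K).ne_zero).1 ha
  let φ : MvPolynomial (Fin 2) K →+* K[X] := (MvPolynomial.aeval ![X, 0]).toRingHom
  have h0 : φ (.X 0) = X := by simp [φ]
  have h1 : φ (.X 1) = 0 := by simp [φ]
  have h : φ a ^ 3 = - X := by
    have := congrArg φ ha'
    rw [affinePoly] at this
    simp only [eval_add, eval_mul, eval_pow, eval_X, eval_C, map_add, map_mul, map_pow, h0, h1,
      map_zero] at this
    linear_combination this
  have h' := congrArg natDegree h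
  rw [natDegree_pow, natDegree_neg, natDegree_X] at h'
  omega

instance : IsDomain (AdjoinRoot (affinePoly K)) :=
  AdjoinRoot.isDomain_of_prime (affinePoly_irreducible K).prime

/-- Homogeneous coordinates over the domain defining an affine chart of the quartic. -/
def affineCoord : Fin 4 → AdjoinRoot (affinePoly K) :=
  ![1, AdjoinRoot.of _ (.X 0), AdjoinRoot.of _ (.X 1), AdjoinRoot.root _]

lemma of_affinePoly_injective : Function.Injective (AdjoinRoot.of (affinePoly K)) :=
  AdjoinRoot.of.injective_of_degree_ne_zero (by simp [degree_affinePoly])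

lemma root_affinePoly : AdjoinRoot.root (affinePoly K) ^ 3 +
    ((AdjoinRoot.of _ (.X 1) ^ 3 + AdjoinRoot.of _ (.X 0) * AdjoinRoot.of _ (.X 1)) *
      AdjoinRoot.root (affinePoly K) +
      (AdjoinRoot.of _ (.X 0) + AdjoinRoot.of _ (.X 0) ^ 3 * AdjoinRoot.of _ (.X 1))) = 0 := by
  have := AdjoinRoot.eval₂_root (affinePoly K)
  rw [eval₂_affinePoly] at this
  simpa only [map_add, map_mul, map_pow] using this

lemma quarticVal_affineCoord : quarticVal (affineCoord K) = 0 := by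
  rw [← root_affinePoly K]
  simp only [quarticVal, affineCoord, Matrix.cons_val]
  ring

lemma affineCoord_ne_zero (j : Fin 4) : affineCoord K j ≠ 0 := by
  have h (k : Fin 2) : AdjoinRoot.of (affinePoly K) (.X k) ≠ 0 := by
    rw [Ne, (injective_iff_map_eq_zero' _).1 (of_affinePoly_injective K)]
    exact MvPolynomial.X_ne_zero k
  obtain rfl | rfl | rfl | rfl : j = 0 ∨ j = 1 ∨ j = 2 ∨ j = 3 := by revert j; decide
  · exact one_ne_zero
  · exact h 0
  · exact h 1
  · intro h0
    change AdjoinRoot.root (affinePoly K) = 0 at h0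
    have := root_affinePoly K
    rw [h0, mul_zero, zero_add, zero_pow three_ne_zero, zero_add, ← map_pow, ← map_mul, ← map_add,
      (injective_iff_map_eq_zero' _).1 (of_affinePoly_injective K)] at this
    -- The constant term `y + y³z` takes the value `1` at `(1, 0)`.
    have h := congrArg (MvPolynomial.aeval (![1, 0] : Fin 2 → K)) this
    simp at h

/-- The map from a chart to the domain defining it. -/
def chartToAdjoinRoot (i : Fin 4) : Chart K i →+* AdjoinRoot (affinePoly K) :=
  chartLift ((AdjoinRoot.of _).comp MvPolynomial.C) (fun j => affineCoord K (j - i))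
    (by rw [sub_self]; rfl) (by
      simp_rw [sub_eq_add_neg]
      rw [quarticVal_rotate, quarticVal_affineCoord])

lemma chartToAdjoinRoot_coord (i j : Fin 4) :
    chartToAdjoinRoot K i (chartCoord K i j) = affineCoord K (j - i) :=
  chartLift_coord ..

/-- The rotated chart coordinates satisfy the same cubic, which gives a left inverse. -/
lemma chartToAdjoinRoot_injective (i : Fin 4) : Function.Injective (chartToAdjoinRoot K i) := by
  set t : Fin 4 → Chart K i := fun j => chartCoord K i (j + i) with ht
  have h0 : t 0 = 1 := by simp [ht]
  have hv : quarticVal t = 0 := by rw [quarticVal_rotate, quarticVal_chartCoord]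
  let φ : MvPolynomial (Fin 2) K →+* Chart K i :=
    MvPolynomial.eval₂Hom (chartC K i) ![t 1, t 2]
  have hφ0 : φ (.X 0) = t 1 := by simp [φ]
  have hφ1 : φ (.X 1) = t 2 := by simp [φ]
  let ψ : AdjoinRoot (affinePoly K) →+* Chart K i := AdjoinRoot.lift φ (t 3) (by
    rw [eval₂_affinePoly]
    simp only [map_add, map_mul, map_pow, hφ0, hφ1]
    rw [← hv, quarticVal, h0]
    ring)
  have hψ (j : Fin 4) : ψ (affineCoord K j) = t j := by
    obtain rfl | rfl | rfl | rfl : j = 0 ∨ j = 1 ∨ j = 2 ∨ j = 3 := by revert j; decide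
    · rw [h0]
      exact map_one _
    · exact (AdjoinRoot.lift_of _).trans hφ0
    · exact (AdjoinRoot.lift_of _).trans hφ1
    · exact AdjoinRoot.lift_root _
  have h : ψ.comp (chartToAdjoinRoot K i) = RingHom.id _ := by
    refine chart_hom_ext (fun r => ?_) fun j => ?_
    · rw [RingHom.comp_apply, chartToAdjoinRoot, chartLift_C]
      exact (AdjoinRoot.lift_of _).trans (MvPolynomial.eval₂Hom_C ..)
    · rw [RingHom.comp_apply, chartToAdjoinRoot_coord, hψ, ht]
      simp
  exact Function.LeftInverse.injective (RingHom.congr_fun h)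

instance (i : Fin 4) : IsDomain (Chart K i) :=
  (chartToAdjoinRoot_injective K i).isDomain

lemma chartCoord_ne_zero (i j : Fin 4) : chartCoord K i j ≠ 0 := by
  intro h
  apply affineCoord_ne_zero K (j - i)
  rw [← chartToAdjoinRoot_coord, h, map_zero]

lemma dPlus_inter_nonempty (i j : Fin 4) :
    ((dPlus K (coord K i) ∩ dPlus K (coord K j) : Set (quarticScheme K))).Nonempty := by
  refine ⟨chartι K i (⊥ : PrimeSpectrum (Chart K i)), ?_, ?_⟩
  · rw [← opensRange_chartι]
    exact ⟨_, rfl⟩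
  · change (⊥ : PrimeSpectrum (Chart K i)) ∈ chartι K i ⁻¹ᵁ dPlus K (coord K j)
    rw [chartι_preimage_dPlus]
    exact chartCoord_ne_zero K i j

lemma isPreirreducible_dPlus (i : Fin 4) :
    IsPreirreducible (dPlus K (coord K i) : Set (quarticScheme K)) := by
  rw [← opensRange_chartι]
  have h := (PreirreducibleSpace.isPreirreducible_univ (X := PrimeSpectrum (Chart K i))).image
    (chartι K i) (chartι K i).continuous.continuousOn
  have e : ((chartι K i).opensRange : Set (quarticScheme K)) = chartι K i '' Set.univ :=
    Set.image_univ.symm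
  rw [e]
  exact h

/-- The charts are irreducible opens, and any two of them meet because no coordinate vanishes
identically on a chart. -/
instance : IrreducibleSpace (quarticScheme K) where
  isPreirreducible_univ := by
    rintro u v hu hv ⟨x, -, hx⟩ ⟨y, -, hy⟩
    obtain ⟨i, x', rfl⟩ := exists_mem_range_chartι x
    obtain ⟨j, y', rfl⟩ := exists_mem_range_chartι y
    have hx' : chartι K i x' ∈ dPlus K (coord K i) := by
      rw [← opensRange_chartι]
      exact ⟨_, rfl⟩
    have hy' : chartι K j y' ∈ dPlus K (coord K j) := by
      rw [← opensRange_chartι]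
      exact ⟨_, rfl⟩
    obtain ⟨z, hz, hzu, hzj⟩ := isPreirreducible_dPlus K i u (dPlus K (coord K j)) hu
      (dPlus K (coord K j)).isOpen ⟨_, hx', hx⟩ (dPlus_inter_nonempty K i j)
    obtain ⟨w, -, hw⟩ := isPreirreducible_dPlus K j u v hu hv ⟨z, hzj, hzu⟩ ⟨_, hy', hy⟩
    exact ⟨w, trivial, hw⟩
  toNonempty := (dPlus_inter_nonempty K 0 0).to_type

instance : IsIntegral (quarticScheme K) := by
  have : IsReduced (quarticScheme K) := by
    have h (i : Fin 4) : IsReduced (Spec (.of (Chart K i))) := inferInstance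
    have (i : (chartCover K).openCover.I₀) : IsReduced ((chartCover K).openCover.X i) := h i
    exact IsReduced.of_openCover _ (chartCover K).openCover
  exact isIntegral_of_irreducibleSpace_of_isReduced _

theorem geometricallyIntegral_quarticStr : GeometricallyIntegral (quarticStr K) := by
  refine ⟨geometrically_iff_of_commRing.2 fun L _ _ Y fst snd h => ?_⟩
  have e := (quarticMap_isPullback (algebraMap K L)).isoIsPullback _ _ h
  have : Nonempty Y := ⟨e.hom (Nonempty.some inferInstance)⟩
  exact isIntegral_of_isOpenImmersion e.inv

end Integral

/-! ### Counting points over `𝔽₂` -/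

section Points

/-- The nonzero vectors over `𝔽₂` at which the quartic form vanishes. -/
abbrev QuarticZero : Type := { t : Fin 4 → ZMod 2 // t ≠ 0 ∧ quarticVal t = 0 }

instance : DecidablePred fun t : Fin 4 → ZMod 2 => t ≠ 0 ∧ quarticVal t = 0 := fun t => by
  unfold quarticVal
  infer_instance

lemma card_quarticZero : Nat.card QuarticZero = 10 := by
  rw [Nat.card_eq_fintype_card]
  decide

/-- The point of a chart over `𝔽₂` given by a ring homomorphism. -/
def chartPoint {i : Fin 4} (g : Chart (ZMod 2) i →+* ZMod 2) : Points (quarticStr (ZMod 2)) :=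
  ⟨Spec.map (CommRingCat.ofHom g) ≫ chartι _ i, by
    rw [Category.assoc, chartι_str, ← Spec.map_comp, ← CommRingCat.ofHom_comp,
      Subsingleton.elim (g.comp _) (RingHom.id _)]
    exact Spec.map_id _⟩

lemma exists_eq_chartPoint (s : Points (quarticStr (ZMod 2))) (i : Fin 4)
    (hi : s.1 (IsLocalRing.closedPoint (ZMod 2)) ∈ dPlus _ (coord (ZMod 2) i)) :
    ∃ g : Chart (ZMod 2) i →+* ZMod 2, s = chartPoint g := by
  have h : Set.range s.1 ⊆ Set.range (chartι (ZMod 2) i) := by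
    rintro _ ⟨x, rfl⟩
    rw [← opensRange_chartι] at hi
    rwa [Subsingleton.elim (α := PrimeSpectrum (ZMod 2)) x (IsLocalRing.closedPoint (ZMod 2))]
  refine ⟨(Spec.preimage (IsOpenImmersion.lift (chartι (ZMod 2) i) s.1 h)).hom, Subtype.ext ?_⟩
  simp [chartPoint]

lemma chartPoint_mem_dPlus_iff {i j : Fin 4} (g : Chart (ZMod 2) i →+* ZMod 2) :
    (chartPoint g).1 (IsLocalRing.closedPoint (ZMod 2)) ∈ dPlus _ (coord (ZMod 2) j) ↔
      g (chartCoord _ i j) ≠ 0 := by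
  change Spec.map (CommRingCat.ofHom g) (IsLocalRing.closedPoint (ZMod 2)) ∈
    chartι (ZMod 2) i ⁻¹ᵁ dPlus _ (coord (ZMod 2) j) ↔ _
  rw [chartι_preimage_dPlus]
  change ¬ (g (chartCoord _ i j) ∈ IsLocalRing.maximalIdeal (ZMod 2)) ↔ _
  rw [IsLocalRing.maximalIdeal_eq_bot, Ideal.mem_bot]

open Classical in
/-- The homogeneous coordinates of a point over `𝔽₂`. -/
def pointCoord (s : Points (quarticStr (ZMod 2))) (j : Fin 4) : ZMod 2 :=
  if s.1 (IsLocalRing.closedPoint (ZMod 2)) ∈ dPlus _ (coord (ZMod 2) j) then 1 else 0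

/-- The only nonzero element of `𝔽₂` is `1`, so a normalized coordinate is the indicator of its
non-vanishing, whichever chart is used. -/
lemma pointCoord_chartPoint {i : Fin 4} (g : Chart (ZMod 2) i →+* ZMod 2) (j : Fin 4) :
    pointCoord (chartPoint g) j = g (chartCoord _ i j) := by
  rw [pointCoord]
  split_ifs with h <;> rw [chartPoint_mem_dPlus_iff] at h
  · generalize g (chartCoord _ i j) = a at h
    revert a
    decide
  · exact (not_not.1 h).symm

lemma exists_mem_dPlus (s : Points (quarticStr (ZMod 2))) :
    ∃ i, s.1 (IsLocalRing.closedPoint (ZMod 2)) ∈ dPlus _ (coord (ZMod 2) i) := by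
  obtain ⟨i, y, hy⟩ := exists_mem_range_chartι (s.1 (IsLocalRing.closedPoint (ZMod 2)))
  exact ⟨i, hy ▸ (opensRange_chartι (ZMod 2) i) ▸ ⟨y, rfl⟩⟩

lemma pointCoord_mem (s : Points (quarticStr (ZMod 2))) :
    pointCoord s ≠ 0 ∧ quarticVal (pointCoord s) = 0 := by
  obtain ⟨i, hi⟩ := exists_mem_dPlus s
  obtain ⟨g, rfl⟩ := exists_eq_chartPoint s i hi
  have h : pointCoord (chartPoint g) = fun j => g (chartCoord _ i j) :=
    funext (pointCoord_chartPoint g)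
  rw [h]
  refine ⟨fun h0 => one_ne_zero (α := ZMod 2) ?_, ?_⟩
  · have := congrFun h0 i
    rwa [chartCoord_self, map_one] at this
  · rw [← map_quarticVal, quarticVal_chartCoord, map_zero]

lemma pointCoord_injective : Function.Injective pointCoord := by
  intro s s' h
  obtain ⟨i, hi⟩ := exists_mem_dPlus s
  have h1 : pointCoord s i = 1 := if_pos hi
  have hi' : s'.1 (IsLocalRing.closedPoint (ZMod 2)) ∈ dPlus _ (coord (ZMod 2) i) := by
    by_contra h'
    have h0 : pointCoord s' i = 0 := if_neg h'
    rw [← h, h1] at h0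
    exact one_ne_zero h0
  obtain ⟨g, rfl⟩ := exists_eq_chartPoint s i hi
  obtain ⟨g', rfl⟩ := exists_eq_chartPoint s' i hi'
  congr 1
  refine chart_hom_ext (fun r => ?_) fun j => ?_
  · exact RingHom.congr_fun (Subsingleton.elim (g.comp (chartC _ i)) (g'.comp (chartC _ i))) r
  · rw [← pointCoord_chartPoint, ← pointCoord_chartPoint, h]

lemma card_points_quarticStr : Nat.card (Points (quarticStr (ZMod 2))) = 10 := by
  rw [← card_quarticZero]
  refine Nat.card_eq_of_bijective (fun s => (⟨pointCoord s, pointCoord_mem s⟩ : QuarticZero))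
    ⟨fun s s' h => pointCoord_injective (congrArg Subtype.val h), ?_⟩
  rintro ⟨t, ht, h⟩
  obtain ⟨i, hi⟩ := Function.ne_iff.1 ht
  have hi' : t i = 1 := by
    rw [Pi.zero_apply] at hi
    generalize t i = a at hi
    revert a
    decide
  refine ⟨chartPoint (chartLift (RingHom.id _) t hi' h), Subtype.ext (funext fun j => ?_)⟩
  exact (pointCoord_chartPoint _ j).trans (chartLift_coord ..)

lemma card_points_congr {R : Type u} [CommRing R] {X Y : Scheme.{u}} {f : X ⟶ Spec (.of R)}
    {g : Y ⟶ Spec (.of R)} (e : X ≅ Y) (he : e.hom ≫ g = f) :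
    Nat.card (Points f) = Nat.card (Points g) := by
  refine Nat.card_congr ⟨fun s => ⟨s.1 ≫ e.hom, ?_⟩, fun s => ⟨s.1 ≫ e.inv, ?_⟩, fun s => ?_,
    fun s => ?_⟩
  · rw [Category.assoc, he, s.2]
  · rw [Category.assoc, (Iso.inv_comp_eq e).2 he.symm, s.2]
  · exact Subtype.ext (by simp)
  · exact Subtype.ext (by simp)

theorem card_points_reduction₂ : Nat.card (Points reduction₂) = 10 := by
  obtain ⟨e, he⟩ := exists_iso_reduction₂
  rw [← card_points_congr e he, card_points_quarticStr]

end Points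

/-! ### Exterior squares under base change -/

section ExteriorSquare

open TensorProduct

/-- The alternating map defined by an alternating bilinear map. -/
def alternatingOfBilin {A M P : Type*} [CommRing A] [AddCommGroup M] [Module A M] [AddCommGroup P]
    [Module A P] (b : M →ₗ[A] M →ₗ[A] P) (hb : ∀ m, b m m = 0) : M [⋀^Fin 2]→ₗ[A] P where
  toFun v := b (v 0) (v 1)
  map_update_add' v i x y := by
    fin_cases i <;> simp [Function.update]
  map_update_smul' v i c x := by
    fin_cases i <;> simp [Function.update]
  map_eq_zero_of_eq' v i j h hij := by
    obtain ⟨rfl, rfl⟩ | ⟨rfl, rfl⟩ : i = 0 ∧ j = 1 ∨ i = 1 ∧ j = 0 := by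
      clear h
      revert i j
      decide
    · rw [h, hb]
    · rw [h, hb]

section

variable (A : Type*) {M : Type*} [CommRing A] [AddCommGroup M] [Module A M]

/-- The bilinear map `(m, n) ↦ m ∧ n`. -/
def wedge : M →ₗ[A] M →ₗ[A] ⋀[A]^2 M :=
  LinearMap.mk₂ A (fun m n => exteriorPower.ιMulti A 2 ![m, n])
    (fun x y z => (exteriorPower.ιMulti A 2).map_vecCons_add _ x y)
    (fun c x z => (exteriorPower.ιMulti A 2).map_vecCons_smul _ c x)
    (fun x y z => by
      have h (w : M) : Function.update ![x, 0] 1 w = ![x, w] := by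
        ext i
        fin_cases i <;> rfl
      rw [← h, ← h y, ← h z]
      exact (exteriorPower.ιMulti A 2 (M := M)).map_update_add ![x, 0] 1 y z)
    (fun c x y => by
      have h (w : M) : Function.update ![x, 0] 1 w = ![x, w] := by
        ext i
        fin_cases i <;> rfl
      rw [← h, ← h y]
      exact (exteriorPower.ιMulti A 2 (M := M)).map_update_smul ![x, 0] 1 c y)

lemma ιMulti_eq_wedge (v : Fin 2 → M) : exteriorPower.ιMulti A 2 v = wedge A (v 0) (v 1) := by
  rw [wedge, LinearMap.mk₂_apply]
  congr 1
  ext i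
  fin_cases i <;> rfl

@[simp]
lemma wedge_self (m : M) : wedge A m m = 0 :=
  (exteriorPower.ιMulti A 2 (M := M)).map_eq_zero_of_eq ![m, m] (i := 0) (j := 1) rfl (by decide)

lemma wedge_swap (m n : M) : wedge A m n = - wedge A n m := by
  have := wedge_self A (m + n)
  rw [LinearMap.map_add₂, map_add, map_add, wedge_self, wedge_self, zero_add, add_zero]
    at this
  exact eq_neg_of_add_eq_zero_left this

variable {A} in
lemma exteriorSquare_hom_ext {P : Type*} [AddCommGroup P] [Module A P] {f g : ⋀[A]^2 M →ₗ[A] P}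
    (h : ∀ m n, f (wedge A m n) = g (wedge A m n)) : f = g := by
  refine exteriorPower.linearMap_ext (AlternatingMap.ext fun v => ?_)
  rw [LinearMap.compAlternatingMap_apply, LinearMap.compAlternatingMap_apply, ιMulti_eq_wedge, h]

lemma span_wedge : Submodule.span A {x | ∃ m n : M, wedge A m n = x} = ⊤ := by
  rw [← exteriorPower.ιMulti_span]
  congr 1
  ext x
  constructor
  · rintro ⟨m, n, rfl⟩
    exact ⟨![m, n], rfl⟩
  · rintro ⟨v, rfl⟩
    exact ⟨v 0, v 1, (ιMulti_eq_wedge A v).symm⟩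

end

variable {A B M N : Type*} [CommRing A] [CommRing B] [Algebra A B] [AddCommGroup M] [Module A M]
  [AddCommGroup N] [Module A N] [Module B N] [IsScalarTower A B N]

/-- On pure tensors this is the hypothesis; the cross terms of a sum cancel because the extended
pairing is skew-symmetric. -/
lemma bilin_baseChange_self {P : Type*} [AddCommGroup P] [Module A P] (b : M →ₗ[A] M →ₗ[A] P)
    (hb : ∀ m, b m m = 0) (x : B ⊗[A] M) : LinearMap.BilinMap.baseChange B b x x = 0 := by
  have hswap (m n : M) : b m n + b n m = 0 := by
    have := hb (m + n)
    rwa [LinearMap.map_add₂, map_add, map_add, hb, hb, zero_add, add_zero] at this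
  have h (x y : B ⊗[A] M) :
      LinearMap.BilinMap.baseChange B b x y + LinearMap.BilinMap.baseChange B b y x = 0 := by
    induction x with
    | zero => simp
    | add x x' hx hx' =>
      rw [map_add, map_add, LinearMap.add_apply, add_add_add_comm, hx, hx', add_zero]
    | tmul c m =>
      induction y with
      | zero => simp
      | add y y' hy hy' =>
        rw [map_add, map_add, LinearMap.add_apply, add_add_add_comm, hy, hy', add_zero]
      | tmul d n =>
        rw [LinearMap.BilinMap.baseChange_tmul, LinearMap.BilinMap.baseChange_tmul, mul_comm d c,
          ← TensorProduct.tmul_add, hswap, TensorProduct.tmul_zero]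
  induction x with
  | zero => simp
  | tmul c m => rw [LinearMap.BilinMap.baseChange_tmul, hb, TensorProduct.tmul_zero]
  | add x y hx hy =>
    rw [LinearMap.map_add₂, map_add, map_add, hx, hy, zero_add, add_zero, h]

/-- The inverse of `B ⊗ ⋀²M → ⋀²N` is induced by the base change of the wedge pairing, an
alternating pairing on `B ⊗ M ≅ N`. -/
theorem isBaseChange_exteriorSquare {f : M →ₗ[A] N} (hf : IsBaseChange B f)
    {Φ : ⋀[A]^2 M →ₗ[A] ⋀[B]^2 N} (hΦ : ∀ m n, Φ (wedge A m n) = wedge B (f m) (f n)) :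
    IsBaseChange B Φ := by
  let b : (B ⊗[A] M) →ₗ[B] (B ⊗[A] M) →ₗ[B] (B ⊗[A] ⋀[A]^2 M) :=
    LinearMap.BilinMap.baseChange B (wedge A)
  let b' : N →ₗ[B] N →ₗ[B] (B ⊗[A] ⋀[A]^2 M) :=
    b.compl₁₂ hf.equiv.symm.toLinearMap hf.equiv.symm.toLinearMap
  let Ψ : ⋀[B]^2 N →ₗ[B] B ⊗[A] ⋀[A]^2 M := exteriorPower.alternatingMapLinearEquiv
    (alternatingOfBilin b' fun n => bilin_baseChange_self _ (wedge_self A) _)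
  have hΨ (n n' : N) : Ψ (wedge B n n') = b (hf.equiv.symm n) (hf.equiv.symm n') :=
    exteriorPower.alternatingMapLinearEquiv_apply_ιMulti _ ![n, n']
  have hΨf (m m' : M) : Ψ (wedge B (f m) (f m')) = 1 ⊗ₜ wedge A m m' := by
    rw [hΨ, hf.equiv_symm_apply, hf.equiv_symm_apply]
    change LinearMap.BilinMap.baseChange B (wedge A) _ _ = _
    rw [LinearMap.BilinMap.baseChange_tmul, one_mul]
  let F : B ⊗[A] ⋀[A]^2 M →ₗ[B] ⋀[B]^2 N := LinearMap.liftBaseChange B Φ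
  have h₁ : Ψ ∘ₗ F = LinearMap.id := by
    refine TensorProduct.AlgebraTensorModule.curry_injective (LinearMap.ext_ring ?_)
    refine exteriorSquare_hom_ext fun m n => ?_
    change Ψ (F (1 ⊗ₜ wedge A m n)) = 1 ⊗ₜ wedge A m n
    rw [LinearMap.liftBaseChange_tmul, one_smul, hΦ, hΨf]
  have h₂ : F ∘ₗ Ψ = LinearMap.id := by
    refine exteriorSquare_hom_ext fun n n' => ?_
    suffices h : (wedge B).compr₂ (F ∘ₗ Ψ) = wedge B (M := N) from LinearMap.congr_fun₂ h n n'
    refine hf.algHom_ext _ _ fun m => hf.algHom_ext _ _ fun m' => ?_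
    change F (Ψ (wedge B (f m) (f m'))) = _
    rw [hΨf, LinearMap.liftBaseChange_tmul, one_smul, hΦ]
  refine .of_equiv (LinearEquiv.ofLinearMap F Ψ h₂ h₁) fun x => ?_
  change F (1 ⊗ₜ x) = _
  rw [LinearMap.liftBaseChange_tmul, one_smul]

end ExteriorSquare

/-! ### Kähler two-forms, localization and generators -/

section TwoForms

variable (k A B : Type u) [CommRing k] [CommRing A] [CommRing B] [Algebra k A] [Algebra k B]
  [Algebra A B] [IsScalarTower k A B]

lemma exteriorSquareMap_wedge (x y : Ω[A⁄k]) : exteriorSquareMap k A B (wedge A x y) =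
    wedge B (KaehlerDifferential.map k k A B x) (KaehlerDifferential.map k k A B y) := by
  refine (exteriorPower.alternatingMapLinearEquiv_apply_ιMulti _ _).trans ?_
  exact ιMulti_eq_wedge B _

instance isLocalizedModule_exteriorSquareMap (S : Submonoid A) [IsLocalization S B] :
    IsLocalizedModule S (exteriorSquareMap k A B) := by
  have := KaehlerDifferential.isLocalizedModule_map k A B S
  rw [isLocalizedModule_iff_isBaseChange S B] at this ⊢
  exact isBaseChange_exteriorSquare this (exteriorSquareMap_wedge k A B)

end TwoForms

namespace TwoForms

variable {k A B C : Type u} [CommRing k] [CommRing A] [CommRing B] [CommRing C]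
  {φ : k →+* A} {ψ : k →+* B} {χ : k →+* C}

lemma map_add (g : A →+* B) (hg : g.comp φ = ψ) (x y : TwoForms φ) :
    TwoForms.map g hg (x + y) = TwoForms.map g hg x + TwoForms.map g hg y :=
  letI := φ.toAlgebra
  letI := ψ.toAlgebra
  letI := g.toAlgebra
  haveI : IsScalarTower k A B := .of_algebraMap_eq' hg.symm
  (exteriorSquareMap k A B).map_add x y

lemma map_smul (g : A →+* B) (hg : g.comp φ = ψ) (a : A) (x : TwoForms φ) :
    TwoForms.map g hg (a • x) = g a • TwoForms.map g hg x :=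
  letI := φ.toAlgebra
  letI := ψ.toAlgebra
  letI := g.toAlgebra
  haveI : IsScalarTower k A B := .of_algebraMap_eq' hg.symm
  ((exteriorSquareMap k A B).map_smul a x).trans (algebraMap_smul B a _).symm

lemma map_zero (g : A →+* B) (hg : g.comp φ = ψ) : TwoForms.map g hg (0 : TwoForms φ) = 0 :=
  letI := φ.toAlgebra
  letI := ψ.toAlgebra
  letI := g.toAlgebra
  haveI : IsScalarTower k A B := .of_algebraMap_eq' hg.symm
  (exteriorSquareMap k A B).map_zero

lemma map_sub (g : A →+* B) (hg : g.comp φ = ψ) (x y : TwoForms φ) :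
    TwoForms.map g hg (x - y) = TwoForms.map g hg x - TwoForms.map g hg y :=
  letI := φ.toAlgebra
  letI := ψ.toAlgebra
  letI := g.toAlgebra
  haveI : IsScalarTower k A B := .of_algebraMap_eq' hg.symm
  (exteriorSquareMap k A B).map_sub x y

/-- The 2-form `da ∧ db`. -/
def dd (φ : k →+* A) (a b : A) : TwoForms φ :=
  letI := φ.toAlgebra
  wedge A (KaehlerDifferential.D k A a) (KaehlerDifferential.D k A b)

lemma map_dd (g : A →+* B) (hg : g.comp φ = ψ) (a b : A) :
    TwoForms.map g hg (dd φ a b) = dd ψ (g a) (g b) := by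
  let := φ.toAlgebra
  let := ψ.toAlgebra
  let := g.toAlgebra
  have : IsScalarTower k A B := .of_algebraMap_eq' hg.symm
  refine (exteriorSquareMap_wedge k A B _ _).trans ?_
  rw [KaehlerDifferential.map_D, KaehlerDifferential.map_D]
  rfl

lemma map_map (g : A →+* B) (hg : g.comp φ = ψ) (h : B →+* C) (hh : h.comp ψ = χ)
    (hgh : (h.comp g).comp φ = χ) (x : TwoForms φ) :
    TwoForms.map h hh (TwoForms.map g hg x) = TwoForms.map (h.comp g) hgh x := by
  let := φ.toAlgebra
  let := ψ.toAlgebra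
  let := χ.toAlgebra
  let := g.toAlgebra
  let := h.toAlgebra
  let := (h.comp g).toAlgebra
  have : IsScalarTower k A B := .of_algebraMap_eq' hg.symm
  have : IsScalarTower k B C := .of_algebraMap_eq' hh.symm
  have : IsScalarTower k A C := .of_algebraMap_eq' hgh.symm
  have : IsScalarTower A B C := .of_algebraMap_eq' rfl
  change ((exteriorSquareMap k B C).restrictScalars A ∘ₗ exteriorSquareMap k A B) x =
    exteriorSquareMap k A C x
  congr 1
  refine exteriorSquare_hom_ext fun m n => ?_
  rw [exteriorSquareMap_wedge, LinearMap.comp_apply, exteriorSquareMap_wedge,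
    LinearMap.restrictScalars_apply, exteriorSquareMap_wedge]
  have h : (KaehlerDifferential.map k k B C).restrictScalars A ∘ₗ KaehlerDifferential.map k k A B =
      KaehlerDifferential.map k k A C := by
    refine Derivation.liftKaehlerDifferential_unique _ _ (Derivation.ext fun a => ?_)
    change KaehlerDifferential.map k k B C (KaehlerDifferential.map k k A B
      (KaehlerDifferential.D k A a)) = KaehlerDifferential.map k k A C (KaehlerDifferential.D k A a)
    rw [KaehlerDifferential.map_D, KaehlerDifferential.map_D, KaehlerDifferential.map_D]
    rfl
  exact congrArg₂ (fun x y => wedge C x y) (LinearMap.congr_fun h m) (LinearMap.congr_fun h n)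

lemma exists_smul_eq_map (S : Submonoid A) (g : A →+* B) (hg : g.comp φ = ψ)
    (hS : letI := g.toAlgebra; IsLocalization S B) (x : TwoForms ψ) :
    ∃ s ∈ S, ∃ y, TwoForms.map g hg y = g s • x := by
  let := φ.toAlgebra
  let := ψ.toAlgebra
  let := g.toAlgebra
  have : IsScalarTower k A B := .of_algebraMap_eq' hg.symm
  obtain ⟨⟨y, s⟩, h⟩ := IsLocalizedModule.surj S (exteriorSquareMap k A B) x
  exact ⟨s, s.2, y, h.symm.trans (algebraMap_smul B (s : A) x).symm⟩

lemma exists_smul_eq_zero (S : Submonoid A) (g : A →+* B) (hg : g.comp φ = ψ)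
    (hS : letI := g.toAlgebra; IsLocalization S B) {x : TwoForms φ}
    (hx : TwoForms.map g hg x = 0) : ∃ s ∈ S, s • x = 0 := by
  let := φ.toAlgebra
  let := ψ.toAlgebra
  let := g.toAlgebra
  have : IsScalarTower k A B := .of_algebraMap_eq' hg.symm
  obtain ⟨s, h⟩ := (IsLocalizedModule.eq_zero_iff S (exteriorSquareMap k A B)).1 hx
  exact ⟨s, s.2, h⟩

/-- The 2-form `η` is the image of a form that generates the 2-forms of `A`. -/
def Generates (φ : k →+* A) (g : A →+* B) (hg : g.comp φ = ψ) (η : TwoForms ψ) : Prop :=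
  ∃ ω : TwoForms φ, TwoForms.map g hg ω = η ∧ ∀ x, ∃ a : A, a • ω = x

lemma eq_zero_of_generates {g : A →+* B} {hg : g.comp φ = ψ} {η : TwoForms ψ}
    (h : Generates φ g hg η) (hinj : Function.Injective g) (hη : ∀ b : B, b • η = 0 → b = 0)
    {x : TwoForms φ} (hx : TwoForms.map g hg x = 0) : x = 0 := by
  obtain ⟨ω, hω, hsurj⟩ := h
  obtain ⟨a, rfl⟩ := hsurj x
  rw [map_smul, hω] at hx
  rw [(injective_iff_map_eq_zero g).1 hinj a (hη _ hx), zero_smul]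

lemma Generates.localization {g : A →+* C} {hg : g.comp φ = χ} {η : TwoForms χ}
    (h : Generates φ g hg η) (S : Submonoid A) {p : A →+* B} (hp : p.comp φ = ψ)
    (hS : letI := p.toAlgebra; IsLocalization S B) {q : B →+* C} (hq : q.comp ψ = χ)
    (hqp : q.comp p = g) : Generates ψ q hq η := by
  obtain ⟨ω, hω, hsurj⟩ := h
  subst hqp
  refine ⟨TwoForms.map p hp ω, by rw [map_map _ _ _ _ hg, hω], fun x => ?_⟩
  obtain ⟨s, hs, y, hy⟩ := exists_smul_eq_map S p hp hS x
  obtain ⟨a, rfl⟩ := hsurj y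
  have hu : IsUnit (p s) := by
    let := p.toAlgebra
    exact IsLocalization.map_units B ⟨s, hs⟩
  obtain ⟨v, hv⟩ := hu.exists_left_inv
  refine ⟨v * p a, ?_⟩
  rw [mul_smul, ← map_smul, hy, smul_smul, hv, one_smul]

/-- The `a` for which `a η` comes from `A` form an ideal, and so do those for which `a x` is a
multiple of `ω`. Each ideal contains a power of every element of `s`, so it is the unit ideal. The
case `f = 0` is exempt: zero lies in every ideal, and its basic open misses the generic point. -/
lemma generates_of_span_eq_top {g : A →+* C} {hg : g.comp φ = χ} {η : TwoForms χ}
    (hη : ∀ c : C, c • η = 0 → c = 0) (s : Set A) (hs : Ideal.span s = ⊤)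
    (H : ∀ f ∈ s, f ≠ 0 → ∃ (B : Type u) (_ : CommRing B) (ψ : k →+* B) (p : A →+* B)
      (_ : p.comp φ = ψ) (_ : letI := p.toAlgebra; IsLocalization.Away f B) (q : B →+* C)
      (hq : q.comp ψ = χ), Function.Injective q ∧ q.comp p = g ∧ Generates ψ q hq η) :
    Generates φ g hg η := by
  have key (I : Ideal A) (hI : ∀ f ∈ s, f ≠ 0 → ∃ n : ℕ, f ^ n ∈ I) : (1 : A) ∈ I := by
    have : I.radical = ⊤ := by
      rw [← top_le_iff, ← hs, Ideal.span_le]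
      intro f hf
      by_cases h0 : f = 0
      · rw [h0]
        exact zero_mem _
      · obtain ⟨n, hn⟩ := hI f hf h0
        exact ⟨n, hn⟩
    rw [Ideal.radical_eq_top] at this
    rw [this]
    trivial
  let I : Ideal A :=
    { carrier := {a | ∃ y, TwoForms.map g hg y = g a • η}
      add_mem' := by
        rintro a b ⟨y, hy⟩ ⟨z, hz⟩
        exact ⟨y + z, by rw [map_add, hy, hz, _root_.map_add, add_smul]⟩
      zero_mem' := ⟨0, by rw [map_zero, _root_.map_zero, zero_smul]⟩
      smul_mem' := by
        rintro c a ⟨y, hy⟩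
        exact ⟨c • y, by rw [map_smul, hy, smul_eq_mul, map_mul, mul_smul]⟩ }
  obtain ⟨ω, hω⟩ : (1 : A) ∈ I := key I fun f hf hf0 => by
    obtain ⟨B, _, ψ, p, hp, hloc, q, hq, hqi, rfl, ω, hω, hsurj⟩ := H f hf hf0
    obtain ⟨_, ⟨n, rfl⟩, y, hy⟩ := exists_smul_eq_map _ p hp hloc ω
    refine ⟨n, y, ?_⟩
    rw [← map_map p hp q hq, hy, map_smul, hω]
    rfl
  rw [map_one, one_smul] at hω
  refine ⟨ω, hω, fun x => ?_⟩
  let J : Ideal A :=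
    { carrier := {a | ∃ b : A, b • ω = a • x}
      add_mem' := by
        rintro a b ⟨y, hy⟩ ⟨z, hz⟩
        exact ⟨y + z, by rw [add_smul, hy, hz, add_smul]⟩
      zero_mem' := ⟨0, by rw [zero_smul, zero_smul]⟩
      smul_mem' := by
        rintro c a ⟨y, hy⟩
        exact ⟨c * y, by rw [smul_eq_mul, mul_smul, hy, mul_smul]⟩ }
  obtain ⟨b, hb⟩ : (1 : A) ∈ J := key J fun f hf hf0 => by
    obtain ⟨B, _, ψ, p, hp, hloc, q, hq, hqi, rfl, hgen⟩ := H f hf hf0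
    have hω' : TwoForms.map q hq (TwoForms.map p hp ω) = η := by rw [map_map _ _ _ _ hg, hω]
    obtain ⟨ω₁, hω₁, hsurj⟩ := id hgen
    have h₁ : ω₁ = TwoForms.map p hp ω := by
      rw [← sub_eq_zero]
      refine eq_zero_of_generates hgen hqi hη ?_
      rw [map_sub, hω₁, hω', sub_self]
    obtain ⟨b, hb⟩ := hsurj (TwoForms.map p hp x)
    obtain ⟨a, n, hn⟩ : ∃ (a : A) (n : ℕ), p a = p (f ^ n) * b := by
      let := p.toAlgebra
      obtain ⟨⟨a, ⟨_, n, rfl⟩⟩, h⟩ := IsLocalization.surj (Submonoid.powers f) b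
      exact ⟨a, n, h.symm.trans (mul_comm _ _)⟩
    have h₂ : TwoForms.map p hp (a • ω - f ^ n • x) = 0 := by
      rw [map_sub, map_smul, map_smul, hn, mul_smul, ← h₁, hb, sub_self]
    obtain ⟨_, ⟨m, rfl⟩, h₃⟩ := exists_smul_eq_zero _ p hp hloc h₂
    refine ⟨m + n, f ^ m * a, ?_⟩
    rw [smul_sub, sub_eq_zero, smul_smul, smul_smul, ← pow_add] at h₃
    exact h₃
  exact ⟨b, by rw [hb, one_smul]⟩

end TwoForms

open TopologicalSpace

/-! ### Global two-forms from forms at the generic point -/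

section GlobalTwoForm

variable {k : Type u} [CommRing k] {Y : Scheme.{u}} [IsIntegral Y] (f : Y ⟶ Spec (.of k))

/-- The structure homomorphism of the function field of a `k`-scheme. -/
def genericScalars : k →+* Y.functionField :=
  (Y.presheaf.germ ⊤ (genericPoint Y) trivial).hom.comp (scalars f ⊤)

/-- The homomorphism from sections to rational functions. -/
def genericGerm (U : Y.Opens) (h : genericPoint Y ∈ U) : Γ(Y, U) →+* Y.functionField :=
  (Y.presheaf.germ U (genericPoint Y) h).hom

variable {f}

lemma genericGerm_comp_restrict {U V : Y.Opens} (hV : V ≤ U) (h : genericPoint Y ∈ V) :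
    (genericGerm V h).comp (restrict hV) = genericGerm U (hV h) := by
  rw [genericGerm, restrict, ← CommRingCat.hom_comp, Y.presheaf.germ_res]
  rfl

lemma genericGerm_comp_scalars (U : Y.Opens) (h : genericPoint Y ∈ U) :
    (genericGerm U h).comp (scalars f U) = genericScalars f := by
  rw [genericScalars, ← restrict_comp_scalars f (le_top : U ≤ ⊤), ← RingHom.comp_assoc,
    genericGerm_comp_restrict]
  rfl

lemma genericGerm_injective (U : Y.Opens) (h : genericPoint Y ∈ U) :
    Function.Injective (genericGerm U h) :=
  germ_injective_of_isIntegral Y _ h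

lemma genericPoint_mem {U : Y.Opens} (h : (U : Set Y).Nonempty) : genericPoint Y ∈ U :=
  ((genericPoint_spec Y).mem_open_set_iff U.isOpen).2 (by simpa using h)

lemma subsingleton_of_genericPoint_notMem {U : Y.Opens} (h : genericPoint Y ∉ U) :
    Subsingleton Γ(Y, U) := by
  have : U = ⊥ := by
    by_contra hU
    exact h (genericPoint_mem (Set.nonempty_iff_ne_empty.2 fun h' => hU (Opens.ext h')))
  subst this
  infer_instance

lemma TwoForms.subsingleton {k A : Type u} [CommRing k] [CommRing A] [Subsingleton A]
    (φ : k →+* A) : Subsingleton (TwoForms φ) := by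
  let := φ.toAlgebra
  exact Module.subsingleton A _

/-- Generation is a local property of affine opens: it passes to basic opens by localization, and
back from basic opens whose functions span the unit ideal. -/
theorem generates_of_iSup_eq_top {η : TwoForms (genericScalars f)}
    (hη : ∀ c : Y.functionField, c • η = 0 → c = 0) {ι : Type*} (V : ι → Y.affineOpens)
    (hV : ⨆ i, (V i : Y.Opens) = ⊤)
    (H : ∀ i, ∃ h, TwoForms.Generates (scalars f (V i)) (genericGerm (V i).1 h)
      (genericGerm_comp_scalars _ h) η) (U : Y.affineOpens) (h : genericPoint Y ∈ U.1) :
    TwoForms.Generates (scalars f U) (genericGerm U.1 h) (genericGerm_comp_scalars _ h) η := by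
  induction U using of_affine_open_cover V hV with
  | basicOpen U a ih =>
    exact (ih (Y.basicOpen_le a h)).localization (Submonoid.powers a)
      (p := restrict (Y.basicOpen_le a))
      (restrict_comp_scalars f _) (U.2.isLocalization_of_eq_basicOpen a (homOfLE _) rfl) _
      (genericGerm_comp_restrict _ _)
  | openCover U s hs ih =>
    refine TwoForms.generates_of_span_eq_top hη _ hs fun a ha ha0 => ?_
    have h' : genericPoint Y ∈ Y.basicOpen a := by
      rw [Y.mem_basicOpen a _ h]
      refine IsUnit.mk0 (genericGerm U.1 h a) fun h0 => ha0 ?_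
      exact genericGerm_injective _ h (h0.trans (map_zero _).symm)
    exact ⟨_, inferInstance, _, restrict (Y.basicOpen_le a), restrict_comp_scalars f _,
      U.2.isLocalization_of_eq_basicOpen a (homOfLE _) rfl, genericGerm (Y.basicOpen a) h',
      genericGerm_comp_scalars _ _, genericGerm_injective _ _, genericGerm_comp_restrict _ _,
      ih ⟨a, ha⟩ h'⟩
  | hU i => exact (H i).2

-- A form at the generic point extends in at most one way to an affine open on which it generates,
-- so the local extensions agree without a cocycle computation.
open Classical in
theorem exists_trivializes {η : TwoForms (genericScalars f)}
    (hη : ∀ c : Y.functionField, c • η = 0 → c = 0) {ι : Type*} (V : ι → Y.affineOpens)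
    (hV : ⨆ i, (V i : Y.Opens) = ⊤)
    (H : ∀ i, ∃ h, TwoForms.Generates (scalars f (V i)) (genericGerm (V i).1 h)
      (genericGerm_comp_scalars _ h) η) :
    ∃ ω : GlobalTwoForm f, ω.Trivializes := by
  have hgen := generates_of_iSup_eq_top hη V hV H
  choose form hform hsurj using hgen
  let ω : GlobalTwoForm f :=
    -- An open missing the generic point is empty and has only the zero form.
    { form := fun U => if h : genericPoint Y ∈ U.1 then form U h else 0
      map_form := fun U V' hVU => by
        by_cases h : genericPoint Y ∈ V'.1
        · rw [dif_pos h, dif_pos (hVU h), ← sub_eq_zero]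
          refine TwoForms.eq_zero_of_generates (generates_of_iSup_eq_top hη V hV H V' h)
            (genericGerm_injective _ h) hη ?_
          rw [TwoForms.map_sub, hform, TwoForms.map_map _ _ _ _
            (by rw [genericGerm_comp_restrict, genericGerm_comp_scalars])]
          simp only [genericGerm_comp_restrict]
          rw [hform, sub_self]
        · have := subsingleton_of_genericPoint_notMem h
          have := TwoForms.subsingleton (scalars f V'.1)
          exact Subsingleton.elim _ _ }
  refine ⟨ω, fun U => ?_⟩
  by_cases h : genericPoint Y ∈ U.1
  · have hω : ω.form U = form U h := dif_pos h
    refine ⟨fun a b hab => ?_, fun x => ?_⟩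
    · rw [← sub_eq_zero]
      refine genericGerm_injective _ h (((hη _ ?_)).trans (map_zero _).symm)
      have h0 : (a - b) • form U h = 0 := by
        refine (sub_smul a b (form U h)).trans (sub_eq_zero.2 ?_)
        rw [← hω]
        exact hab
      rw [← hform U h, ← TwoForms.map_smul, h0, TwoForms.map_zero]
    · obtain ⟨a, ha⟩ := hsurj U h x
      exact ⟨a, by rw [← ha, ← hω]⟩
  · have := subsingleton_of_genericPoint_notMem h
    have := TwoForms.subsingleton (scalars f U.1)
    exact ⟨fun _ _ _ => Subsingleton.elim _ _, fun x => ⟨0, Subsingleton.elim _ _⟩⟩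

end GlobalTwoForm

/-! ### The residue form in characteristic two -/

section MinorForm

lemma derivation_quarticVal {k A M : Type*} [CommRing k] [CommRing A] [Algebra k A]
    [AddCommGroup M] [Module A M] [Module k M] (d : Derivation k A M) (t : Fin 4 → A) (j : Fin 4) :
    d (quarticVal t) = quarticPDeriv t j • d (t j) + quarticPDeriv t (j + 1) • d (t (j + 1)) +
      quarticPDeriv t (j + 2) • d (t (j + 2)) + quarticPDeriv t (j + 3) • d (t (j + 3)) := by
  fin_cases j <;> simp [quarticVal, quarticPDeriv, Derivation.leibniz, Derivation.leibniz_pow] <;>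
    module

/-- Euler's relation in degree four, with the indices taken cyclically from `j`. -/
lemma sum_mul_quarticPDeriv {A : Type*} [CommRing A] (t : Fin 4 → A) (j : Fin 4) :
    t j * quarticPDeriv t j + t (j + 1) * quarticPDeriv t (j + 1) +
      t (j + 2) * quarticPDeriv t (j + 2) + t (j + 3) * quarticPDeriv t (j + 3) =
      4 * quarticVal t := by
  fin_cases j <;> simp [quarticVal, quarticPDeriv] <;> ring

lemma quarticPDeriv_mul {A : Type*} [CommRing A] (c : A) (t : Fin 4 → A) (j : Fin 4) :
    quarticPDeriv (fun i => c * t i) j = c ^ 3 * quarticPDeriv t j := by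
  simp only [quarticPDeriv]
  ring

section Relations

variable {A M : Type*} [CommRing A] [AddCommGroup M] [Module A M] {p q r s x y z w : A}
  {ab ac ad bc bd cd : M}

/-- Here `p, q, r, s` stand for the partial derivatives, `x, y, z, w` for the coordinates and `ab,
ac, …` for the wedges of their differentials. `hE` is Euler's relation, `hc` and `hd` are `dF = 0`
wedged with a differential. This compares the minors at adjacent indices; the primed version treats
opposite indices. -/
lemma smul_minor_eq_of_relations (h2 : (2 : A) = 0) (hE : x * p + y * q + z * r + w * s = 0)
    (hc : p • ac + q • bc + s • cd = 0) (hd : p • ad + q • bd + r • cd = 0) :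
    p • (z • ad + w • ac + x • cd) = q • (y • cd + z • bd + w • bc) := by
  linear_combination (norm := module) hE • cd + z • hd + w • hc -
    h2 • ((y * q + z * r + w * s) • cd + (z * q) • bd + (w * q) • bc)

lemma smul_minor_eq_of_relations' (h2 : (2 : A) = 0) (hE : x * p + y * q + z * r + w * s = 0)
    (hb : p • ab + r • bc + s • bd = 0) (hd : p • ad + q • bd + r • cd = 0) :
    p • (w • ab + x • bd + y • ad) = r • (y • cd + z • bd + w • bc) := by
  linear_combination (norm := module) hE • bd + w • hb + y • hd -
    h2 • ((y * q + z * r + w * s) • bd + (w * r) • bc + (y * r) • cd)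

lemma wedge_swap_of_two (h2 : (2 : A) = 0) (m n : M) :
    wedge A m n = wedge A n m := by
  rw [wedge_swap]
  linear_combination (norm := module) -h2 • wedge A n m

/-- With `u = dc`, the terms containing `u` cancel in pairs modulo two. -/
lemma minor_mul_of_two (h2 : (2 : A) = 0) (c y z w : A) (u d₁ d₂ d₃ : M) :
    (c * y) • wedge A (c • d₂ + z • u) (c • d₃ + w • u) +
      (c * z) • wedge A (c • d₁ + y • u) (c • d₃ + w • u) +
      (c * w) • wedge A (c • d₁ + y • u) (c • d₂ + z • u) =
      c ^ 3 • (y • wedge A d₂ d₃ + z • wedge A d₁ d₃ + w • wedge A d₁ d₂) := by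
  simp only [map_add, LinearMap.add_apply, map_smul, LinearMap.smul_apply, wedge_self]
  rw [wedge_swap_of_two h2 d₂ u, wedge_swap_of_two h2 d₁ u]
  linear_combination (norm := module) h2 • ((c ^ 2 * y * z) • wedge A u d₃ +
    (c ^ 2 * y * w) • wedge A u d₂ + (c ^ 2 * z * w) • wedge A u d₁)

end Relations

/-- A form which is a multiple of the residue on the quartic, in characteristic two. -/
def minorForm (k : Type*) {A : Type*} [CommRing k] [CommRing A] [Algebra k A] (t : Fin 4 → A)
    (j : Fin 4) : ⋀[A]^2 (Ω[A⁄k]) :=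
  let d := KaehlerDifferential.D k A
  t (j + 1) • wedge A (d (t (j + 2))) (d (t (j + 3))) +
    t (j + 2) • wedge A (d (t (j + 1))) (d (t (j + 3))) +
    t (j + 3) • wedge A (d (t (j + 1))) (d (t (j + 2)))

variable {k A : Type*} [CommRing k] [CommRing A] [Algebra k A]

lemma minorForm_mul (h2 : (2 : A) = 0) (c : A) (t : Fin 4 → A) (j : Fin 4) :
    minorForm k (fun i => c * t i) j = c ^ 3 • minorForm k t j := by
  simp only [minorForm, Derivation.leibniz]
  exact minor_mul_of_two h2 c _ _ _ _ _ _ _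

lemma quarticPDeriv_smul_minorForm (h2 : (2 : A) = 0) {t : Fin 4 → A} (ht : quarticVal t = 0)
    (j m : Fin 4) :
    quarticPDeriv t j • minorForm k t m = quarticPDeriv t m • minorForm k t j := by
  have key (j : Fin 4) (n : Ω[A⁄k]) : _ := congrArg (fun x => wedge A x n)
    (derivation_quarticVal (KaehlerDifferential.D k A) t j)
  simp only [ht, map_zero, LinearMap.zero_apply, map_add, LinearMap.add_apply, map_smul,
    LinearMap.smul_apply] at key
  have hE (j : Fin 4) := sum_mul_quarticPDeriv t j
  simp only [ht, mul_zero] at hE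
  have hswap (a b : A) := wedge_swap_of_two h2 (KaehlerDifferential.D k A a)
    (KaehlerDifferential.D k A b)
  have h₁ (j : Fin 4) : quarticPDeriv t j • minorForm k t (j + 1) =
      quarticPDeriv t (j + 1) • minorForm k t j := by
    have e : j + 1 + 1 = j + 2 ∧ j + 1 + 2 = j + 3 ∧ j + 1 + 3 = j := by
      revert j
      decide
    have hc := key j (KaehlerDifferential.D k A (t (j + 2)))
    have hd := key j (KaehlerDifferential.D k A (t (j + 3)))
    rw [minorForm, e.1, e.2.1, e.2.2, hswap (t (j + 3)) (t j), hswap (t (j + 2)) (t j)]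
    refine smul_minor_eq_of_relations h2 (hE j) ?_ ?_
    · rw [wedge_self, smul_zero, add_zero, hswap (t (j + 3))] at hc
      exact hc.symm
    · rw [wedge_self, smul_zero, add_zero] at hd
      exact hd.symm
  have h₂ (j : Fin 4) : quarticPDeriv t j • minorForm k t (j + 2) =
      quarticPDeriv t (j + 2) • minorForm k t j := by
    have e : j + 2 + 1 = j + 3 ∧ j + 2 + 2 = j ∧ j + 2 + 3 = j + 1 := by
      revert j
      decide
    have hb := key j (KaehlerDifferential.D k A (t (j + 1)))
    have hd := key j (KaehlerDifferential.D k A (t (j + 3)))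
    rw [minorForm, e.1, e.2.1, e.2.2, hswap (t (j + 3)) (t (j + 1)), hswap (t (j + 3)) (t j)]
    refine smul_minor_eq_of_relations' h2 (hE j) ?_ ?_
    · rw [wedge_self, smul_zero, add_zero, hswap (t (j + 3)), hswap (t (j + 2))] at hb
      exact hb.symm
    · rw [wedge_self, smul_zero, add_zero] at hd
      exact hd.symm
  obtain rfl | rfl | rfl | rfl : m = j ∨ m = j + 1 ∨ m = j + 2 ∨ j = m + 1 := by
    revert j m
    decide
  · rfl
  · exact h₁ j
  · exact h₂ j
  · exact (h₁ m).symm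

lemma exists_smul_wedge_eq {M : Type*} [AddCommGroup M] [Module A M] {x y : M}
    (h : ∀ m, ∃ a b : A, m = a • x + b • y) (ω : ⋀[A]^2 M) : ∃ c : A, c • wedge A x y = ω := by
  have : ω ∈ Submodule.span A {wedge A x y} := by
    have hω : ω ∈ Submodule.span A {x | ∃ m n : M, wedge A m n = x} := by
      rw [span_wedge]
      trivial
    refine Submodule.span_le.2 ?_ hω
    rintro _ ⟨m, n, rfl⟩
    obtain ⟨a, b, rfl⟩ := h m
    obtain ⟨c, d, rfl⟩ := h n
    refine Submodule.mem_span_singleton.2 ⟨a * d - b * c, ?_⟩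
    simp only [map_add, LinearMap.add_apply, map_smul, LinearMap.smul_apply, wedge_self]
    rw [wedge_swap A y x]
    module
  exact Submodule.mem_span_singleton.1 this

/-- Since `dt_i = 0`, the minor reduces to `dt_a ∧ dt_b` for the two indices other than `i` and `j`,
and `dt_a`, `dt_b` span the differentials. -/
lemma minorForm_generates {t : Fin 4 → A} {i j : Fin 4} (hij : j ≠ i) (hi : t i = 1)
    (h : ∀ m : Ω[A⁄k], m ∈ Submodule.span A {x | ∃ l, l ≠ j ∧ KaehlerDifferential.D k A (t l) = x})
    (ω : ⋀[A]^2 (Ω[A⁄k])) : ∃ c : A, c • minorForm k t j = ω := by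
  have hd : KaehlerDifferential.D k A (t i) = 0 := by rw [hi, Derivation.map_one_eq_zero]
  have key {a b : Fin 4} (hab : ∀ l, l ≠ j → l = i ∨ l = a ∨ l = b) (m : Ω[A⁄k]) :
      ∃ c d : A, m = c • KaehlerDifferential.D k A (t a) + d • KaehlerDifferential.D k A (t b) := by
    have : m ∈ Submodule.span A
        {KaehlerDifferential.D k A (t a), KaehlerDifferential.D k A (t b)} := by
      refine Submodule.span_le.2 ?_ (h m)
      rintro _ ⟨l, hl, rfl⟩
      obtain rfl | rfl | rfl := hab l hl
      · rw [hd]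
        exact zero_mem _
      · exact Submodule.subset_span (by simp)
      · exact Submodule.subset_span (by simp)
    obtain ⟨c, d, h⟩ := Submodule.mem_span_pair.1 this
    exact ⟨c, d, h.symm⟩
  obtain rfl | rfl | rfl : i = j + 1 ∨ i = j + 2 ∨ i = j + 3 := by
    clear * - hij
    revert i j
    decide
  · obtain ⟨c, hc⟩ := exists_smul_wedge_eq (key (a := j + 2) (b := j + 3) (by
      clear * -
      revert j
      decide)) ω
    exact ⟨c, by simpa [minorForm, hi, hd] using hc⟩
  · obtain ⟨c, hc⟩ := exists_smul_wedge_eq (key (a := j + 1) (b := j + 3) (by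
      clear * -
      revert j
      decide)) ω
    exact ⟨c, by simpa [minorForm, hi, hd] using hc⟩
  · obtain ⟨c, hc⟩ := exists_smul_wedge_eq (key (a := j + 1) (b := j + 2) (by
      clear * -
      revert j
      decide)) ω
    exact ⟨c, by simpa [minorForm, hi, hd] using hc⟩

end MinorForm

/-! ### Affine open immersions and the function field -/

section OpenImmersion

variable {Y : Scheme.{u}} {A : Type u} [CommRing A] (g : Spec (.of A) ⟶ Y)

/-- The sections on the image of an affine open immersion. -/
def sectionsEquiv [IsOpenImmersion g] : Γ(Y, g ''ᵁ ⊤) ≃+* A :=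
  (g.appIso ⊤ ≪≫ Scheme.ΓSpecIso (.of A)).commRingCatIsoToRingEquiv

lemma sectionsEquiv_comp_scalars [IsOpenImmersion g] {k : Type u} [CommRing k]
    {f : Y ⟶ Spec (.of k)} {φ : k →+* A} (h : g ≫ f = Spec.map (CommRingCat.ofHom φ)) :
    (sectionsEquiv g : Γ(Y, g ''ᵁ ⊤) →+* A).comp (scalars f _) = φ := by
  have : (Scheme.ΓSpecIso (.of k)).inv ≫ f.appTop ≫ Y.presheaf.map (homOfLE le_top).op ≫
      (g.appIso ⊤).hom ≫ (Scheme.ΓSpecIso (.of A)).hom = CommRingCat.ofHom φ := by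
    rw [Scheme.Hom.appIso_hom']
    have h₁ : f.appTop ≫ Y.presheaf.map (homOfLE le_top).op ≫ g.appLE (g ''ᵁ ⊤) ⊤
        (g.preimage_image_eq ⊤).ge = (g ≫ f).appTop := by
      rw [Scheme.Hom.map_appLE, Scheme.Hom.comp_appTop]
      exact congrArg (f.appTop ≫ ·) g.appLE_eq_app
    rw [reassoc_of% h₁, h, Iso.inv_comp_eq, Scheme.ΓSpecIso_naturality]
  exact congrArg CommRingCat.Hom.hom this

lemma fromSpecStalk_appLE {x : Y} {U : Y.Opens} (hU : x ∈ U) (h : ⊤ ≤ Y.fromSpecStalk x ⁻¹ᵁ U) :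
    (Y.fromSpecStalk x).appLE U ⊤ h =
      Y.presheaf.germ U x hU ≫ (Scheme.ΓSpecIso (Y.presheaf.stalk x)).inv := by
  rw [Scheme.Hom.appLE, Y.fromSpecStalk_app hU, Category.assoc, Category.assoc, ← Functor.map_comp,
    Subsingleton.elim (_ ≫ _) (𝟙 _), CategoryTheory.Functor.map_id, Category.comp_id]

variable [IsIntegral Y]

lemma comp_sectionsEquiv [IsOpenImmersion g] {ρ : A →+* Y.functionField}
    (h : Spec.map (CommRingCat.ofHom ρ) ≫ g = Y.fromSpecStalk (genericPoint Y))
    (hU : genericPoint Y ∈ g ''ᵁ ⊤) :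
    ρ.comp (sectionsEquiv g : Γ(Y, g ''ᵁ ⊤) →+* A) = genericGerm _ hU := by
  have : (g.appIso ⊤).hom ≫ (Scheme.ΓSpecIso (.of A)).hom ≫ CommRingCat.ofHom ρ =
      Y.presheaf.germ _ _ hU := by
    rw [← Scheme.ΓSpecIso_naturality, Scheme.Hom.appIso_hom']
    have h₀ : (⊤ : (Spec (.of Y.functionField)).Opens) ≤
        (Spec.map (CommRingCat.ofHom ρ) ≫ g) ⁻¹ᵁ (g ''ᵁ ⊤) := by
      rw [Scheme.Hom.comp_preimage, g.preimage_image_eq]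
      exact le_rfl
    have h₁ : g.appLE (g ''ᵁ ⊤) ⊤ (g.preimage_image_eq ⊤).ge ≫
        (Spec.map (CommRingCat.ofHom ρ)).appTop =
        (Spec.map (CommRingCat.ofHom ρ) ≫ g).appLE (g ''ᵁ ⊤) ⊤ h₀ :=
      (congrArg (g.appLE _ _ _ ≫ ·) (Scheme.Hom.appLE_eq_app _).symm).trans
        (Scheme.Hom.appLE_comp_appLE ..)
    rw [reassoc_of% h₁]
    simp_rw [h]
    rw [fromSpecStalk_appLE hU, Category.assoc]
    exact (congrArg (Y.presheaf.germ _ _ hU ≫ ·) (Iso.inv_hom_id _)).trans (Category.comp_id _)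
  exact congrArg CommRingCat.Hom.hom this

lemma genericPoint_mem_of_comp_eq [IsOpenImmersion g] {ρ : A →+* Y.functionField}
    (h : Spec.map (CommRingCat.ofHom ρ) ≫ g = Y.fromSpecStalk (genericPoint Y)) :
    genericPoint Y ∈ g ''ᵁ ⊤ := by
  have : genericPoint Y ∈ Set.range (Y.fromSpecStalk (genericPoint Y)) := by
    rw [Scheme.range_fromSpecStalk]
    exact specializes_rfl
  rw [← h] at this
  obtain ⟨x, hx⟩ := this
  rw [Scheme.Hom.image_top_eq_opensRange]
  exact ⟨_, hx⟩

lemma exists_comp_eq_fromSpecStalk [IsOpenImmersion g] (y : Y) (hy : y ∈ Set.range g) :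
    ∃ ρ : A →+* Y.functionField,
      Spec.map (CommRingCat.ofHom ρ) ≫ g = Y.fromSpecStalk (genericPoint Y) := by
  have h : Set.range (Y.fromSpecStalk (genericPoint Y)) ⊆ Set.range g := by
    rw [Scheme.range_fromSpecStalk]
    intro z hz
    exact Specializes.mem_open hz g.opensRange.isOpen (genericPoint_mem (U := g.opensRange) ⟨y, hy⟩)
  refine ⟨(Spec.preimage (IsOpenImmersion.lift g _ h)).hom, ?_⟩
  rw [CommRingCat.ofHom_hom, Spec.map_preimage, IsOpenImmersion.lift_fac]

variable {g} {k : Type u} [CommRing k] {f : Y ⟶ Spec (.of k)} {φ : k →+* A}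
  {ρ : A →+* Y.functionField}

lemma comp_eq_genericScalars [IsOpenImmersion g] (hg : g ≫ f = Spec.map (CommRingCat.ofHom φ))
    (h : Spec.map (CommRingCat.ofHom ρ) ≫ g = Y.fromSpecStalk (genericPoint Y)) :
    ρ.comp φ = genericScalars f := by
  rw [← sectionsEquiv_comp_scalars g hg, ← RingHom.comp_assoc,
    comp_sectionsEquiv g h (genericPoint_mem_of_comp_eq g h), genericGerm_comp_scalars]

lemma generates_image [IsOpenImmersion g] (hg : g ≫ f = Spec.map (CommRingCat.ofHom φ))
    (h : Spec.map (CommRingCat.ofHom ρ) ≫ g = Y.fromSpecStalk (genericPoint Y))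
    {η : TwoForms (genericScalars f)}
    (H : TwoForms.Generates φ ρ (comp_eq_genericScalars hg h) η) :
    TwoForms.Generates (scalars f (g ''ᵁ ⊤))
      (genericGerm _ (genericPoint_mem_of_comp_eq g h)) (genericGerm_comp_scalars _ _) η := by
  -- An isomorphism is a localization at `1`.
  refine H.localization (Submonoid.powers 1) (p := ((sectionsEquiv g).symm : A →+* _)) ?_ ?_ _ ?_
  · rw [← sectionsEquiv_comp_scalars g hg, ← RingHom.comp_assoc, RingEquiv.symm_comp,
      RingHom.id_comp]
  · let := ((sectionsEquiv g).symm : A →+* Γ(Y, g ''ᵁ ⊤)).toAlgebra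
    exact IsLocalization.away_of_isUnit_of_bijective _ isUnit_one (sectionsEquiv g).symm.bijective
  · rw [← comp_sectionsEquiv g h, RingHom.comp_assoc, RingEquiv.comp_symm, RingHom.comp_id]

/-- The function field is a fraction field of `A`, so a form that dies there is torsion. -/
lemma exists_smul_eq_zero_of_map_eq_zero [IsOpenImmersion g]
    (hg : g ≫ f = Spec.map (CommRingCat.ofHom φ))
    (h : Spec.map (CommRingCat.ofHom ρ) ≫ g = Y.fromSpecStalk (genericPoint Y))
    {x : TwoForms φ} (hx : TwoForms.map ρ (comp_eq_genericScalars hg h) x = 0) :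
    ∃ s : A, s ≠ 0 ∧ s • x = 0 := by
  have hU := genericPoint_mem_of_comp_eq g h
  have : Nonempty (g ''ᵁ ⊤ : Y.Opens) := ⟨_, hU⟩
  have hloc := functionField_isFractionRing_of_isAffineOpen Y (g ''ᵁ ⊤)
    ((isAffineOpen_top _).image_of_isOpenImmersion g)
  have h₁ := IsLocalization.isLocalization_of_base_ringEquiv (nonZeroDivisors Γ(Y, g ''ᵁ ⊤))
    Y.functionField (sectionsEquiv g)
  have h₂ : (algebraMap Γ(Y, g ''ᵁ ⊤) Y.functionField).comp (sectionsEquiv g).symm = ρ := by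
    change (genericGerm _ hU).comp _ = _
    rw [← comp_sectionsEquiv g h, RingHom.comp_assoc, RingEquiv.comp_symm, RingHom.comp_id]
  obtain rfl := h₂
  obtain ⟨_, ⟨s, hs, rfl⟩, hsx⟩ := TwoForms.exists_smul_eq_zero _ _ _ h₁ hx
  refine ⟨_, fun h0 => ?_, hsx⟩
  have : s = 0 := (sectionsEquiv g).injective (h0.trans (map_zero _).symm)
  exact nonZeroDivisors.ne_zero hs this

end OpenImmersion

/-! ### Generation of the two-forms by a minor -/

section MinorForm

namespace TwoForms

variable {k A B : Type u} [CommRing k] [CommRing A] [CommRing B] {φ : k →+* A} {ψ : k →+* B}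

/-- `minorForm` for the algebra structure given by a ring homomorphism. -/
def minor (φ : k →+* A) (t : Fin 4 → A) (j : Fin 4) : TwoForms φ :=
  letI := φ.toAlgebra
  minorForm k t j

lemma minor_mul (h2 : (2 : A) = 0) (c : A) (t : Fin 4 → A) (j : Fin 4) :
    minor φ (fun i => c * t i) j = c ^ 3 • minor φ t j :=
  letI := φ.toAlgebra
  minorForm_mul h2 c t j

lemma quarticPDeriv_smul_minor (h2 : (2 : A) = 0) {t : Fin 4 → A} (ht : quarticVal t = 0)
    (j m : Fin 4) : quarticPDeriv t j • minor φ t m = quarticPDeriv t m • minor φ t j :=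
  letI := φ.toAlgebra
  quarticPDeriv_smul_minorForm h2 ht j m

lemma minor_eq (t : Fin 4 → A) (j : Fin 4) :
    minor φ t j = t (j + 1) • dd φ (t (j + 2)) (t (j + 3)) +
      t (j + 2) • dd φ (t (j + 1)) (t (j + 3)) + t (j + 3) • dd φ (t (j + 1)) (t (j + 2)) := rfl

lemma map_minor (g : A →+* B) (hg : g.comp φ = ψ) (t : Fin 4 → A) (j : Fin 4) :
    TwoForms.map g hg (minor φ t j) = minor ψ (fun i => g (t i)) j := by
  rw [minor_eq, minor_eq, map_add, map_add, map_smul, map_smul, map_smul, map_dd, map_dd, map_dd]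

/-- The elements whose differential lies in the span of the `dt_l`, `l ≠ j`, form a subring. It
contains `t_j` because `dF = 0` and the `j`-th derivative is a unit, and then `v` by differentiating
`hv`; so it is everything by `hgen`. -/
lemma minor_generates {t : Fin 4 → A} {v : A} {i j : Fin 4} (hij : j ≠ i) (hi : t i = 1)
    (ht : quarticVal t = 0) (hv : v * quarticPDeriv t j = 1)
    (hgen : ∀ S : Subring A, (∀ r, φ r ∈ S) → (∀ l, t l ∈ S) → v ∈ S → S = ⊤)
    (x : TwoForms φ) : ∃ c : A, c • minor φ t j = x := by
  let := φ.toAlgebra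
  refine minorForm_generates hij hi (fun m => ?_) x
  let d := KaehlerDifferential.D k A
  set N := Submodule.span A {x | ∃ l, l ≠ j ∧ d (t l) = x} with hN
  have hdt (l : Fin 4) (hl : l ≠ j) : d (t l) ∈ N := Submodule.subset_span ⟨l, hl, rfl⟩
  have hu : ∀ x : Ω[A⁄k], quarticPDeriv t j • x ∈ N → x ∈ N := by
    intro x hx
    have := N.smul_mem v hx
    rwa [smul_smul, hv, one_smul] at this
  let S : Subring A :=
    { carrier := {a | d a ∈ N}
      zero_mem' := by
        change d 0 ∈ N
        rw [_root_.map_zero]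
        exact zero_mem _
      one_mem' := by
        change d 1 ∈ N
        rw [Derivation.map_one_eq_zero]
        exact zero_mem _
      add_mem' := by
        intro a b ha hb
        change d (a + b) ∈ N
        rw [_root_.map_add]
        exact add_mem ha hb
      neg_mem' := by
        intro a ha
        change d (-a) ∈ N
        rw [_root_.map_neg]
        exact neg_mem ha
      mul_mem' := by
        intro a b ha hb
        change d (a * b) ∈ N
        rw [Derivation.leibniz]
        exact add_mem (N.smul_mem _ hb) (N.smul_mem _ ha) }
  have hS : S = ⊤ := by
    have hr (r : k) : φ r ∈ S := by
      change d (algebraMap k A r) ∈ N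
      rw [Derivation.map_algebraMap]
      exact zero_mem _
    have hjS : t j ∈ S := by
      refine hu _ ?_
      have := derivation_quarticVal d t j
      rw [ht, _root_.map_zero] at this
      have h' : quarticPDeriv t j • d (t j) = -(quarticPDeriv t (j + 1) • d (t (j + 1)) +
          quarticPDeriv t (j + 2) • d (t (j + 2)) + quarticPDeriv t (j + 3) • d (t (j + 3))) := by
        rw [eq_neg_iff_add_eq_zero, ← add_assoc, ← add_assoc, this]
      have hj : j + 1 ≠ j ∧ j + 2 ≠ j ∧ j + 3 ≠ j := by
        clear * -
        revert j
        decide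
      change quarticPDeriv t j • d (t j) ∈ N
      rw [h']
      exact neg_mem (add_mem (add_mem (N.smul_mem _ (hdt _ hj.1)) (N.smul_mem _ (hdt _ hj.2.1)))
        (N.smul_mem _ (hdt _ hj.2.2)))
    have htS (l : Fin 4) : t l ∈ S := by
      by_cases hl : l = j
      · rwa [hl]
      · exact hdt l hl
    have hpS : quarticPDeriv t j ∈ S :=
      add_mem (add_mem (mul_mem (mul_mem (ofNat_mem S 3) (pow_mem (htS _) 2)) (htS _))
        (pow_mem (htS _) 3)) (mul_mem (mul_mem (htS _) (htS _)) (htS _))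
    refine hgen S hr htS (hu _ ?_)
    have := d.leibniz v (quarticPDeriv t j)
    rw [hv, Derivation.map_one_eq_zero] at this
    rw [eq_neg_of_add_eq_zero_right this.symm]
    exact neg_mem (N.smul_mem v hpS)
  have hD (a : A) : d a ∈ N := by
    have : a ∈ S := by
      rw [hS]
      trivial
    exact this
  have : m ∈ Submodule.span A (Set.range d) := by
    rw [KaehlerDifferential.span_range_derivation]
    trivial
  refine Submodule.span_le.2 ?_ this
  rintro _ ⟨a, rfl⟩
  exact hD a

end TwoForms

end MinorForm

/-! ### Two-forms on a patch -/

section PatchForm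

variable {R : Type u} [CommRing R] {i j : Fin 4}

lemma patch_subring_eq_top (S : Subring (Patch R i j)) (hC : ∀ r, algebraMap R _ r ∈ S)
    (ht : ∀ l, patchCoord R i j l ∈ S) (hv : patchInv R i j ∈ S) : S = ⊤ := by
  refine eq_top_iff.2 fun a _ => ?_
  obtain ⟨p, rfl⟩ := Ideal.Quotient.mk_surjective a
  induction p using MvPolynomial.induction_on with
  | C r => exact hC r
  | add p q hp hq =>
    rw [map_add]
    exact add_mem (hp trivial) (hq trivial)
  | mul_X p n hp =>
    rw [map_mul]
    refine mul_mem (hp trivial) ?_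
    obtain _ | l := n
    · exact hv
    · exact ht l

lemma patch_minor_generates (hij : j ≠ i) (x : TwoForms (algebraMap R (Patch R i j))) :
    ∃ c : Patch R i j, c • TwoForms.minor _ (patchCoord R i j) j = x :=
  TwoForms.minor_generates hij (patchCoord_self R i j) (quarticVal_patchCoord R i j)
    (patchInv_mul R i j) patch_subring_eq_top x

/-- The differentials are free of rank two, so their exterior square is free of rank one and has
zero annihilator. -/
lemma eq_zero_of_smul_twoForms_eq_zero {k A : Type u} [CommRing k] [CommRing A] [Nontrivial A]
    [inst : Algebra k A] [Algebra.IsStandardSmoothOfRelativeDimension 2 k A] {s : A}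
    (hs : ∀ x : TwoForms (algebraMap k A), s • x = 0) : s = 0 := by
  -- `TwoForms` uses the algebra structure rebuilt from `algebraMap`, which has to be identified
  -- with the given one.
  have key : ∀ inst' : Algebra k A, inst' = inst →
      (∀ x : letI := inst'; ⋀[A]^2 (Ω[A⁄k]), s • x = 0) → s = 0 := by
    rintro _ rfl h
    have : Algebra.IsStandardSmooth k A :=
      Algebra.IsStandardSmoothOfRelativeDimension.isStandardSmooth 2
    have hr := Algebra.IsStandardSmoothOfRelativeDimension.rank_kaehlerDifferential (R := k)
      (S := A) 2
    have : Module.Free A (Ω[A⁄k]) := inferInstance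
    have : Module.Finite A (Ω[A⁄k]) := inferInstance
    have h1 : Module.finrank A (⋀[A]^2 (Ω[A⁄k])) = 1 := by
      rw [exteriorPower.finrank_eq, Module.finrank_eq_of_rank_eq hr]
      rfl
    let b := Module.finBasisOfFinrankEq A _ h1
    have := congrArg (fun x => b.repr x 0) (h (b 0))
    simpa using this
  exact key (algebraMap k A).toAlgebra (Algebra.algebra_ext _ _ fun _ => rfl) hs

end PatchForm

/-! ### Change of charts -/

section Compatibility

variable {R : Type u} [CommRing R]

attribute [local instance] MvPolynomial.gradedAlgebra

-- Both maps factor through the locus where `x_i x_{i'}` is invertible, and there `x_k / x_i =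
-- (x_{i'} / x_i)(x_k / x_{i'})`.
open HomogeneousLocalization in
lemma chartCoord_eq_mul_of_comp_eq {i i' : Fin 4} {B : Type u} [CommRing B] {δ : Chart R i →+* B}
    {δ' : Chart R i' →+* B} (h : Spec.map (CommRingCat.ofHom δ) ≫ chartι R i =
      Spec.map (CommRingCat.ofHom δ') ≫ chartι R i') (k : Fin 4) :
    δ (chartCoord R i k) = δ (chartCoord R i i') * δ' (chartCoord R i' k) := by
  change Spec.map _ ≫ Proj.awayι (coordGrading R) (coord R i) (coord_mem R i) one_pos =
    Spec.map _ ≫ Proj.awayι (coordGrading R) (coord R i') (coord_mem R i') one_pos at h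
  let w := coord R i * coord R i'
  let e := Proj.pullbackAwayιIso (coordGrading R) (coord_mem R i) one_pos (coord_mem R i') one_pos
    (x := w) rfl
  obtain ⟨ε, hε⟩ : ∃ ε : Away (coordGrading R) w →+* B,
      Spec.map (CommRingCat.ofHom ε) = pullback.lift _ _ h ≫ e.hom :=
    ⟨(Spec.preimage (pullback.lift _ _ h ≫ e.hom)).hom, Spec.map_preimage _⟩
  have h₁ : ε.comp (awayMap _ (coord_mem R i') rfl) = δ := by
    have : Spec.map (CommRingCat.ofHom ε) ≫ Spec.map (CommRingCat.ofHom
        (awayMap (coordGrading R) (coord_mem R i') (x := w) rfl)) =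
        Spec.map (CommRingCat.ofHom δ) := by
      rw [hε, Category.assoc, Proj.pullbackAwayιIso_hom_SpecMap_awayMap_left, pullback.lift_fst]
    rw [← Spec.map_comp] at this
    exact congrArg CommRingCat.Hom.hom (Spec.map_injective this)
  have h₂ : ε.comp (awayMap _ (coord_mem R i) (mul_comm _ _)) = δ' := by
    have : Spec.map (CommRingCat.ofHom ε) ≫ Spec.map (CommRingCat.ofHom
        (awayMap (coordGrading R) (coord_mem R i) (x := w) (mul_comm _ _))) =
        Spec.map (CommRingCat.ofHom δ') := by
      rw [hε, Category.assoc, Proj.pullbackAwayιIso_hom_SpecMap_awayMap_right, pullback.lift_snd]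
    rw [← Spec.map_comp] at this
    exact congrArg CommRingCat.Hom.hom (Spec.map_injective this)
  rw [← h₁, ← h₂]
  simp only [RingHom.comp_apply]
  rw [← map_mul]
  congr 1
  apply val_injective
  simp only [chartCoord, awayMap_mk, val_mul, Away.val_mk, Localization.mk_mul]
  rw [Localization.mk_eq_mk_iff, Localization.r_iff_exists]
  refine ⟨1, ?_⟩
  simp [w]
  ring

end Compatibility

/-! ### The residue form as a global generator -/

section Trivialization

variable {K : Type u} [Field K] {Y : Scheme.{u}} {f : Y ⟶ Spec (.of K)} (e : quarticScheme K ≅ Y)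

lemma patchι_comp_str (he : e.hom ≫ f = quarticStr K) (i j : Fin 4) :
    (patchι K i j ≫ e.hom) ≫ f =
      Spec.map (CommRingCat.ofHom (algebraMap K (Patch K i j))) := by
  rw [Category.assoc, he, patchι_str]

lemma exists_patch_of_iso [CharP K 2] (y : Y) :
    ∃ i j, j ≠ i ∧ y ∈ Set.range (patchι K i j ≫ e.hom) := by
  obtain ⟨i, j, hij, x, hx⟩ := exists_mem_range_patchι (e.inv y) (by
    rw [show (2 : K) = 0 from CharP.cast_eq_zero K 2]
    exact zero_mem _)
  refine ⟨i, j, hij, x, ?_⟩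
  rw [Scheme.Hom.comp_apply, hx, ← Scheme.Hom.comp_apply, e.inv_hom_id]
  rfl

variable [IsIntegral Y]

/-- The residue form on the function field of the quartic, in terms of patch coordinates. -/
def residueForm (f : Y ⟶ Spec (.of K)) {i j : Fin 4} (ρ : Patch K i j →+* Y.functionField) :
    TwoForms (genericScalars f) :=
  ρ (patchInv K i j) • TwoForms.minor _ (fun l => ρ (patchCoord K i j l)) j

lemma residueForm_generates (he : e.hom ≫ f = quarticStr K) {i j : Fin 4} (hij : j ≠ i)
    {ρ : Patch K i j →+* Y.functionField}
    (h : Spec.map (CommRingCat.ofHom ρ) ≫ patchι K i j ≫ e.hom = Y.fromSpecStalk (genericPoint Y)) :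
    TwoForms.Generates (algebraMap K (Patch K i j)) ρ
      (comp_eq_genericScalars (patchι_comp_str e he i j) h) (residueForm f ρ) := by
  refine ⟨patchInv K i j • TwoForms.minor _ (patchCoord K i j) j, ?_, fun x => ?_⟩
  · rw [TwoForms.map_smul, TwoForms.map_minor]
    rfl
  · obtain ⟨c, rfl⟩ := patch_minor_generates hij x
    refine ⟨c * quarticPDeriv (patchCoord K i j) j, ?_⟩
    refine (smul_smul (c * quarticPDeriv (patchCoord K i j) j) (patchInv K i j)
      (TwoForms.minor (algebraMap K (Patch K i j)) (patchCoord K i j) j)).trans ?_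
    rw [mul_assoc, mul_comm (quarticPDeriv _ _), patchInv_mul, mul_one]

/-- If the residue form were zero, its generating lift to the patch would be torsion, and a nonzero
function would kill all two-forms of the patch. -/
lemma residueForm_eq_zero_imp (he : e.hom ≫ f = quarticStr K) {i j : Fin 4} (hij : j ≠ i)
    {ρ : Patch K i j →+* Y.functionField}
    (h : Spec.map (CommRingCat.ofHom ρ) ≫ patchι K i j ≫ e.hom = Y.fromSpecStalk (genericPoint Y))
    (c : Y.functionField) (hc : c • residueForm f ρ = 0) : c = 0 := by
  by_contra hc0
  have h0 : residueForm f ρ = 0 := by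
    have := congrArg (c⁻¹ • ·) hc
    simpa [smul_smul, hc0] using this
  obtain ⟨ω, hω, hsurj⟩ := residueForm_generates e he hij h
  rw [h0] at hω
  obtain ⟨s, hs, hsω⟩ := exists_smul_eq_zero_of_map_eq_zero (patchι_comp_str e he i j) h hω
  have : Nontrivial (Patch K i j) := ρ.domain_nontrivial
  have := isStandardSmooth_patch K hij
  refine hs (eq_zero_of_smul_twoForms_eq_zero (k := K) fun x => ?_)
  obtain ⟨a, rfl⟩ := hsurj x
  rw [smul_comm, hsω, smul_zero]

variable [CharP K 2]

lemma two_eq_zero_functionField (f : Y ⟶ Spec (.of K)) : (2 : Y.functionField) = 0 := by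
  rw [← map_ofNat (genericScalars f) 2, show (OfNat.ofNat 2 : K) = 0 from CharP.cast_eq_zero K 2,
    map_zero]

/-- The two coordinate vectors differ by a factor `c`. The minor and the partial derivative both
scale by `c³`, which cancels; the change from `j` to `j'` is `quarticPDeriv_smul_minor`. -/
lemma residueForm_eq {i j i' j' : Fin 4} {ρ : Patch K i j →+* Y.functionField}
    {ρ' : Patch K i' j' →+* Y.functionField}
    (h : Spec.map (CommRingCat.ofHom ρ) ≫ patchι K i j ≫ e.hom = Y.fromSpecStalk (genericPoint Y))
    (h' : Spec.map (CommRingCat.ofHom ρ') ≫ patchι K i' j' ≫ e.hom =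
      Y.fromSpecStalk (genericPoint Y)) : residueForm f ρ = residueForm f ρ' := by
  have h2 := two_eq_zero_functionField f
  have hcomp : Spec.map (CommRingCat.ofHom (ρ.comp (chartToPatch K i j))) ≫ chartι K i =
      Spec.map (CommRingCat.ofHom (ρ'.comp (chartToPatch K i' j'))) ≫ chartι K i' := by
    rw [← cancel_mono e.hom, CommRingCat.ofHom_comp, CommRingCat.ofHom_comp, Spec.map_comp,
      Spec.map_comp]
    simpa [patchι] using h.trans h'.symm
  obtain ⟨t, ht⟩ : ∃ t, t = fun l => ρ (patchCoord K i j l) := ⟨_, rfl⟩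
  obtain ⟨t', ht'⟩ : ∃ t', t' = fun l => ρ' (patchCoord K i' j' l) := ⟨_, rfl⟩
  have htt (l : Fin 4) : t l = t i' * t' l := by
    simpa [ht, ht'] using chartCoord_eq_mul_of_comp_eq hcomp l
  have hv : ρ (patchInv K i j) * quarticPDeriv t j = 1 := by
    rw [ht, ← map_quarticPDeriv, ← map_mul, patchInv_mul, map_one]
  have hv' : ρ' (patchInv K i' j') * quarticPDeriv t' j' = 1 := by
    rw [ht', ← map_quarticPDeriv, ← map_mul, patchInv_mul, map_one]
  have hF : quarticVal t' = 0 := by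
    rw [ht', ← map_quarticVal, quarticVal_patchCoord, map_zero]
  rw [residueForm, residueForm, ← ht, ← ht']
  generalize t i' = c at htt
  clear ht ht'
  obtain rfl : t = fun l => c * t' l := funext htt
  rw [quarticPDeriv_mul] at hv
  rw [TwoForms.minor_mul h2]
  have key := TwoForms.quarticPDeriv_smul_minor (φ := genericScalars f) h2 hF j j'
  generalize ρ (patchInv K i j) = v at hv
  generalize ρ' (patchInv K i' j') = v' at hv'
  calc v • c ^ 3 • TwoForms.minor (genericScalars f) t' j
      = (v * c ^ 3 * v') • quarticPDeriv t' j' • TwoForms.minor (genericScalars f) t' j := by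
        rw [smul_smul, smul_smul, mul_assoc (v * c ^ 3), hv', mul_one]
    _ = (v * (c ^ 3 * quarticPDeriv t' j) * v') • TwoForms.minor (genericScalars f) t' j' := by
        rw [← key, smul_smul]
        congr 1
        ring
    _ = v' • TwoForms.minor (genericScalars f) t' j' := by rw [hv, one_mul]

theorem exists_trivializes_of_iso (he : e.hom ≫ f = quarticStr K) :
    ∃ ω : GlobalTwoForm f, ω.Trivializes := by
  -- The existence of `ρ` selects the patches that contain the generic point.
  let I := { p : Fin 4 × Fin 4 // p.2 ≠ p.1 ∧ ∃ ρ : Patch K p.1 p.2 →+* Y.functionField,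
    Spec.map (CommRingCat.ofHom ρ) ≫ patchι K p.1 p.2 ≫ e.hom = Y.fromSpecStalk (genericPoint Y) }
  have hI (y : Y) : ∃ p : I, y ∈ Set.range (patchι K p.1.1 p.1.2 ≫ e.hom) := by
    obtain ⟨i, j, hij, hy⟩ := exists_patch_of_iso e y
    exact ⟨⟨(i, j), hij, exists_comp_eq_fromSpecStalk _ y hy⟩, hy⟩
  obtain ⟨⟨⟨i, j⟩, hij, ρ, h⟩, -⟩ := hI (genericPoint Y)
  refine exists_trivializes (residueForm_eq_zero_imp e he hij h) (ι := I)
    (fun p => ⟨(patchι K p.1.1 p.1.2 ≫ e.hom) ''ᵁ ⊤,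
      (isAffineOpen_top _).image_of_isOpenImmersion _⟩) ?_ ?_
  · refine top_le_iff.1 fun y _ => ?_
    obtain ⟨p, hp⟩ := hI y
    refine TopologicalSpace.Opens.mem_iSup.2 ⟨p, ?_⟩
    exact (Scheme.Hom.image_top_eq_opensRange _).ge hp
  · rintro ⟨⟨i', j'⟩, hij', ρ', h'⟩
    refine ⟨_, generates_image (patchι_comp_str e he i' j') h' ?_⟩
    rw [residueForm_eq e h h']
    exact residueForm_generates e he hij' h'

end Trivialization

/-! ### Regular elements in a monic extension -/

section Regular

open Polynomial

/-- Remainders modulo the monic `g` are coordinates over `R`, so regularity of `r` modulo `I` can be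
applied to each coefficient. -/
lemma adjoinRoot_mem_map_of_mul_mem {R : Type*} [CommRing R] {I : Ideal R} {r : R}
    (hr : ∀ s, r * s ∈ I → s ∈ I) {g : R[X]} (hg : g.Monic) {q : AdjoinRoot g}
    (hq : AdjoinRoot.of g r * q ∈ I.map (AdjoinRoot.of g)) : q ∈ I.map (AdjoinRoot.of g) := by
  obtain ⟨f, rfl⟩ := AdjoinRoot.mk_surjective q
  have hmap : I.map (AdjoinRoot.of g) = (I.map C).map (AdjoinRoot.mk g) := by
    rw [Ideal.map_map]
    rfl
  rw [hmap, Ideal.mem_map_iff_of_surjective _ AdjoinRoot.mk_surjective] at hq ⊢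
  obtain ⟨h, hh, he⟩ := hq
  refine ⟨f %ₘ g, ?_, ?_⟩
  · have h₁ : (h - C r * f) %ₘ g = 0 := by
      rw [modByMonic_eq_zero_iff_dvd hg, ← AdjoinRoot.mk_eq_zero, map_sub, he, map_mul]
      exact sub_self _
    have h₂ : h %ₘ g = C r * (f %ₘ g) := by
      rw [sub_modByMonic, sub_eq_zero] at h₁
      rw [h₁, ← smul_eq_C_mul, ← smul_eq_C_mul, smul_modByMonic]
    have h₃ : h %ₘ g ∈ I.map C := by
      have hker := Polynomial.ker_mapRingHom (Ideal.Quotient.mk I)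
      rw [Ideal.mk_ker] at hker
      rw [← hker, RingHom.mem_ker, coe_mapRingHom] at hh ⊢
      rw [map_modByMonic _ hg, hh, zero_modByMonic]
    rw [Ideal.mem_map_C_iff] at h₃ ⊢
    intro n
    refine hr _ ?_
    rw [← coeff_C_mul, ← h₂]
    exact h₃ n
  · refine AdjoinRoot.mk_eq_mk.2 ⟨-(f /ₘ g), ?_⟩
    linear_combination modByMonic_add_div f g

end Regular

/-! ### Powers of variables as a regular sequence -/

section Monomial

variable {K σ : Type*} [Field K]

lemma mem_span_X_pow_of_X_pow_mul_mem {i j : σ} (hij : j ≠ i) (n : ℕ)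
    (s : MvPolynomial σ K)
    (h : MvPolynomial.X j ^ n * s ∈ Ideal.span {(MvPolynomial.X i ^ n : MvPolynomial σ K)}) :
    s ∈ Ideal.span {(MvPolynomial.X i ^ n : MvPolynomial σ K)} := by
  rw [Ideal.mem_span_singleton] at h ⊢
  refine (MvPolynomial.X_prime (i := i)).pow_dvd_of_dvd_mul_left n ?_ h
  intro h'
  have := (MvPolynomial.X_prime (i := i)).dvd_of_dvd_pow h'
  rw [MvPolynomial.X_dvd_X] at this
  exact hij this.symm

/-- Membership in a monomial ideal is read off the support, and multiplying by a power of `X l`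
leaves the exponents of `X i` and `X j` unchanged. -/
lemma mem_span_X_pow_pair_of_X_pow_mul_mem {i j l : σ} (hil : l ≠ i) (hjl : l ≠ j) (n : ℕ)
    (s : MvPolynomial σ K) (h : MvPolynomial.X l ^ n * s ∈
      Ideal.span {MvPolynomial.X i ^ n, (MvPolynomial.X j ^ n : MvPolynomial σ K)}) :
    s ∈ Ideal.span {MvPolynomial.X i ^ n, (MvPolynomial.X j ^ n : MvPolynomial σ K)} := by
  classical
  have e : ({MvPolynomial.X i ^ n, MvPolynomial.X j ^ n} : Set (MvPolynomial σ K)) =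
      (fun s => MvPolynomial.monomial s 1) '' {Finsupp.single i n, Finsupp.single j n} := by
    rw [Set.image_pair]
    simp [MvPolynomial.X_pow_eq_monomial]
  rw [e, MvPolynomial.mem_ideal_span_monomial_image] at h ⊢
  intro m hm
  have hm' : Finsupp.single l n + m ∈ (MvPolynomial.X l ^ n * s).support := by
    rw [MvPolynomial.mem_support_iff, MvPolynomial.X_pow_eq_monomial,
      MvPolynomial.coeff_monomial_mul, one_mul]
    exact MvPolynomial.mem_support_iff.1 hm
  obtain ⟨u, hu, hle⟩ := h _ hm'
  refine ⟨u, hu, ?_⟩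
  obtain rfl | rfl := hu
  · have := hle i
    simp [hil] at this
    simpa using this
  · have := hle j
    simp [hjl] at this
    simpa using this

end Monomial

/-! ### The coordinate ring as a free algebra over three linear forms -/

section Coordinates

variable {K : Type u} [Field K]

/-- Linear coordinates on the quartic whose common zero in projective space is not on the quartic,
in characteristic two. -/
def lin (R : Type u) [CommRing R] (i : Fin 3) : CoordRing R := coord R i.castSucc + coord R 3

variable (K) in
/-- The quartic form as a polynomial in the last coordinate. -/
def quarticPoly : Polynomial (MvPolynomial (Fin 3) K) :=
  quarticVal ![.C (.X 0) + .X, .C (.X 1) + .X, .C (.X 2) + .X, .X]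

-- The coefficient of `w⁴` is the value `5 = 1` of the quartic at `(1, 1, 1, 1)`; the linear
-- coordinates are chosen for this reason.
open Polynomial in
lemma quarticPoly_monic [CharP K 2] : (quarticPoly K).Monic := by
  let a : MvPolynomial (Fin 3) K := .X 0
  let b : MvPolynomial (Fin 3) K := .X 1
  let c : MvPolynomial (Fin 3) K := .X 2
  have h2 : (2 : (MvPolynomial (Fin 3) K)[X]) = 0 := CharP.cast_eq_zero _ 2
  have : quarticPoly K = X ^ 4 + (C (a + b + c) * X ^ 3 + C (a ^ 2 + b ^ 2 + c ^ 2 +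
    a * c) * X ^ 2 +
      C (a ^ 3 + b ^ 3 + c ^ 3 + a ^ 2 * b + b ^ 2 * c + a * b * c) * X +
      C (a ^ 3 * b + b ^ 3 * c)) := by
    simp only [quarticPoly, quarticVal, Matrix.cons_val, map_add, map_mul, map_pow]
    simp only [a, b, c]
    generalize (C (MvPolynomial.X 0 : MvPolynomial (Fin 3) K)) = a
    generalize (C (MvPolynomial.X 1 : MvPolynomial (Fin 3) K)) = b
    generalize (C (MvPolynomial.X 2 : MvPolynomial (Fin 3) K)) = c
    generalize (X : (MvPolynomial (Fin 3) K)[X]) = w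
    linear_combination (2 * w ^ 4 + 2 * (a + b + c) * w ^ 3 +
      (a ^ 2 + b ^ 2 + c ^ 2 + 2 * a * b + 2 * b * c) * w ^ 2 + (a ^ 2 * b + b ^ 2 * c) * w) * h2
  rw [this]
  refine monic_X_pow_add ?_
  compute_degree!

/-- The coordinate ring is the algebra generated by a root of the quartic form. -/
def coordToAdjoinRoot : CoordRing K →+* AdjoinRoot (quarticPoly K) :=
  coordLift K ((AdjoinRoot.of _).comp MvPolynomial.C) (fun i => AdjoinRoot.mk (quarticPoly K)
    ((![.C (.X 0) + .X, .C (.X 1) + .X, .C (.X 2) + .X, .X] :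
      Fin 4 → Polynomial (MvPolynomial (Fin 3) K)) i)) (by
    rw [← map_quarticVal]
    exact AdjoinRoot.mk_self)

lemma coordToAdjoinRoot_coord (i : Fin 4) : coordToAdjoinRoot (K := K) (coord K i) =
    AdjoinRoot.mk _ ((![.C (.X 0) + .X, .C (.X 1) + .X, .C (.X 2) + .X, .X] :
      Fin 4 → Polynomial (MvPolynomial (Fin 3) K)) i) :=
  coordLift_coord ..

variable (K) in
/-- The polynomials in the linear coordinates. -/
def linHom : MvPolynomial (Fin 3) K →+* CoordRing K :=
  MvPolynomial.eval₂Hom (algebraMap K _) (lin K)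

lemma linHom_X (i : Fin 3) : linHom K (.X i) = lin K i := MvPolynomial.eval₂Hom_X' ..

lemma two_eq_zero_of_algebra (K A : Type*) [CommRing K] [CharP K 2] [CommRing A] [Algebra K A] :
    (2 : A) = 0 := by
  rw [← map_ofNat (algebraMap K A) 2, show (OfNat.ofNat 2 : K) = 0 from CharP.cast_eq_zero K 2,
    map_zero]

variable [CharP K 2]

lemma lin_add_coord (i : Fin 3) : lin K i + coord K 3 = coord K i.castSucc := by
  rw [lin]
  linear_combination coord K 3 * two_eq_zero_of_algebra K (CoordRing K)

/-- The inverse of `coordToAdjoinRoot`. -/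
def adjoinRootToCoord : AdjoinRoot (quarticPoly K) →+* CoordRing K :=
  AdjoinRoot.lift (linHom K) (coord K 3) (by
    rw [quarticPoly, ← Polynomial.coe_eval₂RingHom, map_quarticVal, ← quarticVal_coord K]
    congr 1
    funext i
    have hC (i : Fin 3) : Polynomial.eval₂RingHom (linHom K) (coord K 3)
        (.C (.X i) + .X) = coord K i.castSucc := by
      rw [map_add, Polynomial.coe_eval₂RingHom, Polynomial.eval₂_C, Polynomial.eval₂_X, linHom_X,
        lin_add_coord]
    fin_cases i
    · exact hC 0
    · exact hC 1
    · exact hC 2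
    · exact Polynomial.eval₂_X ..)

lemma adjoinRootToCoord_comp_of :
    (adjoinRootToCoord (K := K)).comp (AdjoinRoot.of _) = linHom K :=
  RingHom.ext fun x => by rw [RingHom.comp_apply, adjoinRootToCoord, AdjoinRoot.lift_of]

lemma adjoinRootToCoord_coordToAdjoinRoot (s : CoordRing K) :
    adjoinRootToCoord (coordToAdjoinRoot s) = s := by
  have h : (adjoinRootToCoord (K := K)).comp coordToAdjoinRoot = RingHom.id _ := by
    refine Ideal.Quotient.ringHom_ext (MvPolynomial.ringHom_ext (fun r => ?_) fun i => ?_)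
    · change adjoinRootToCoord (coordToAdjoinRoot (algebraMap K (CoordRing K) r)) = algebraMap K _ r
      have : coordToAdjoinRoot (algebraMap K (CoordRing K) r) =
        AdjoinRoot.of _ (MvPolynomial.C r) := MvPolynomial.eval₂_C ..
      rw [this, ← RingHom.comp_apply, adjoinRootToCoord_comp_of]
      exact MvPolynomial.eval₂_C ..
    · change adjoinRootToCoord (coordToAdjoinRoot (coord K i)) = coord K i
      have hC (i : Fin 3) : adjoinRootToCoord (AdjoinRoot.mk (quarticPoly K)
          (.C (.X i) + .X)) = coord K i.castSucc := by
        rw [adjoinRootToCoord, AdjoinRoot.lift_mk, Polynomial.eval₂_add, Polynomial.eval₂_C,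
          Polynomial.eval₂_X, linHom_X, lin_add_coord]
      rw [coordToAdjoinRoot_coord]
      fin_cases i
      · exact hC 0
      · exact hC 1
      · exact hC 2
      · exact (AdjoinRoot.lift_mk _ _).trans (Polynomial.eval₂_X ..)
  exact RingHom.congr_fun h s

lemma coordToAdjoinRoot_comp_linHom :
    (coordToAdjoinRoot (K := K)).comp (linHom K) = AdjoinRoot.of _ := by
  refine MvPolynomial.ringHom_ext (fun r => ?_) fun i => ?_
  · rw [RingHom.comp_apply, linHom, MvPolynomial.coe_eval₂Hom, MvPolynomial.eval₂_C]
    exact MvPolynomial.eval₂_C ..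
  · rw [RingHom.comp_apply, linHom_X, lin, map_add, coordToAdjoinRoot_coord,
      coordToAdjoinRoot_coord, ← map_add, AdjoinRoot.of, RingHom.comp_apply]
    have h2 := two_eq_zero_of_algebra K (Polynomial (MvPolynomial (Fin 3) K))
    congr 1
    fin_cases i <;> simp <;> linear_combination (Polynomial.X) * h2

lemma mem_map_linHom_of_mul_mem {I : Ideal (MvPolynomial (Fin 3) K)} {r : MvPolynomial (Fin 3) K}
    (hr : ∀ s, r * s ∈ I → s ∈ I) {s : CoordRing K} (hs : linHom K r * s ∈ I.map (linHom K)) :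
    s ∈ I.map (linHom K) := by
  have h := Ideal.mem_map_of_mem (coordToAdjoinRoot (K := K)) hs
  rw [Ideal.map_map, coordToAdjoinRoot_comp_linHom, map_mul, ← RingHom.comp_apply,
    coordToAdjoinRoot_comp_linHom] at h
  have h' := Ideal.mem_map_of_mem (adjoinRootToCoord (K := K))
    (adjoinRoot_mem_map_of_mul_mem hr quarticPoly_monic h)
  rwa [Ideal.map_map, adjoinRootToCoord_comp_of, adjoinRootToCoord_coordToAdjoinRoot] at h'

lemma eq_zero_of_lin_mul_eq_zero {i : Fin 3} {s : CoordRing K} (h : lin K i * s = 0) : s = 0 := by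
  have := mem_map_linHom_of_mul_mem (K := K) (I := ⊥) (r := .X i) (s := s)
    (fun s hs => by simpa [MvPolynomial.X_ne_zero] using hs) (by
      rw [linHom_X, h]
      exact zero_mem _)
  rwa [Ideal.map_bot, Ideal.mem_bot] at this

lemma lin_pow_dvd {i j : Fin 3} (hij : j ≠ i) {n : ℕ} {s : CoordRing K}
    (h : lin K i ^ n ∣ lin K j ^ n * s) : lin K i ^ n ∣ s := by
  have := mem_map_linHom_of_mul_mem (mem_span_X_pow_of_X_pow_mul_mem (K := K) hij n) (s := s)
  simpa only [Ideal.map_span, Set.image_singleton, map_pow, linHom_X, Ideal.mem_span_singleton, h,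
    true_imp_iff] using this

lemma exists_eq_of_lin_pow_mul_eq {i j l : Fin 3} (hil : l ≠ i) (hjl : l ≠ j) {n : ℕ}
    {s u v : CoordRing K} (h : lin K l ^ n * s = u * lin K i ^ n + v * lin K j ^ n) :
    ∃ u v, s = u * lin K i ^ n + v * lin K j ^ n := by
  have := mem_map_linHom_of_mul_mem (mem_span_X_pow_pair_of_X_pow_mul_mem (K := K) hil hjl n)
    (s := s)
  simp only [Ideal.map_span, Set.image_pair, map_pow, linHom_X, Ideal.mem_span_pair] at this
  obtain ⟨u, v, h⟩ := this ⟨u, v, h.symm⟩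
  exact ⟨u, v, h.symm⟩

/-- Exactness in the middle of the Koszul complex. -/
lemma exists_koszul {a b c : Fin 3} (hab : b ≠ a) (hac : c ≠ a) (hbc : c ≠ b) {n : ℕ}
    {p q r : CoordRing K}
    (h : p * lin K c ^ n + q * lin K a ^ n = r * lin K b ^ n) :
    ∃ α β γ, p = β * lin K a ^ n - α * lin K b ^ n ∧ q = γ * lin K b ^ n - β * lin K c ^ n ∧
      r = γ * lin K a ^ n - α * lin K c ^ n := by
  obtain ⟨β, α, hp⟩ := exists_eq_of_lin_pow_mul_eq hac hbc (s := p) (u := -q) (v := r) (n := n) (by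
    linear_combination h)
  -- After substituting `p`, the relation reads `b^n (r - α c^n) = a^n (β c^n + q)` in the linear
  -- forms, so regularity lets `b^n` be cancelled.
  obtain ⟨γ, hγ⟩ := lin_pow_dvd hab (n := n) (s := r - α * lin K c ^ n)
    ⟨β * lin K c ^ n + q, by
      rw [hp] at h
      linear_combination -h⟩
  refine ⟨-α, β, γ, by linear_combination hp, ?_, by linear_combination hγ⟩
  have hreg (m : ℕ) (s : CoordRing K) (h : lin K a ^ m * s = 0) : s = 0 := by
    induction m with
    | zero => simpa using h
    | succ m ih =>
      rw [pow_succ', mul_assoc] at h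
      exact ih (eq_zero_of_lin_mul_eq_zero h)
  rw [← sub_eq_zero]
  refine hreg n _ ?_
  rw [hp] at h
  linear_combination h + lin K b ^ n * hγ

end Coordinates

/-! ### Spanning monomials and the top Čech class -/

section Spanning

variable (K : Type u) [Field K]

lemma lin_mem (i : Fin 3) : lin K i ∈ coordGrading K 1 := add_mem (coord_mem K _) (coord_mem K _)

/-- The monomials in the three linear coordinates and the last coordinate. -/
def linMonomial (i j k l : ℕ) : CoordRing K :=
  lin K 0 ^ i * lin K 1 ^ j * lin K 2 ^ k * coord K 3 ^ l

lemma linMonomial_mem {i j k l m : ℕ} (h : i + j + k + l = m) :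
    linMonomial K i j k l ∈ coordGrading K m := by
  have h₁ := SetLike.mul_mem_graded (SetLike.mul_mem_graded (SetLike.mul_mem_graded
    (SetLike.pow_mem_graded i (lin_mem K 0)) (SetLike.pow_mem_graded j (lin_mem K 1)))
    (SetLike.pow_mem_graded k (lin_mem K 2))) (SetLike.pow_mem_graded l (coord_mem K 3))
  have e : i • 1 + j • 1 + k • 1 + l • 1 = m := by simpa using h
  rw [← e]
  exact h₁

/-- The span of the monomials of degree `m` and of degree at most three in the last coordinate. -/
def normalSpan (m : ℕ) : Submodule K (CoordRing K) :=
  Submodule.span K {s | ∃ i j k l, i + j + k + l = m ∧ l ≤ 3 ∧ linMonomial K i j k l = s}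

variable {K}

lemma smul_eq_algebraMap_mul (r : K) (x : CoordRing K) : r • x = algebraMap K _ r * x :=
  Algebra.smul_def r x

lemma linMonomial_mem_normalSpan {i j k l m : ℕ} (h : i + j + k + l = m) (hl : l ≤ 3) :
    linMonomial K i j k l ∈ normalSpan K m := Submodule.subset_span ⟨i, j, k, l, h, hl, rfl⟩

lemma mul_mem_normalSpan {x : CoordRing K} {m : ℕ}
    (h : ∀ i j k l, i + j + k + l = m → l ≤ 3 → x * linMonomial K i j k l ∈ normalSpan K (m + 1))
    {s : CoordRing K} (hs : s ∈ normalSpan K m) : x * s ∈ normalSpan K (m + 1) := by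
  induction hs using Submodule.span_induction with
  | mem s hs =>
    obtain ⟨i, j, k, l, hm, hl, rfl⟩ := hs
    exact h i j k l hm hl
  | zero =>
    rw [mul_zero]
    exact zero_mem _
  | add s t _ _ hs ht =>
    rw [mul_add]
    exact add_mem hs ht
  | smul r s _ hs =>
    rw [mul_smul_comm]
    exact Submodule.smul_mem _ r hs

lemma lin_mul_mem_normalSpan (n : Fin 3) {m : ℕ} {s : CoordRing K} (hs : s ∈ normalSpan K m) :
    lin K n * s ∈ normalSpan K (m + 1) := by
  refine mul_mem_normalSpan (fun i j k l hm hl => ?_) hs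
  obtain rfl | rfl | rfl : n = 0 ∨ n = 1 ∨ n = 2 := by revert n; decide
  · rw [show lin K 0 * linMonomial K i j k l = linMonomial K (i + 1) j k l by
      simp only [linMonomial]; ring]
    exact linMonomial_mem_normalSpan (by omega) hl
  · rw [show lin K 1 * linMonomial K i j k l = linMonomial K i (j + 1) k l by
      simp only [linMonomial]; ring]
    exact linMonomial_mem_normalSpan (by omega) hl
  · rw [show lin K 2 * linMonomial K i j k l = linMonomial K i j (k + 1) l by
      simp only [linMonomial]; ring]
    exact linMonomial_mem_normalSpan (by omega) hl

variable [CharP K 2]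

lemma coord_pow_four : coord K 3 ^ 4 = (lin K 0 + lin K 1 + lin K 2) * coord K 3 ^ 3 +
    (lin K 0 ^ 2 + lin K 1 ^ 2 + lin K 2 ^ 2 + lin K 0 * lin K 2) * coord K 3 ^ 2 +
    (lin K 0 ^ 3 + lin K 1 ^ 3 + lin K 2 ^ 3 + lin K 0 ^ 2 * lin K 1 + lin K 1 ^ 2 * lin K 2 +
      lin K 0 * lin K 1 * lin K 2) * coord K 3 +
    (lin K 0 ^ 3 * lin K 1 + lin K 1 ^ 3 * lin K 2) := by
  have h := quarticVal_coord K
  have h2 := two_eq_zero_of_algebra K (CoordRing K)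
  have h₀ : coord K 0 = _ := (lin_add_coord (K := K) 0).symm
  have h₁ : coord K 1 = _ := (lin_add_coord (K := K) 1).symm
  have h₂ : coord K 2 = _ := (lin_add_coord (K := K) 2).symm
  rw [quarticVal, h₀, h₁, h₂] at h
  generalize lin K 0 = a at *
  generalize lin K 1 = b at *
  generalize lin K 2 = c at *
  generalize coord K 3 = w at *
  linear_combination h - (2 * w ^ 4 + 3 * (a + b + c) * w ^ 3 +
      (2 * a ^ 2 + 2 * b ^ 2 + 2 * c ^ 2 + 2 * a * b + 2 * b * c + a * c) * w ^ 2 +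
      (a ^ 3 + b ^ 3 + c ^ 3 + 2 * a ^ 2 * b + 2 * b ^ 2 * c + a * b * c) * w +
      (a ^ 3 * b + b ^ 3 * c)) * h2

lemma coord_three_mul_mem_normalSpan {m : ℕ} {s : CoordRing K} (hs : s ∈ normalSpan K m) :
    coord K 3 * s ∈ normalSpan K (m + 1) := by
  refine mul_mem_normalSpan (fun i j k l hm hl => ?_) hs
  have hmem {i j k l : ℕ} (h : i + j + k + l = m + 1) (hl : l ≤ 3) :=
    linMonomial_mem_normalSpan (K := K) h hl
  obtain hl | rfl := hl.lt_or_eq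
  · rw [show coord K 3 * linMonomial K i j k l = linMonomial K i j k (l + 1) by
      simp only [linMonomial]; ring]
    exact hmem (by omega) hl
  -- At exponent three, `w⁴` is replaced by the fifteen monomials of `coord_pow_four`.
  · have : coord K 3 * linMonomial K i j k 3 =
      linMonomial K (i + 1) j k 3 + linMonomial K i (j + 1) k 3 + linMonomial K i j (k + 1) 3 +
      linMonomial K (i + 2) j k 2 + linMonomial K i (j + 2) k 2 + linMonomial K i j (k + 2) 2 +
      linMonomial K (i + 1) j (k + 1) 2 +
      linMonomial K (i + 3) j k 1 + linMonomial K i (j + 3) k 1 + linMonomial K i j (k + 3) 1 +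
      linMonomial K (i + 2) (j + 1) k 1 + linMonomial K i (j + 2) (k + 1) 1 +
      linMonomial K (i + 1) (j + 1) (k + 1) 1 +
      linMonomial K (i + 3) (j + 1) k 0 + linMonomial K i (j + 3) (k + 1) 0 := by
      simp only [linMonomial]
      linear_combination (lin K 0 ^ i * lin K 1 ^ j * lin K 2 ^ k) * coord_pow_four (K := K)
    rw [this]
    iterate 14 refine add_mem ?_ (hmem (by omega) (by omega))
    exact hmem (by omega) (by omega)

lemma coord_mul_mem_normalSpan (n : Fin 4) {m : ℕ} {s : CoordRing K} (hs : s ∈ normalSpan K m) :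
    coord K n * s ∈ normalSpan K (m + 1) := by
  have h (n : Fin 3) : coord K n.castSucc * s ∈ normalSpan K (m + 1) := by
    rw [← lin_add_coord, add_mul]
    exact add_mem (lin_mul_mem_normalSpan n hs) (coord_three_mul_mem_normalSpan hs)
  obtain rfl | rfl | rfl | rfl : n = 0 ∨ n = 1 ∨ n = 2 ∨ n = 3 := by revert n; decide
  · exact h 0
  · exact h 1
  · exact h 2
  · exact coord_three_mul_mem_normalSpan hs

lemma coord_pow_mul_mem_normalSpan (n : Fin 4) (e : ℕ) {m : ℕ} {s : CoordRing K}
    (hs : s ∈ normalSpan K m) : coord K n ^ e * s ∈ normalSpan K (m + e) := by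
  induction e with
  | zero => simpa using hs
  | succ e ih =>
    rw [pow_succ', mul_assoc]
    exact coord_mul_mem_normalSpan n ih

lemma mem_normalSpan {m : ℕ} {s : CoordRing K} (hs : s ∈ coordGrading K m) :
    s ∈ normalSpan K m := by
  obtain ⟨p, hp, rfl⟩ := exists_isHomogeneous_of_mem K hs
  rw [← MvPolynomial.support_sum_monomial_coeff p, map_sum]
  refine sum_mem fun d hd => ?_
  have hdeg : d 0 + d 1 + d 2 + d 3 = m := by
    have := hp (MvPolynomial.mem_support_iff.1 hd)
    rw [← this]
    simp [Finsupp.weight_apply, Finsupp.sum_fintype, Fin.sum_univ_four]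
  have e : Ideal.Quotient.mk (quarticIdeal K) (MvPolynomial.monomial d (p.coeff d)) =
      p.coeff d • (coord K 0 ^ d 0 * (coord K 1 ^ d 1 * (coord K 2 ^ d 2 *
        (coord K 3 ^ d 3 * 1)))) := by
    rw [smul_eq_algebraMap_mul, MvPolynomial.monomial_eq, Finsupp.prod_fintype _ _ (by simp),
      Fin.prod_univ_four, map_mul,
      map_mul, map_mul, map_mul, map_pow, map_pow, map_pow, map_pow, mul_one,
      mul_assoc (_ * _), mul_assoc]
    rfl
  rw [e]
  refine Submodule.smul_mem _ _ ?_
  have h1 : (1 : CoordRing K) ∈ normalSpan K 0 := by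
    have := linMonomial_mem_normalSpan (K := K) (i := 0) (j := 0) (k := 0) (l := 0) rfl (by omega)
    simpa [linMonomial] using this
  have := coord_pow_mul_mem_normalSpan 0 (d 0) (coord_pow_mul_mem_normalSpan 1 (d 1)
    (coord_pow_mul_mem_normalSpan 2 (d 2) (coord_pow_mul_mem_normalSpan 3 (d 3) h1)))
  rwa [show 0 + d 3 + d 2 + d 1 + d 0 = m by omega] at this

/-- The second Čech cohomology group is spanned by the class of one monomial. -/
lemma exists_eq_add_of_mem {n : ℕ} {s : CoordRing K} (hs : s ∈ coordGrading K (3 * (n + 1))) :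
    ∃ (ε : K), ∃ A ∈ coordGrading K (2 * (n + 1)), ∃ B ∈ coordGrading K (2 * (n + 1)),
      ∃ C ∈ coordGrading K (2 * (n + 1)), s = ε • linMonomial K n n n 3 +
        lin K 0 ^ (n + 1) * A + lin K 1 ^ (n + 1) * B + lin K 2 ^ (n + 1) * C := by
  replace hs := mem_normalSpan hs
  induction hs using Submodule.span_induction with
  | mem s hs =>
    obtain ⟨i, j, k, l, hm, hl, rfl⟩ := hs
    by_cases hi : n + 1 ≤ i
    · obtain ⟨i, rfl⟩ := Nat.exists_eq_add_of_le hi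
      refine ⟨0, linMonomial K i j k l, linMonomial_mem K (by omega), 0, zero_mem _, 0, zero_mem _,
        ?_⟩
      simp only [linMonomial, zero_smul]
      ring
    by_cases hj : n + 1 ≤ j
    · obtain ⟨j, rfl⟩ := Nat.exists_eq_add_of_le hj
      refine ⟨0, 0, zero_mem _, linMonomial K i j k l, linMonomial_mem K (by omega), 0, zero_mem _,
        ?_⟩
      simp only [linMonomial, zero_smul]
      ring
    by_cases hk : n + 1 ≤ k
    · obtain ⟨k, rfl⟩ := Nat.exists_eq_add_of_le hk
      refine ⟨0, 0, zero_mem _, 0, zero_mem _, linMonomial K i j k l, linMonomial_mem K (by omega),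
        ?_⟩
      simp only [linMonomial, zero_smul]
      ring
    -- The total degree is `3n + 3`, while `i, j, k ≤ n` and `l ≤ 3`, so all bounds are attained.
    · obtain ⟨rfl, rfl, rfl, rfl⟩ : i = n ∧ j = n ∧ k = n ∧ l = 3 := by omega
      exact ⟨1, 0, zero_mem _, 0, zero_mem _, 0, zero_mem _, by simp⟩
  | zero => exact ⟨0, 0, zero_mem _, 0, zero_mem _, 0, zero_mem _, by simp⟩
  | add s t _ _ hs ht =>
    obtain ⟨ε, A, hA, B, hB, C, hC, rfl⟩ := hs
    obtain ⟨ε', A', hA', B', hB', C', hC', rfl⟩ := ht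
    refine ⟨ε + ε', A + A', add_mem hA hA', B + B', add_mem hB hB', C + C', add_mem hC hC', ?_⟩
    rw [add_smul]
    ring
  | smul r s _ hs =>
    obtain ⟨ε, A, hA, B, hB, C, hC, rfl⟩ := hs
    refine ⟨r * ε, r • A, Submodule.smul_mem _ _ hA, r • B, Submodule.smul_mem _ _ hB, r • C,
      Submodule.smul_mem _ _ hC, ?_⟩
    simp only [smul_eq_algebraMap_mul, map_mul]
    ring

/-- This is where ordinarity comes from: the square of the generator `w³ / (abc)` of `H²` reduces to
the generator itself, with coefficient `1`. -/
lemma coord_pow_six : ∃ A ∈ coordGrading K 4, ∃ B ∈ coordGrading K 4, ∃ C ∈ coordGrading K 4,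
    coord K 3 ^ 6 = lin K 0 * lin K 1 * lin K 2 * coord K 3 ^ 3 + lin K 0 ^ 2 * A +
      lin K 1 ^ 2 * B + lin K 2 ^ 2 * C := by
  have hw := coord_pow_four (K := K)
  have h2 := two_eq_zero_of_algebra K (CoordRing K)
  obtain ⟨a, ha⟩ : ∃ a, a = lin K 0 := ⟨_, rfl⟩
  obtain ⟨b, hb⟩ : ∃ b, b = lin K 1 := ⟨_, rfl⟩
  obtain ⟨c, hc⟩ : ∃ c, c = lin K 2 := ⟨_, rfl⟩
  obtain ⟨w, hw'⟩ : ∃ w, w = coord K 3 := ⟨_, rfl⟩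
  have ha1 : a ∈ coordGrading K 1 := ha ▸ lin_mem K 0
  have hb1 : b ∈ coordGrading K 1 := hb ▸ lin_mem K 1
  have hc1 : c ∈ coordGrading K 1 := hc ▸ lin_mem K 2
  have hw1 : w ∈ coordGrading K 1 := hw' ▸ coord_mem K 3
  rw [← ha, ← hb, ← hc, ← hw'] at hw ⊢
  have m2 {x y : CoordRing K} (hx : x ∈ coordGrading K 1) (hy : y ∈ coordGrading K 1) :
    x * y ∈ coordGrading K 2 := SetLike.mul_mem_graded hx hy
  have m4 {x y : CoordRing K} (hx : x ∈ coordGrading K 2) (hy : y ∈ coordGrading K 2) :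
    x * y ∈ coordGrading K 4 := SetLike.mul_mem_graded hx hy
  have he : a + b + c ∈ coordGrading K 1 := add_mem (add_mem ha1 hb1) hc1
  have hq : w * w + (a + b + c) * w + a * c ∈ coordGrading K 2 :=
    add_mem (add_mem (m2 hw1 hw1) (m2 he hw1)) (m2 ha1 hc1)
  have hA : w * w + a * w + b * w + a * b ∈ coordGrading K 2 :=
    add_mem (add_mem (add_mem (m2 hw1 hw1) (m2 ha1 hw1)) (m2 hb1 hw1)) (m2 ha1 hb1)
  have hB : w * w + b * w + c * w + b * c ∈ coordGrading K 2 :=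
    add_mem (add_mem (add_mem (m2 hw1 hw1) (m2 hb1 hw1)) (m2 hc1 hw1)) (m2 hb1 hc1)
  have hC : w * w + c * w ∈ coordGrading K 2 := add_mem (m2 hw1 hw1) (m2 hc1 hw1)
  have hww := m4 (m2 hw1 hw1) (m2 hw1 hw1)
  refine ⟨_, add_mem (add_mem (add_mem (add_mem (m4 hq hA) hww) (m4 (m2 hb1 hc1) (m2 hw1 hw1)))
    (m4 (m2 hc1 hc1) (m2 hw1 hw1))) (m4 (m2 hb1 hc1) (m2 hc1 hw1)),
    _, add_mem (add_mem (m4 hq hB) hww) (m4 (m2 ha1 hc1) (m2 hw1 hw1)),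
    _, add_mem (add_mem (m4 hq hC) hww) (m4 (m2 ha1 hb1) (m2 hw1 hw1)), ?_⟩
  -- The multiplier is the quotient, modulo two, of `w⁶` by the quartic as a polynomial in `w`.
  linear_combination (w ^ 2 + (a + b + c) * w + a * c) * hw +
    (a * c * (a + b + c) * w ^ 3 + (a * b + b * c + a * c) * w ^ 4) * h2

end Spanning

/-! ### Sections as homogeneous fractions -/

section Fractions

open HomogeneousLocalization

variable {R A : Type u} [CommRing R] [CommRing A] [Algebra R A] {𝒜 : ℕ → Submodule R A}
  [GradedAlgebra 𝒜] {Y : Scheme.{u}} (g : Y ⟶ Proj 𝒜)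

/-- The sections of a scheme over `Proj` defined by homogeneous fractions. -/
def fractionSection (f : A) : Away 𝒜 f →+* Γ(Y, g ⁻¹ᵁ Proj.basicOpen 𝒜 f) :=
  (Proj.awayToSection 𝒜 f ≫ g.app (Proj.basicOpen 𝒜 f)).hom

lemma fractionSection_bijective [IsIso g] {f : A} {d : ℕ} (hf : f ∈ 𝒜 d) (hd : 0 < d) :
    Function.Bijective (fractionSection g f) := by
  have : IsIso (Proj.awayToSection 𝒜 f) := by
    rw [← Proj.basicOpenIsoAway_hom 𝒜 f hf hd]
    infer_instance
  exact ConcreteCategory.bijective_of_isIso (Proj.awayToSection 𝒜 f ≫ g.app (Proj.basicOpen 𝒜 f))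

lemma restrict_fractionSection {f h x : A} {d : ℕ} (hh : h ∈ 𝒜 d) (hx : x = f * h)
    (hle : g ⁻¹ᵁ Proj.basicOpen 𝒜 x ≤ g ⁻¹ᵁ Proj.basicOpen 𝒜 f) (a : Away 𝒜 f) :
    restrict hle (fractionSection g f a) = fractionSection g x (awayMap 𝒜 hh hx a) := by
  have h₁ := Proj.awayMap_awayToSection 𝒜 hh hx
  have h₂ : CommRingCat.ofHom (awayMap 𝒜 hh hx) ≫ Proj.awayToSection 𝒜 x ≫ g.app _ =
      Proj.awayToSection 𝒜 f ≫ g.app _ ≫ Y.presheaf.map (homOfLE hle).op := by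
    rw [reassoc_of% h₁, Scheme.Hom.naturality]
    rfl
  exact congrArg (fun φ => φ.hom a) h₂.symm

/-- A single ring, the localization at `m`, receives the sections over all opens `D(f)` with `f`
dividing `m`; there they are the fractions `p / fⁿ` of degree zero. Čech identities thereby become
identities between homogeneous elements. -/
lemma exists_fractionHom [IsIso g] {m : A} {d : ℕ} (hm : m ∈ 𝒜 d) (hd : 0 < d) {O : Y.Opens}
    (hO : O = g ⁻¹ᵁ Proj.basicOpen 𝒜 m) :
    ∃ Φ : Γ(Y, O) →+* Localization.Away m, Function.Injective Φ ∧
      ∀ {f h : A} {d₁ d₂ : ℕ} (_ : f ∈ 𝒜 d₁) (_ : h ∈ 𝒜 d₂) (_ : 0 < d₁) (_ : m = f * h)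
        {O' : Y.Opens} (_ : O' = g ⁻¹ᵁ Proj.basicOpen 𝒜 f) (hle : O ≤ O'),
        (∀ s : Γ(Y, O'), ∃ n, ∃ p ∈ 𝒜 (n • d₁),
          Φ (restrict hle s) * algebraMap A _ f ^ n = algebraMap A _ p) ∧
        (∀ n, ∀ p ∈ 𝒜 (n • d₁), ∃ s : Γ(Y, O'),
          Φ (restrict hle s) * algebraMap A _ f ^ n = algebraMap A _ p) ∧
        (Function.Injective (algebraMap A (Localization.Away m)) →
          Function.Injective fun s => Φ (restrict hle s)) := by
  subst hO
  let e := RingEquiv.ofBijective _ (fractionSection_bijective g hm hd)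
  let Φ : Γ(Y, g ⁻¹ᵁ Proj.basicOpen 𝒜 m) →+* Localization.Away m :=
    (algebraMap (Away 𝒜 m) (Localization.Away m)).comp e.symm
  have hΦ (a : Away 𝒜 m) : Φ (fractionSection g m a) = a.val :=
    congrArg (algebraMap (Away 𝒜 m) (Localization.Away m)) (e.symm_apply_apply a)
  refine ⟨Φ, (val_injective _).comp e.symm.injective, ?_⟩
  rintro f h d₁ d₂ hf hh hd₁ hmfh O' rfl hle
  have key (n : ℕ) (p : A) (hp : p ∈ 𝒜 (n • d₁)) :
      Φ (restrict hle (fractionSection g f (Away.mk 𝒜 hf n p hp))) * algebraMap A _ f ^ n =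
        algebraMap A _ p := by
    rw [restrict_fractionSection g hh hmfh, hΦ, awayMap_mk, Away.val_mk, Localization.mk_eq_mk',
      ← map_pow, mul_comm,
      IsLocalization.mul_mk'_eq_mk'_of_mul, IsLocalization.mk'_eq_iff_eq_mul, ← map_mul]
    congr 1
    simp only [hmfh]
    ring
  have hsurj (s) : ∃ (n : ℕ) (p : A) (hp : p ∈ 𝒜 (n • d₁)),
      fractionSection g f (Away.mk 𝒜 hf n p hp) = s := by
    obtain ⟨a, rfl⟩ := (fractionSection_bijective g hf hd₁).2 s
    obtain ⟨n, p, hp, rfl⟩ := Away.mk_surjective 𝒜 hf a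
    exact ⟨n, p, hp, rfl⟩
  refine ⟨fun s => ?_, fun n p hp => ⟨_, key n p hp⟩, fun hinj => ?_⟩
  · obtain ⟨n, p, hp, rfl⟩ := hsurj s
    exact ⟨n, p, hp, key n p hp⟩
  · refine (injective_iff_map_eq_zero (Φ.comp (restrict hle))).2 fun s hs => ?_
    obtain ⟨n, p, hp, rfl⟩ := hsurj s
    have h0 := key n p hp
    rw [← RingHom.comp_apply, hs, zero_mul] at h0
    obtain rfl : p = 0 := hinj (h0.symm.trans (map_zero _).symm)
    have : Away.mk 𝒜 hf n 0 hp = 0 := by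
      apply val_injective
      rw [Away.val_mk, Localization.mk_zero, val_zero]
    rw [this, map_zero]

end Fractions

open Opposite

/-! ### Common denominators and homogeneous components -/

section HomogeneousFractions

variable {R A T : Type*} [CommRing R] [CommRing A] [Algebra R A] {𝒜 : ℕ → Submodule R A}
  [GradedAlgebra 𝒜] [CommRing T] [Algebra A T]

lemma exists_fraction_of_le {f t} {d n : ℕ} (hf : f ∈ 𝒜 d)
    (h : ∃ p ∈ 𝒜 (n • d), t * algebraMap A T f ^ n = algebraMap A T p) {N : ℕ} (hN : n ≤ N) :
    ∃ p ∈ 𝒜 (N • d), t * algebraMap A T f ^ N = algebraMap A T p := by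
  obtain ⟨k, rfl⟩ := Nat.exists_eq_add_of_le hN
  obtain ⟨p, hp, h⟩ := h
  refine ⟨p * f ^ k, ?_, ?_⟩
  · rw [add_smul]
    exact SetLike.mul_mem_graded hp (SetLike.pow_mem_graded k hf)
  · rw [pow_add, ← mul_assoc, h, map_mul, map_pow]

/-- Taking homogeneous components makes the Koszul coefficients homogeneous, as needed for them to
define sections. -/
lemma eq_decompose_mul_sub {p u v x y : A} {i j : ℕ} (hp : p ∈ 𝒜 (i + j)) (hx : x ∈ 𝒜 j)
    (hy : y ∈ 𝒜 j) (h : p = u * x - v * y) :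
    p = DirectSum.decompose 𝒜 u i * x - DirectSum.decompose 𝒜 v i * y := by
  have h₁ := DirectSum.decompose_of_mem_same 𝒜 hp
  rw [h, DirectSum.decompose_sub, DirectSum.sub_apply, Submodule.coe_sub,
    DirectSum.coe_decompose_mul_add_of_right_mem 𝒜 hx,
    DirectSum.coe_decompose_mul_add_of_right_mem 𝒜 hy] at h₁
  rw [h₁, h]

end HomogeneousFractions

/-! ### Vanishing of `H¹` -/

section CechQuartic

/-- The product of the three linear coordinates. -/
def linProd (K : Type u) [Field K] : CoordRing K := lin K 0 * lin K 1 * lin K 2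

variable {K : Type u} [Field K]

lemma linProd_mem : linProd K ∈ coordGrading K 3 :=
  SetLike.mul_mem_graded (SetLike.mul_mem_graded (lin_mem K 0) (lin_mem K 1)) (lin_mem K 2)

lemma isUnit_algebraMap_lin (i : Fin 3) :
    IsUnit (algebraMap (CoordRing K) (Localization.Away (linProd K)) (lin K i)) := by
  have h := IsLocalization.Away.algebraMap_isUnit (S := Localization.Away (linProd K)) (linProd K)
  refine isUnit_of_dvd_unit (map_dvd _ ?_) h
  obtain rfl | rfl | rfl : i = 0 ∨ i = 1 ∨ i = 2 := by revert i; decide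
  · exact Dvd.intro _ (mul_assoc ..).symm
  · exact ⟨lin K 0 * lin K 2, by rw [linProd]; ring⟩
  · exact Dvd.intro_left _ rfl

section Opens

variable {Y : Scheme.{u}} (e : quarticScheme K ≅ Y)

/-- The affine open where a linear coordinate does not vanish. -/
def linOpen (i : Fin 3) : Y.Opens := e.inv ⁻¹ᵁ dPlus K (lin K i)

lemma isAffineOpen_preimage {f : CoordRing K} {d : ℕ} (hf : f ∈ coordGrading K d) (hd : 0 < d) :
    IsAffineOpen (e.inv ⁻¹ᵁ dPlus K f) :=
  IsAffineOpen.preimage_of_isIso (show IsAffineOpen (dPlus K f) from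
    Proj.isAffineOpen_basicOpen _ f hf hd) e.inv

lemma linOpen_inf (i j : Fin 3) :
    linOpen e i ⊓ linOpen e j = e.inv ⁻¹ᵁ dPlus K (lin K i * lin K j) := by
  rw [dPlus, Proj.basicOpen_mul]
  rfl

lemma linOpen_inf_inf :
    linOpen e 0 ⊓ linOpen e 1 ⊓ linOpen e 2 = e.inv ⁻¹ᵁ dPlus K (linProd K) := by
  rw [dPlus, linProd, Proj.basicOpen_mul, Proj.basicOpen_mul]
  rfl

end Opens

variable [CharP K 2]

lemma algebraMap_linProd_injective :
    Function.Injective (algebraMap (CoordRing K) (Localization.Away (linProd K))) := by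
  have h (i : Fin 3) : lin K i ∈ nonZeroDivisors (CoordRing K) := mem_nonZeroDivisors_iff.2
    ⟨fun s => eq_zero_of_lin_mul_eq_zero,
      fun s hs => eq_zero_of_lin_mul_eq_zero ((mul_comm _ _).trans hs)⟩
  have hm : linProd K ∈ nonZeroDivisors (CoordRing K) := mul_mem (mul_mem (h 0) (h 1)) (h 2)
  exact IsLocalization.injective _ (M := Submonoid.powers (linProd K)) (Submonoid.powers_le.2 hm)

/-- A prime containing the three linear forms contains `w⁴` by `coord_pow_four`, hence `w` and the
irrelevant ideal. -/
lemma iSup_dPlus_lin : dPlus K (lin K 0) ⊔ dPlus K (lin K 1) ⊔ dPlus K (lin K 2) = ⊤ := by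
  refine top_le_iff.1 fun (x : Proj (coordGrading K)) _ => ?_
  by_contra hx
  have h₀ : lin K 0 ∈ x.asHomogeneousIdeal.toIdeal := by
    by_contra hi
    exact hx (Or.inl (Or.inl hi))
  have h₁ : lin K 1 ∈ x.asHomogeneousIdeal.toIdeal := by
    by_contra hi
    exact hx (Or.inl (Or.inr hi))
  have h₂ : lin K 2 ∈ x.asHomogeneousIdeal.toIdeal := by
    by_contra hi
    exact hx (Or.inr hi)
  have hprime : x.asHomogeneousIdeal.toIdeal.IsPrime := x.isPrime
  obtain ⟨P, hP⟩ : ∃ P, P = x.asHomogeneousIdeal.toIdeal := ⟨_, rfl⟩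
  rw [← hP] at h₀ h₁ h₂ hprime
  have hw : coord K 3 ∈ P := by
    refine hprime.mem_of_pow_mem 4 ?_
    rw [coord_pow_four]
    have e (p q r : CoordRing K) : p * lin K 0 + q * lin K 1 + r * lin K 2 ∈ P :=
      add_mem (add_mem (P.mul_mem_left _ h₀) (P.mul_mem_left _ h₁)) (P.mul_mem_left _ h₂)
    convert e (coord K 3 ^ 3 + (lin K 0 + lin K 2) * coord K 3 ^ 2 +
        (lin K 0 ^ 2 + lin K 0 * lin K 1 + lin K 1 * lin K 2) * coord K 3 +
        lin K 0 ^ 2 * lin K 1)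
      (coord K 3 ^ 3 + lin K 1 * coord K 3 ^ 2 + (lin K 1 ^ 2 + lin K 1 * lin K 2) * coord K 3 +
        lin K 1 ^ 2 * lin K 2)
      (coord K 3 ^ 3 + lin K 2 * coord K 3 ^ 2 + lin K 2 ^ 2 * coord K 3) using 1
    ring
  refine x.not_irrelevant_le ((irrelevant_le_span_coord K).trans ?_)
  refine le_of_le_of_eq ?_ hP
  rw [Ideal.span_le]
  rintro _ ⟨i, rfl⟩
  obtain rfl | rfl | rfl | rfl : i = 0 ∨ i = 1 ∨ i = 2 ∨ i = 3 := by revert i; decide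
  · exact (lin_add_coord (K := K) 0) ▸ add_mem h₀ hw
  · exact (lin_add_coord (K := K) 1) ▸ add_mem h₁ hw
  · exact (lin_add_coord (K := K) 2) ▸ add_mem h₂ hw
  · exact hw

variable {Y : Scheme.{u}}

lemma iSup_linOpen (e : quarticScheme K ≅ Y) : linOpen e 0 ⊔ linOpen e 1 ⊔ linOpen e 2 = ⊤ := by
  have := congrArg (e.inv ⁻¹ᵁ ·) (iSup_dPlus_lin (K := K))
  exact this

/-- With a common exponent `N` in the denominators, a Čech cocycle is a relation among the `N`-th
powers of the linear forms. Exactness of the Koszul complex solves it, and the homogeneous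
components of the solution give the cochain. -/
theorem subsingleton_h_one_of_iso (e : quarticScheme K ≅ Y) : Subsingleton (H Y 1) := by
  refine subsingleton_h_one (U := linOpen e 0) (V := linOpen e 1) (W := linOpen e 2)
    (isAffineOpen_preimage e (lin_mem K 0) one_pos)
    (isAffineOpen_preimage e (lin_mem K 1) one_pos) (isAffineOpen_preimage e (lin_mem K 2) one_pos)
    (iSup_linOpen e) ?_
  intro s t r hstr
  let g : Y ⟶ Proj (coordGrading K) := e.inv
  have : IsIso g := inferInstanceAs (IsIso e.inv)
  obtain ⟨Φ, -, key⟩ := exists_fractionHom g linProd_mem three_pos (linOpen_inf_inf e)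
  have ha := lin_mem K 0
  have hb := lin_mem K 1
  have hc := lin_mem K 2
  have hab : lin K 0 * lin K 1 ∈ coordGrading K 2 := SetLike.mul_mem_graded ha hb
  have hbc : lin K 1 * lin K 2 ∈ coordGrading K 2 := SetLike.mul_mem_graded hb hc
  have hac : lin K 0 * lin K 2 ∈ coordGrading K 2 := SetLike.mul_mem_graded ha hc
  have kU := key ha hbc one_pos (by rw [linProd]; ring) (O' := linOpen e 0) rfl
    (inf_le_left.trans inf_le_left)
  have kV := key hb hac one_pos (by rw [linProd]; ring) (O' := linOpen e 1) rfl
    (inf_le_left.trans inf_le_right)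
  have kW := key hc hab one_pos (by rw [linProd]; ring) (O' := linOpen e 2) rfl inf_le_right
  have kUV := key hab hc two_pos (by rw [linProd]) (linOpen_inf e 0 1) inf_le_left
  have kVW := key hbc ha two_pos (by rw [linProd]; ring) (linOpen_inf e 1 2)
    (inf_le_inf_right _ inf_le_right)
  have kUW := key hac hb two_pos (by rw [linProd]; ring) (linOpen_inf e 0 2)
    (inf_le_inf_right _ inf_le_left)
  clear key
  obtain ⟨n₁, hs⟩ := kUV.1 s
  obtain ⟨n₂, ht⟩ := kVW.1 t
  obtain ⟨n₃, hr⟩ := kUW.1 r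
  obtain ⟨N, h₁, h₂, h₃⟩ : ∃ N, n₁ ≤ N ∧ n₂ ≤ N ∧ n₃ ≤ N :=
    ⟨n₁ + n₂ + n₃, by omega, by omega, by omega⟩
  obtain ⟨p, hp, hs⟩ := exists_fraction_of_le hab hs h₁
  obtain ⟨q, hq, ht⟩ := exists_fraction_of_le hbc ht h₂
  obtain ⟨o, ho, hr⟩ := exists_fraction_of_le hac hr h₃
  have hΦ := (map_add Φ _ _).symm.trans (congrArg Φ hstr)
  have hinj := algebraMap_linProd_injective (K := K)
  have hpqo : p * lin K 2 ^ N + q * lin K 0 ^ N = o * lin K 1 ^ N := by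
    apply hinj
    simp only [map_mul, map_add, map_pow] at hs ht hr ⊢
    rw [← hs, ← ht, ← hr, ← hΦ]
    ring
  obtain ⟨α, β, γ, hp', hq', ho'⟩ := exists_koszul (by decide) (by decide) (by decide) hpqo
  have e2 : N • 2 = N • 1 + N • 1 := by simp [mul_two]
  rw [e2] at hp hq ho
  have han := SetLike.pow_mem_graded N ha
  have hbn := SetLike.pow_mem_graded N hb
  have hcn := SetLike.pow_mem_graded N hc
  replace hp' := eq_decompose_mul_sub hp han hbn hp'
  replace hq' := eq_decompose_mul_sub hq hbn hcn hq'
  replace ho' := eq_decompose_mul_sub ho han hcn ho'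
  obtain ⟨α', hα⟩ := kU.2.1 N _ (DirectSum.decompose (coordGrading K) α (N • 1)).2
  obtain ⟨β', hβ⟩ := kV.2.1 N _ (DirectSum.decompose (coordGrading K) β (N • 1)).2
  obtain ⟨γ', hγ⟩ := kW.2.1 N _ (DirectSum.decompose (coordGrading K) γ (N • 1)).2
  have hu (i j : Fin 3) : IsUnit ((algebraMap (CoordRing K) (Localization.Away (linProd K))
      (lin K i * lin K j)) ^ N) := by
    rw [map_mul]
    exact ((isUnit_algebraMap_lin i).mul (isUnit_algebraMap_lin j)).pow N
  refine ⟨α', β', γ', kUV.2.2 hinj ((hu 0 1).mul_right_cancel ?_),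
    kVW.2.2 hinj ((hu 1 2).mul_right_cancel ?_), kUW.2.2 hinj ((hu 0 2).mul_right_cancel ?_)⟩
  · simp only [map_sub, restrict_restrict]
    rw [hs, hp', map_sub, map_mul, map_mul, ← hα, ← hβ]
    simp only [map_mul, map_pow]
    ring
  · simp only [map_sub, restrict_restrict]
    rw [ht, hq', map_sub, map_mul, map_mul, ← hβ, ← hγ]
    simp only [map_mul, map_pow]
    ring
  · simp only [map_sub, restrict_restrict]
    rw [hr, ho', map_sub, map_mul, map_mul, ← hα, ← hγ]
    simp only [map_mul, map_pow]
    ring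

end CechQuartic

/-! ### Frobenius on `H²` -/

open Opposite

/-- Here `x = k w³ / (abc) + s + t + r` with `k² = k`. Squaring in characteristic two gives `k w⁶ /
(abc)² + s² + t² + r²`, and `hw` turns the first term into `k w³ / (abc) + k (s' + t' + r')`. -/
lemma sq_eq_of_fraction {A T : Type*} [CommRing A] [CommRing T] (ψ : A →+* T) (h2 : (2 : T) = 0)
    {a b c w p q o p' q' o' : A} {x s t r s' t' r' : T} (hu : IsUnit (ψ (a * b * c))) {k n : ℕ}
    (hk : k < 2)
    (hx : x * ψ (a * b * c) ^ (n + 1) = ψ (k * (a ^ n * b ^ n * c ^ n * w ^ 3) +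
      a ^ (n + 1) * p + b ^ (n + 1) * q + c ^ (n + 1) * o))
    (hs : s * ψ (b * c) ^ (n + 1) = ψ p) (ht : t * ψ (a * c) ^ (n + 1) = ψ q)
    (hr : r * ψ (a * b) ^ (n + 1) = ψ o)
    (hw : w ^ 6 = a * b * c * w ^ 3 + a ^ 2 * p' + b ^ 2 * q' + c ^ 2 * o')
    (hs' : s' * ψ (b * c) ^ 2 = ψ p') (ht' : t' * ψ (a * c) ^ 2 = ψ q')
    (hr' : r' * ψ (a * b) ^ 2 = ψ o') :
    x ^ 2 = x + (k * r' + r ^ 2 - r) + (k * s' + s ^ 2 - s) + (k * t' + t ^ 2 - t) := by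
  have hk' : (k : T) ^ 2 = k := by
    obtain rfl | rfl : k = 0 ∨ k = 1 := by omega
    · simp
    · simp
  replace hw := congrArg ψ hw
  simp only [map_add, map_mul, map_pow, map_natCast, ← hs, ← ht, ← hr, ← hs', ← ht', ← hr']
    at hx hw hu
  generalize (k : T) = k at *
  generalize ψ a = a at *
  generalize ψ b = b at *
  generalize ψ c = c at *
  generalize ψ w = w at *
  have hx' : x * (a * b * c) = k * w ^ 3 + a * b * c * (s + t + r) := by
    refine (hu.pow n).mul_right_cancel ?_
    simp only [mul_pow] at hx ⊢
    linear_combination hx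
  refine (hu.pow 2).mul_right_cancel ?_
  linear_combination (x * (a * b * c) + k * w ^ 3 + a * b * c * (s + t + r) - a * b * c) * hx' +
    k * hw + w ^ 6 * hk' +
    (a * b * c) * ((a * b * c) * (s * t + s * r + t * r) + k * w ^ 3 * (s + t + r)) * h2

section

variable {Y : Scheme.{0}} {f : Y ⟶ Spec (.of (ZMod 2))}

/-- By `h_two_map_eq` it suffices to compare a section on the triple intersection with its square.
Such a section is `ε w³ / (abc)` plus sections from the double intersections, and `ε ∈ 𝔽₂` equals
its square. -/
theorem h_two_frobenius_eq (e : quarticScheme (ZMod 2) ≅ Y) (x : H Y 2) :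
    Sheaf.H.map (frobenius 2 f) 2 x = x := by
  have ha := lin_mem (ZMod 2) 0
  have hb := lin_mem (ZMod 2) 1
  have hc := lin_mem (ZMod 2) 2
  have hab : lin (ZMod 2) 0 * lin (ZMod 2) 1 ∈ coordGrading (ZMod 2) 2 :=
    SetLike.mul_mem_graded ha hb
  have hbc : lin (ZMod 2) 1 * lin (ZMod 2) 2 ∈ coordGrading (ZMod 2) 2 :=
    SetLike.mul_mem_graded hb hc
  have hac : lin (ZMod 2) 0 * lin (ZMod 2) 2 ∈ coordGrading (ZMod 2) 2 :=
    SetLike.mul_mem_graded ha hc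
  have hU (i j : Fin 3) : IsAffineOpen (linOpen e i ⊓ linOpen e j) := by
    rw [linOpen_inf]
    exact isAffineOpen_preimage e (SetLike.mul_mem_graded (lin_mem _ i) (lin_mem _ j)) two_pos
  refine h_two_map_eq (U := linOpen e 0) (V := linOpen e 1) (W := linOpen e 2)
    (isAffineOpen_preimage e ha one_pos) (isAffineOpen_preimage e hb one_pos)
    (isAffineOpen_preimage e hc one_pos) (hU 0 1) (hU 1 2) (hU 0 2) (iSup_linOpen e) _ ?_ x
  change ∀ s : Γ(Y, linOpen e 0 ⊓ linOpen e 1 ⊓ linOpen e 2),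
    ∃ (a : Γ(Y, linOpen e 0 ⊓ linOpen e 1)) (b : Γ(Y, linOpen e 1 ⊓ linOpen e 2))
      (c : Γ(Y, linOpen e 0 ⊓ linOpen e 2)), s ^ 2 = s + restrict inf_le_left a +
        restrict (inf_le_inf_right _ inf_le_right) b + restrict (inf_le_inf_right _ inf_le_left) c
  intro σ
  let g : Y ⟶ Proj (coordGrading (ZMod 2)) := e.inv
  have : IsIso g := inferInstanceAs (IsIso e.inv)
  obtain ⟨Φ, hΦ, key⟩ := exists_fractionHom g linProd_mem three_pos (linOpen_inf_inf e)
  -- The trivial factorization `linProd * 1` describes the sections on the triple intersection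
  -- itself.
  have kσ := (key linProd_mem (SetLike.GradedOne.one_mem) three_pos (mul_one _).symm
    (linOpen_inf_inf e) le_rfl).1 σ
  have kUV := (key hab hc two_pos (by rw [linProd]) (linOpen_inf e 0 1) inf_le_left).2.1
  have kVW := (key hbc ha two_pos (by rw [linProd]; ring) (linOpen_inf e 1 2)
    (inf_le_inf_right _ inf_le_right)).2.1
  have kUW := (key hac hb two_pos (by rw [linProd]; ring) (linOpen_inf e 0 2)
    (inf_le_inf_right _ inf_le_left)).2.1
  clear key
  have hres : restrict (le_refl (linOpen e 0 ⊓ linOpen e 1 ⊓ linOpen e 2)) σ = σ :=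
    ConcreteCategory.congr_hom (Y.presheaf.map_id _) σ
  rw [hres] at kσ
  obtain ⟨n, kσ⟩ := kσ
  obtain ⟨p, hp, hx⟩ := exists_fraction_of_le linProd_mem kσ n.le_succ
  rw [smul_eq_mul, mul_comm] at hp
  obtain ⟨ε, A, hA, B, hB, C, hC, rfl⟩ := exists_eq_add_of_mem hp
  obtain ⟨A', hA', B', hB', C', hC', hw⟩ := coord_pow_six (K := ZMod 2)
  rw [mul_comm] at hA hB hC
  obtain ⟨s, hs⟩ := kVW (n + 1) A hA
  obtain ⟨t, ht⟩ := kUW (n + 1) B hB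
  obtain ⟨r, hr⟩ := kUV (n + 1) C hC
  obtain ⟨s', hs'⟩ := kVW 2 A' hA'
  obtain ⟨t', ht'⟩ := kUW 2 B' hB'
  obtain ⟨r', hr'⟩ := kUV 2 C' hC'
  have hε : algebraMap (ZMod 2) (CoordRing (ZMod 2)) ε = (ε.val : ℕ) := by
    conv_lhs => rw [← ZMod.natCast_zmod_val ε]
    exact map_natCast _ _
  have h2 : (2 : Localization.Away (linProd (ZMod 2))) = 0 :=
    two_eq_zero_of_algebra (ZMod 2) _
  rw [smul_eq_algebraMap_mul, hε] at hx
  refine ⟨(ε.val : ℕ) * r' + r ^ 2 - r, (ε.val : ℕ) * s' + s ^ 2 - s,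
    (ε.val : ℕ) * t' + t ^ 2 - t, hΦ ?_⟩
  simp only [map_add, map_sub, map_mul, map_pow, map_natCast]
  exact sq_eq_of_fraction (algebraMap (CoordRing (ZMod 2)) _) h2
    (IsLocalization.Away.algebraMap_isUnit (linProd (ZMod 2))) ε.val_lt hx hs ht hr hw hs' ht' hr'

end

/-! ### The reduction as an ordinary K3 surface -/

lemma isK3Surface_of_iso {K : Type u} [Field K] [CharP K 2] {Y : Scheme.{u}}
    {f : Y ⟶ Spec (.of K)} (e : quarticScheme K ≅ Y) (he : e.hom ≫ f = quarticStr K) :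
    IsK3Surface f := by
  have hf : f = e.inv ≫ quarticStr K := by rw [← he, e.inv_hom_id_assoc]
  have : Nonempty Y := (inferInstance : Nonempty (quarticScheme K)).map e.hom
  have : IsIntegral Y := isIntegral_of_isOpenImmersion e.inv
  refine ⟨?_, ?_, ?_, exists_trivializes_of_iso e he, subsingleton_h_one_of_iso e⟩
  · rw [hf]
    infer_instance
  · have : IsZariskiLocalAtSource (@SmoothOfRelativeDimension 2) :=
      HasRingHomProperty.instIsZariskiLocalAtSource
        (Q := RingHom.Locally (RingHom.IsStandardSmoothOfRelativeDimension 2))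
    rw [hf]
    exact IsZariskiLocalAtSource.comp (smoothOfRelativeDimension_quarticStr (R := K)) _
  · rw [hf]
    exact ⟨(MorphismProperty.cancel_left_of_respectsIso (geometrically IsIntegral) e.inv _).2
      (geometricallyIntegral_quarticStr K).1⟩

lemma isOrdinaryK3Surface_reduction₂ : IsOrdinaryK3Surface 2 reduction₂ := by
  obtain ⟨e, he⟩ := exists_iso_reduction₂
  refine ⟨isK3Surface_of_iso e he, ?_⟩
  have h := h_two_frobenius_eq (f := reduction₂) e
  exact ⟨fun x y hxy => (h x).symm.trans (hxy.trans (h y)), fun x => ⟨x, h x⟩⟩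

end

end OrdinaryK3

theorem lemma2 :
    OrdinaryK3.IsOrdinaryK3Surface 2 OrdinaryK3.reduction₂ ∧
      Nat.card (OrdinaryK3.Points OrdinaryK3.reduction₂) = 10 ∧
      OrdinaryK3.IsGoodModelAt 2 (OrdinaryK3.quarticStr ℚ) OrdinaryK3.model₂ :=
  ⟨OrdinaryK3.isOrdinaryK3Surface_reduction₂, OrdinaryK3.card_points_reduction₂,
    OrdinaryK3.isGoodModelAt_model₂⟩
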